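/- Let $k$ be an algebraically closed field (of any characteristic), let $m\ge 4$ be an integer with $3\nmid m$, and put $(a,b,c)=(7m-3,\,5m^2-2m,\,8m-3)$. Let $\mathbb P=\mathbb P(a,b,c)=\operatorname{Proj}k[x,y,z]$ with $\deg x=a$, $\deg y=b$, $\deg z=c$. Let $e=V_+(\mathfrak p)\in\mathbb P$ be the identity of the open torus, where $\mathfrak p$ is the kernel of $k[x,y,z]\to k[t]$, $x\mapsto t^a$, $y\mapsto t^b$, $z\mapsto t^c$. Let $\pi:X=\mathrm{Bl}_e\mathbb P\to\mathbb P$ be the blow-up of $\mathbb P$ at $e$ (an integral locally Noetherian scheme), with exceptional divisor $E$. Choose integers $m_1,m_2,m_3$ with $m_1a+m_2b+m_3c=1$ and let $A=m_1\pi^{-1}(V_+(x))+m_2\pi^{-1}(V_+(y))+m_3\pi^{-1}(V_+(z))$. Let $C\subset X$ be the proper transform of the curve $y^3=x^mz^m$ in $\mathbb P$. For an integer $d\ge 0$ let $D_d\in\mathrm{Cl}(X)$ be the class of $d(7m-3)(8m-3)A-3dE$. Let $\mathcal I$ be the set of effective Weil divisors $D$ on $X$ (including $D=0$) such that $D\cdot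 C=0$ and $D$ does not contain $C$ as a component. Then the set $$I=\{d\in\mathbb Z_{\ge 0}\mid \exists\, D\in\mathcal I \text{ with } [D]=D_d\}$$ equals $\mathbb Z_{\ge 0}\,d_0$ for some non-negative integer $d_0$. -/

import Mathlib

open AlgebraicGeometry CategoryTheory TopologicalSpace

universe u

namespace BlowUpPlane

noncomputable section

/-! ### Blow-ups -/

/-- The closed subscheme cut out by `J` is an effective Cartier divisor: locally `J` is generated
by one nonzerodivisor. -/
def IsEffectiveCartier {X : Scheme.{u}} (J : X.IdealSheafData) : Prop :=
  ∀ x : X, ∃ U : X.affineOpens, x ∈ U.1 ∧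
    ∃ f : Γ(X, U.1), f ∈ nonZeroDivisors Γ(X, U.1) ∧ J.ideal U = Ideal.span {f}

/-- `π : X ⟶ Y` is the blow-up of `Y` along the quasi-coherent ideal sheaf `I`: the inverse image
ideal sheaf `π⁻¹I · 𝒪_X` is invertible, and `π` is universal with this property. -/
structure IsBlowUp {X Y : Scheme.{u}} (π : X ⟶ Y) (I : Y.IdealSheafData) : Prop where
  isEffectiveCartier : IsEffectiveCartier (I.comap π)
  existsUnique_lift : ∀ (Z : Scheme.{u}) (g : Z ⟶ Y), IsEffectiveCartier (I.comap g) →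
    ∃! g' : Z ⟶ X, g' ≫ π = g

/-! ### Weil divisors -/

/-- Prime divisors of `X`, given by their generic points, the points of codimension one. -/
abbrev PrimeDivisor (X : Scheme.{u}) : Type u := {x : X // Order.coheight x = 1}

/-- Weil divisors on a (Noetherian) scheme: the free abelian group on the prime divisors.
A Weil divisor `D` is effective when `0 ≤ D`. -/
abbrev WeilDivisor (X : Scheme.{u}) : Type u := PrimeDivisor X →₀ ℤ

/-- The sum, with coefficients one, of the prime divisors contained in the closed set `Z`. -/
def divisorOfClosed {X : Scheme.{u}} (Z : Closeds X) : WeilDivisor X :=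
  ∑ᶠ x ∈ {x : PrimeDivisor X | x.1 ∈ Z}, Finsupp.single x 1

/-- Linear equivalence, that is, equality of classes in `Cl(X)`: the difference is the divisor of
a nonzero rational function. -/
def LinearlyEquivalent {X : Scheme.{u}} [IsIntegral X] [IsLocallyNoetherian X]
    (D D' : WeilDivisor X) : Prop :=
  ∃ f : X.functionField, f ≠ 0 ∧ ∀ x : PrimeDivisor X, D x - D' x = Scheme.ord f x.1

/-- No prime divisor contained in the closed set `C` is a component of `D`.  (If `C` is itself a
prime divisor, this says that `D` does not contain `C`.) -/
def HasNoComponentIn {X : Scheme.{u}} (D : WeilDivisor X) (C : Closeds X) : Prop :=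
  ∀ x : PrimeDivisor X, x.1 ∈ C → D x = 0

/-! ### Intersection numbers -/

/-- The stalk at `p` of an ideal sheaf, as an ideal of `𝒪_{X,p}`. -/
def stalkIdeal {X : Scheme.{u}} (J : X.IdealSheafData) (p : X) : Ideal (X.presheaf.stalk p) :=
  ⨆ (U : X.affineOpens) (hp : p ∈ U.1), (J.ideal U).map (X.presheaf.germ U.1 p hp).hom

/-- `f ∈ 𝒪_{X,p}` is a local equation at `p` of the divisor `n D`, where `D` is effective: it
vanishes to order `n D(x)` along each prime divisor `x` passing through `p`. -/
def IsLocalEquation {X : Scheme.{u}} (D : WeilDivisor X) (n : ℕ) (p : X)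
    (f : X.presheaf.stalk p) : Prop :=
  ∀ (x : PrimeDivisor X) (h : x.1 ⤳ p),
    Ring.ord (X.presheaf.stalk x.1) ((X.presheaf.stalkSpecializes h).hom f) =
      ((n * (D x).toNat : ℕ) : ℕ∞)

/-- The local intersection multiplicity at `p` of an effective `ℚ`-Cartier divisor `D` with a
reduced curve `C` none of whose components is in `D`: it is
`(1/n) * length (𝒪_{X,p} / (f, I_{C,p}))`, where `f` is a local equation at `p` of some multiple
`n D` with `n > 0`.  On a normal surface this value does not depend on `n` and `f`, so that the
infimum only selects it. -/
def localIntersection {X : Scheme.{u}} (D : WeilDivisor X) (C : Closeds X) (p : X) : ENNReal :=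
  ⨅ (n : ℕ) (_ : 0 < n) (f : X.presheaf.stalk p) (_ : IsLocalEquation D n p f),
    ((Module.length (X.presheaf.stalk p) (X.presheaf.stalk p ⧸
      (Ideal.span {f} ⊔ stalkIdeal (Scheme.IdealSheafData.vanishingIdeal C) p)) : ℕ∞) : ENNReal)
        / (n : ENNReal)

/-- The intersection number `D · C` of an effective `ℚ`-Cartier divisor `D` with a complete reduced
curve `C` none of whose components is in `D`, on a normal surface over an algebraically closed field
(so that all closed points have residue degree one): the sum of the local intersection
multiplicities at the closed points of `C`. -/
def intersectionNumber {X : Scheme.{u}} (D : WeilDivisor X) (C : Closeds X) : ENNReal :=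
  ∑' p : {p : X // IsClosed ({p} : Set X) ∧ p ∈ C}, localIntersection D C p.1

/-! ### Weighted projective planes -/

instance weightedGrading (k : Type u) [Field k] (w : Fin 3 → ℕ) :
    GradedAlgebra (MvPolynomial.weightedHomogeneousSubmodule k w) :=
  MvPolynomial.weightedGradedAlgebra k w

/-- The weighted projective plane `ℙ(w 0, w 1, w 2) = Proj k[x, y, z]`, where the variables
`x, y, z` are `X 0, X 1, X 2` and have degrees `w 0, w 1, w 2`. -/
abbrev weightedPlane (k : Type u) [Field k] (w : Fin 3 → ℕ) : Scheme.{u} :=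
  Proj (MvPolynomial.weightedHomogeneousSubmodule k w)

/-- The closed subset `V₊(s)` of the weighted projective plane. -/
def zeroLocus {k : Type u} [Field k] (w : Fin 3 → ℕ) (s : Set (MvPolynomial (Fin 3) k)) :
    Closeds (weightedPlane k w) :=
  ⟨ProjectiveSpectrum.zeroLocus (MvPolynomial.weightedHomogeneousSubmodule k w) s,
    ProjectiveSpectrum.isClosed_zeroLocus _ s⟩

/-- The ideal `𝔭` of the monomial curve: the kernel of `k[x, y, z] → k[t]`,
`x ↦ t ^ w 0`, `y ↦ t ^ w 1`, `z ↦ t ^ w 2`. -/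
def monomialPrime (k : Type u) [Field k] (w : Fin 3 → ℕ) : Ideal (MvPolynomial (Fin 3) k) :=
  RingHom.ker (MvPolynomial.aeval (R := k) fun i => (Polynomial.X : Polynomial k) ^ w i)

/-- The identity `e = V₊(𝔭)` of the open torus, as a (one-point) closed subset. -/
def torusIdentity (k : Type u) [Field k] (w : Fin 3 → ℕ) : Closeds (weightedPlane k w) :=
  zeroLocus w (monomialPrime k w : Set (MvPolynomial (Fin 3) k))

/-- `π : X ⟶ ℙ(w 0, w 1, w 2)` is the blow-up of the identity of the torus, with its reduced
structure. -/
def IsBlowUpAtIdentity {k : Type u} [Field k] {w : Fin 3 → ℕ} {X : Scheme.{u}}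
    (π : X ⟶ weightedPlane k w) : Prop :=
  IsBlowUp π (Scheme.IdealSheafData.vanishingIdeal (torusIdentity k w))

section Blowup

variable {k : Type u} [Field k] {w : Fin 3 → ℕ} {X : Scheme.{u}} (π : X ⟶ weightedPlane k w)

/-- The preimage of a closed subset. -/
def preimage (Z : Closeds (weightedPlane k w)) : Closeds X :=
  ⟨π ⁻¹' (Z : Set (weightedPlane k w)), Z.isClosed.preimage π.continuous⟩

/-- The proper transform of a closed subset of the plane: the closure of the preimage of its
complement of `e`. -/
def properTransform (Z : Closeds (weightedPlane k w)) : Closeds X :=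
  Closeds.closure (π ⁻¹' ((Z : Set (weightedPlane k w)) \ torusIdentity k w))

/-- The exceptional divisor `E`. -/
def exceptionalDivisor : WeilDivisor X :=
  divisorOfClosed (preimage π (torusIdentity k w))

/-- The divisor `A = ∑ r i • π⁻¹(D i)`, where `D i = V₊(X i)` are the torus invariant divisors. -/
def divisorA (r : Fin 3 → ℤ) : WeilDivisor X :=
  ∑ i, r i • divisorOfClosed (preimage π (zeroLocus w {MvPolynomial.X i}))

end Blowup

/-! ### The triples `(7m - 3, 5m² - 2m, 8m - 3)` -/

/-- The weights `(7m - 3, 5m² - 2m, 8m - 3)`. -/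
def weights (m : ℕ) : Fin 3 → ℕ := ![7 * m - 3, 5 * m ^ 2 - 2 * m, 8 * m - 3]

section Triples

variable {k : Type u} [Field k] {m : ℕ} {X : Scheme.{u}} (π : X ⟶ weightedPlane k (weights m))

/-- The curve `C`: the proper transform of `y³ = xᵐzᵐ`. -/
def curveC : Closeds X :=
  properTransform π
    (zeroLocus (weights m)
      {MvPolynomial.X 1 ^ 3 - MvPolynomial.X 0 ^ m * MvPolynomial.X 2 ^ m})

/-- The divisor `d(7m - 3)(8m - 3)A - 3dE`, which represents the class `D_d`. -/
def divisorD (r : Fin 3 → ℤ) (d : ℕ) : WeilDivisor X :=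
  ((d : ℤ) * (7 * m - 3) * (8 * m - 3)) • divisorA π r - (3 * (d : ℤ)) • exceptionalDivisor π

/-- The set `𝓘` of effective Weil divisors `D` on `X` that do not contain `C` and satisfy
`D · C = 0`. -/
def orthogonalDivisors : Set (WeilDivisor X) :=
  {D | 0 ≤ D ∧ HasNoComponentIn D (curveC π) ∧ intersectionNumber D (curveC π) = 0}

/-- The set `I` of all `d ≥ 0` such that the class `D_d` contains a member of `𝓘`. -/
def degreeSet [IsIntegral X] [IsLocallyNoetherian X] (r : Fin 3 → ℤ) : Set ℕ :=
  {d | ∃ D ∈ orthogonalDivisors π, LinearlyEquivalent D (divisorD π r d)}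

end Triples

end

end BlowUpPlane

/-!
The proof turns the geometric set of degrees into an algebraic one, and shows that the latter is closed
under sums and differences.

Let `(a, b, c)` be the weights, and let `X`, `Y = y³ / (xᵐzᵐ)` be coordinates on the torus, so that the
curve is `Y = 1`.  Setting a Laurent monomial of degree one equal to `1` turns homogeneous polynomials
into polynomials in `X` and `Y`; this is the homomorphism `theta`.  On the chart `Y = 1 + (X - 1)U` of
the blow-up the exceptional curve is `X = 1` and the proper transform of the curve is `U = 0`.  A
degree `d` belongs to the set if and only if there is a section (`HasSection`): a homogeneous polynomial
`ξ` of degree `acd` that vanishes to order `3d` at the identity and not identically on the curve.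

*From divisors to sections* (`IsBlowupCover.hasSection_of_linearlyEquivalent`).  Let `D` be linearly
equivalent to `acd A - 3d E` by means of a rational function `f`.  Then `f` is regular on both charts of
the blow-up, hence a Laurent polynomial (`IsBlowupCover.exists_eq_torusLift`), and its orders along the
coordinate divisors show that `f` times a Laurent monomial of degree `acd` is a polynomial.

*From sections to divisors* (`IsBlowupCover.exists_divisor_of_hasSection`).  In terms of `X`, the
monomials of degree `acd` restrict on `Y = 1` to powers between `X^{8ad}` and `X^{8ad + 3d}`.  A section
vanishes to order `3d` at `X = 1`, so that it restricts to a scalar times `X^{8ad}(X - 1)^{3d}`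
(`exists_theta_one_eq`).  Thus its zeros on the curve are accounted for by `3d E`, the remaining divisor
does not meet the curve, and the intersection number is zero.

*Sums and differences.*  A product of sections is a section.  For differences (`HasSection.of_add`) the
quotient of sections of degrees `ac(d + r)` and `acd` exists as a power series along the curve, since the
second one is invertible there up to `(X - 1)^{3d}`.  Modulo `(Y - 1)^{3r + 1}` its coefficients are
linear combinations of powers of `Y` which occur in monomials of degree `acr`: this follows by long
division from the lowest and from the highest power of `X` (`IsTriple.coeff_mem_of_mul_eq`), because
the extreme coefficients of a section are single monomials, powers of `z` and `x`.  Lifting the quotient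
to a combination of these monomials changes it by a multiple of `(Y - 1)^{3r + 1}`, which vanishes to
order more than `3r` at the identity.  The result is a section of degree `acr`.

The geometry of the blow-up enters through `IsBlowupCover`: two charts isomorphic to the spectrum of
`k[X, U]_{X(1 + (X - 1)U)}`, and the complement of the exceptional curve, which is an open subscheme of
the plane.  These are obtained from the universal property (`IsBlowUp.exists_chart`,
`IsBlowUp.exists_chart_compl`).
-/

namespace BlowUpPlane

/-! ### Numerology of the triples -/

/-- The weights `(a, b, c) = (7m - 3, 5m² - 2m, 8m - 3)`, without truncated subtraction, together
with `p, q` such that `3q - mp = 1`; these exist because `3 ∤ m`.  The vectors `(7, 5m, 8)`,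
`(p, q, 0)` and `(a, b, c)` then form a basis of `ℤ³`. -/
structure IsTriple (m a b c p q : ℕ) : Prop where
  ha : a + 3 = 7 * m
  hb : b + 2 * m = 5 * m ^ 2
  hc : c + 3 = 8 * m
  hpq : 3 * q = m * p + 1

namespace IsTriple

variable {m a b c p q : ℕ} (h : IsTriple m a b c p q)
include h

lemma three_mul_b : 3 * b = m * (a + c) := by
  obtain ⟨ha, hb, hc, -⟩ := h
  nlinarith

lemma seven_c : 7 * c = 8 * a + 3 := by
  obtain ⟨ha, hb, hc, -⟩ := h
  omega

lemma five_mc : 5 * m * c = 8 * b + m := by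
  obtain ⟨ha, hb, hc, -⟩ := h
  nlinarith

lemma seven_b : 7 * b = 5 * m * a + m := by
  obtain ⟨ha, hb, hc, -⟩ := h
  nlinarith

lemma m_pos : 0 < m := by
  obtain ⟨ha, -, -, -⟩ := h
  omega

lemma a_pos : 0 < a := by
  obtain ⟨ha, -, -, -⟩ := h
  omega

lemma c_pos : 0 < c := by
  obtain ⟨-, -, hc, -⟩ := h
  omega

lemma b_pos : 0 < b := by
  have := h.seven_b
  have := h.m_pos
  by_contra h0
  have : b = 0 := by omega
  subst this
  nlinarith [h.a_pos]

lemma column_left {d i j l : ℕ} (hw : i * a + j * b + l * c = a * c * d) :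
    c * (i * 7 + j * (5 * m) + l * 8) = c * (8 * a * d) + (3 * i + m * j) := by
  have h1 := h.seven_c
  have h2 := h.five_mc
  calc _ = i * (7 * c) + j * (5 * m * c) + 8 * (l * c) := by ring
    _ = 8 * (i * a + j * b + l * c) + (3 * i + m * j) := by rw [h1, h2]; ring
    _ = _ := by rw [hw]; ring

lemma column_right {d i j l : ℕ} (hw : i * a + j * b + l * c = a * c * d) :
    a * (i * 7 + j * (5 * m) + l * 8) + (m * j + 3 * l) = a * (8 * a * d + 3 * d) := by
  have h1 := h.seven_c
  have h2 := h.seven_b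
  calc _ = 7 * (i * a) + j * (5 * m * a + m) + l * (8 * a + 3) := by ring
    _ = 7 * (i * a + j * b + l * c) := by rw [← h1, ← h2]; ring
    _ = a * (7 * c) * d := by rw [hw]; ring
    _ = _ := by rw [h1]; ring

/-- A column number between `0` and `3d`, in terms of the exponents of a monomial. -/
lemma exists_column {d i j l : ℕ} (hw : i * a + j * b + l * c = a * c * d) :
    ∃ κ, i * 7 + j * (5 * m) + l * 8 = 8 * a * d + κ ∧ 3 * i + m * j = c * κ ∧
      m * j + 3 * l + a * κ = a * (3 * d) := by
  have h1 := h.column_left hw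
  have h2 := h.column_right hw
  have hc := h.c_pos
  obtain ⟨κ, hκ⟩ : ∃ κ, i * 7 + j * (5 * m) + l * 8 = 8 * a * d + κ :=
    Nat.exists_eq_add_of_le (Nat.le_of_mul_le_mul_left (by omega : c * (8 * a * d) ≤ _) hc)
  refine ⟨κ, hκ, ?_, ?_⟩
  · rw [hκ, mul_add] at h1
    omega
  · rw [hκ, mul_add, mul_add] at h2
    omega

lemma weight_of_column {d i j l κ : ℕ} (h1 : 3 * i + m * j = c * κ)
    (h2 : m * j + 3 * l + a * κ = a * (3 * d)) :
    i * a + j * b + l * c = a * c * d ∧ i * 7 + j * (5 * m) + l * 8 = 8 * a * d + κ := by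
  have hb := h.three_mul_b
  have hac := h.seven_c
  have hm : 15 * m = a + c + 6 := by have := h.ha; have := h.hc; omega
  constructor
  · have : 3 * (i * a + j * b + l * c) + a * c * κ = 3 * (a * c * d) + a * c * κ := by
      calc _ = a * (3 * i) + j * (3 * b) + c * (3 * l) + a * c * κ := by ring
        _ = a * (3 * i + m * j) + c * (m * j + 3 * l + a * κ) := by rw [hb]; ring
        _ = _ := by rw [h1, h2]; ring
    omega
  · zify at *
    have : (3 : ℤ) * (i * 7 + j * (5 * m) + l * 8) = 3 * (8 * a * d + κ) := by
      linear_combination 7 * h1 + 8 * h2 + κ * hac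
    omega

end IsTriple

/-! ### Columns of polynomials over a truncated polynomial ring -/

section Columns

open Polynomial

variable {k R : Type*} [Field k] [CommRing R] [Algebra k R]

/-- Long division from the lowest coefficient: if the coefficients of `P` and `P * Q` lie in a
multiplicative filtration and the constant coefficient of `P` is a nonzero scalar, then the
coefficients of `Q` lie in the filtration as well. -/
lemma coeff_mem_of_coeff_mul_mem (V : ℕ → Submodule k R)
    (hV : ∀ i j x y, x ∈ V i → y ∈ V j → x * y ∈ V (i + j)) (P Q : R[X])
    (hP : ∀ i, P.coeff i ∈ V i) (hPQ : ∀ i, (P * Q).coeff i ∈ V i) {r : k} (hr : r ≠ 0)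
    (h0 : P.coeff 0 = algebraMap k R r) (n : ℕ) : Q.coeff n ∈ V n := by
  induction n using Nat.strong_induction_on with
  | _ n ih =>
    have h1 : r • Q.coeff n ∈ V n := by
      have h2 := coeff_mul P Q n
      rw [Finset.Nat.sum_antidiagonal_eq_sum_range_succ_mk, Finset.sum_range_succ'] at h2
      simp only [Nat.sub_zero, h0] at h2
      rw [Algebra.smul_def, ← sub_eq_of_eq_add' h2]
      refine (V n).sub_mem (hPQ n) ((V n).sum_mem fun i hi => ?_)
      have hi' : i < n := Finset.mem_range.mp hi
      have := hV _ _ _ _ (hP (i + 1)) (ih (n - (i + 1)) (by omega))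
      rwa [show i + 1 + (n - (i + 1)) = n by omega] at this
    simpa [smul_smul, inv_mul_cancel₀ hr] using (V n).smul_mem r⁻¹ h1

lemma span_mul_mem {s t v : Set R} (h : ∀ x ∈ s, ∀ y ∈ t, x * y ∈ v) {x y : R}
    (hx : x ∈ Submodule.span k s) (hy : y ∈ Submodule.span k t) :
    x * y ∈ Submodule.span k v := by
  have := Submodule.mul_mem_mul hx hy
  rw [Submodule.span_mul_span] at this
  refine Submodule.span_mono ?_ this
  rintro _ ⟨x, hx, y, hy, rfl⟩
  exact h x hx y hy

end Columns

/-! ### Sections over the torus -/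

section Theta

open Polynomial

/-- The substitution `x ↦ u⁷vᵖ`, `y ↦ u⁵ᵐv^q`, `z ↦ u⁸`.  It dehomogenises with respect to a Laurent
monomial of degree one, the coordinates `u` and `v` of the torus being Laurent monomials of degree
zero. -/
noncomputable def theta {k R : Type*} [Field k] [CommRing R] (m p q : ℕ) (ι : k →+* R) (u v : R) :
    MvPolynomial (Fin 3) k →+* R :=
  MvPolynomial.eval₂Hom ι ![u ^ 7 * v ^ p, u ^ (5 * m) * v ^ q, u ^ 8]

variable {k R R' : Type*} [Field k] [CommRing R] [CommRing R'] {m p q : ℕ}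

@[simp]
lemma theta_C (ι : k →+* R) (u v : R) (r : k) : theta m p q ι u v (MvPolynomial.C r) = ι r := by
  simp [theta]

lemma theta_X_zero (ι : k →+* R) (u v : R) :
    theta m p q ι u v (MvPolynomial.X 0) = u ^ 7 * v ^ p := by
  simp [theta]

lemma theta_X_one (ι : k →+* R) (u v : R) :
    theta m p q ι u v (MvPolynomial.X 1) = u ^ (5 * m) * v ^ q := by
  simp [theta]

lemma theta_X_two (ι : k →+* R) (u v : R) :
    theta m p q ι u v (MvPolynomial.X 2) = u ^ 8 := by
  simp [theta]

lemma comp_theta (f : R →+* R') (ι : k →+* R) (u v : R) :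
    f.comp (theta m p q ι u v) = theta m p q (f.comp ι) (f u) (f v) := by
  refine MvPolynomial.ringHom_ext (fun r => by simp) fun i => ?_
  fin_cases i <;> simp [theta_X_zero, theta_X_one, theta_X_two]

lemma map_theta (f : R →+* R') (ι : k →+* R) (u v : R) (ξ : MvPolynomial (Fin 3) k) :
    f (theta m p q ι u v ξ) = theta m p q (f.comp ι) (f u) (f v) ξ :=
  DFunLike.congr_fun (comp_theta f ι u v) ξ

lemma theta_monomial (ι : k →+* R) (u v : R) (μ : Fin 3 →₀ ℕ) (r : k) :
    theta m p q ι u v (MvPolynomial.monomial μ r) =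
      ι r * (u ^ (μ 0 * 7 + μ 1 * (5 * m) + μ 2 * 8) * v ^ (p * μ 0 + q * μ 1)) := by
  simp only [theta, MvPolynomial.coe_eval₂Hom, MvPolynomial.eval₂_monomial]
  rw [Finsupp.prod_fintype _ _ (by simp), Fin.prod_univ_three]
  have (i j l : ℕ) : (u ^ 7 * v ^ p) ^ i * (u ^ (5 * m) * v ^ q) ^ j * (u ^ 8) ^ l =
      u ^ (i * 7 + j * (5 * m) + l * 8) * v ^ (p * i + q * j) := by
    rw [mul_pow, mul_pow, pow_add, pow_add, pow_add, pow_mul' u i 7, pow_mul' u j,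
      pow_mul' u l 8, pow_mul v p i, pow_mul v q j]
    generalize u ^ 7 = x, v ^ p = y, u ^ (5 * m) = z, v ^ q = t, u ^ 8 = w
    ring
  exact congr_arg (ι r * ·) (this (μ 0) (μ 1) (μ 2))

lemma theta_eq_sum (ι : k →+* R) (u v : R) (ξ : MvPolynomial (Fin 3) k) :
    theta m p q ι u v ξ = ∑ μ ∈ ξ.support, ι (ξ.coeff μ) *
      (u ^ (μ 0 * 7 + μ 1 * (5 * m) + μ 2 * 8) * v ^ (p * μ 0 + q * μ 1)) := by
  conv_lhs => rw [ξ.as_sum, map_sum]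
  exact Finset.sum_congr rfl fun μ _ => theta_monomial ..

/-- `f(X, Y) ↦ f(X, 1 + (X - 1)U)`: the substitution that describes the chart of the blow-up of
`(1, 1)` on which `X - 1` is an equation of the exceptional divisor.  The polynomial ring is
`k[Y][X]`. -/
noncomputable def blowupSubst (k : Type*) [Field k] : k[X][X] →+* k[X][X] :=
  eval₂RingHom (eval₂RingHom (C.comp C) (1 + (X - 1) * C X)) X

@[simp]
lemma blowupSubst_X : blowupSubst k X = X := by simp [blowupSubst]

@[simp]
lemma blowupSubst_C_X : blowupSubst k (C X) = 1 + (X - 1) * C X := by simp [blowupSubst]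

@[simp]
lemma blowupSubst_C_C (r : k) : blowupSubst k (C (C r)) = C (C r) := by simp [blowupSubst]

lemma blowupSubst_theta (ξ : MvPolynomial (Fin 3) k) :
    blowupSubst k (theta m p q (C.comp C) X (C X) ξ) =
      theta m p q (C.comp C) X (1 + (X - 1) * C X) ξ := by
  have h : (blowupSubst k).comp (C.comp C) = C.comp C := RingHom.ext blowupSubst_C_C
  rw [map_theta, h, blowupSubst_X, blowupSubst_C_X]

lemma map_eval_blowupSubst (f : k[X][X]) :
    (blowupSubst k f).map (evalRingHom 0) = f.map (evalRingHom 1) := by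
  have : (mapRingHom (evalRingHom (0 : k))).comp (blowupSubst k) =
      mapRingHom (evalRingHom (1 : k)) := by
    refine Polynomial.ringHom_ext' (Polynomial.ringHom_ext' ?_ ?_) ?_
    · ext r : 1
      simp
    · simp
    · simp
  exact DFunLike.congr_fun this f

lemma map_eval_theta (ξ : MvPolynomial (Fin 3) k) :
    (theta m p q (C.comp C) X (C X) ξ : k[X][X]).map (evalRingHom 1) =
      theta m p q C X 1 ξ := by
  have h : (mapRingHom (evalRingHom (1 : k))).comp (C.comp C) = C := by
    ext r : 1
    simp
  rw [← coe_mapRingHom, map_theta, h]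
  simp

lemma C_X_sub_one_dvd {f : k[X][X]} (hf : f.map (evalRingHom 1) = 0) :
    C (X - 1) ∣ f := by
  rw [C_dvd_iff_dvd_coeff]
  intro i
  rw [← C_1, dvd_iff_isRoot, IsRoot.def]
  simpa using congr_arg (fun g => g.coeff i) hf

lemma prime_C_X : Prime (C X : k[X][X]) := prime_C_iff.mpr prime_X

lemma prime_X_sub_one : Prime (X - 1 : k[X][X]) := by
  simpa using prime_X_sub_C (1 : k[X])

lemma map_X_sub_one_ne_zero (r : k) :
    (X - 1 : k[X][X]).map (evalRingHom r) ≠ 0 := by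
  simpa using X_sub_C_ne_zero (1 : k)

lemma not_C_X_dvd_X_sub_one : ¬ (C X : k[X][X]) ∣ X - 1 := by
  rintro ⟨g, hg⟩
  refine map_X_sub_one_ne_zero (0 : k) ?_
  rw [hg]
  simp

lemma not_X_sub_one_dvd_X : ¬ (X - 1 : k[X][X]) ∣ X := by
  rintro ⟨g, hg⟩
  simpa using congr_arg (eval 1) hg

/-- A polynomial that vanishes to order `n` along the proper transform of `Y = 1` does so along
`Y = 1`. -/
lemma C_X_sub_one_pow_dvd (n : ℕ) {f : k[X][X]} (hf : C X ^ n ∣ blowupSubst k f) :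
    C (X - 1) ^ n ∣ f := by
  induction n generalizing f with
  | zero => simp
  | succ n ih =>
    have h1 : f.map (evalRingHom 1) = 0 := by
      obtain ⟨g, hg⟩ := hf
      rw [← map_eval_blowupSubst, hg]
      simp [pow_succ]
    obtain ⟨g, rfl⟩ := C_X_sub_one_dvd h1
    rw [pow_succ']
    refine mul_dvd_mul_left _ (ih ?_)
    have h2 : blowupSubst k (C (X - 1)) = (X - 1) * C X := by simp
    rw [map_mul, h2, pow_succ', mul_comm (X - 1 : k[X][X]), mul_assoc,
      mul_dvd_mul_iff_left prime_C_X.ne_zero] at hf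
    exact prime_C_X.pow_dvd_of_dvd_mul_left n not_C_X_dvd_X_sub_one hf

/-- Up to order `n + 1` along the proper transform of `Y = 1`, every multiple of `(X - 1)ⁿ` on the
chart comes from a polynomial in `X` and `Y`. -/
lemma exists_blowupSubst_sub_dvd (n : ℕ) (g : k[X][X]) :
    ∃ f, (X - 1) ^ n ∣ blowupSubst k f ∧ C X ^ (n + 1) ∣ blowupSubst k f - (X - 1) ^ n * g := by
  induction g using Polynomial.induction_on' with
  | add g₁ g₂ h₁ h₂ =>
    obtain ⟨f₁, h₁, h₁'⟩ := h₁
    obtain ⟨f₂, h₂, h₂'⟩ := h₂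
    refine ⟨f₁ + f₂, by rw [map_add]; exact dvd_add h₁ h₂, ?_⟩
    convert dvd_add h₁' h₂' using 1
    rw [map_add]
    ring
  | monomial i g =>
    induction g using Polynomial.induction_on' with
    | add g₁ g₂ h₁ h₂ =>
      obtain ⟨f₁, h₁, h₁'⟩ := h₁
      obtain ⟨f₂, h₂, h₂'⟩ := h₂
      refine ⟨f₁ + f₂, by rw [map_add]; exact dvd_add h₁ h₂, ?_⟩
      convert dvd_add h₁' h₂' using 1
      rw [map_add, map_add]
      ring
    | monomial j r =>
      rw [← C_mul_X_pow_eq_monomial, ← C_mul_X_pow_eq_monomial]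
      rcases le_or_gt j n with hj | hj
      · obtain ⟨e, rfl⟩ := Nat.exists_eq_add_of_le hj
        have : blowupSubst k (X ^ i * (X - 1) ^ e * C (C r) * C (X - 1) ^ j) =
            (X - 1) ^ (j + e) * (C (C r * X ^ j) * X ^ i) := by
          simp only [map_mul, map_pow, map_sub, map_one, blowupSubst_X, blowupSubst_C_C,
            blowupSubst_C_X, add_sub_cancel_left, mul_pow, pow_add]
          ring
        exact ⟨_, by rw [this]; exact dvd_mul_right _ _, by rw [this, sub_self]; exact dvd_zero _⟩
      · refine ⟨0, by simp, ?_⟩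
        rw [map_zero]
        refine dvd_sub (dvd_zero _) (Dvd.dvd.mul_left (Dvd.dvd.mul_right ?_ _) _)
        rw [C_mul, C_pow]
        exact Dvd.dvd.mul_left (pow_dvd_pow _ hj) _

end Theta

/-! ### The algebraic form of the degree set -/

section Good

open Polynomial

variable {k : Type*} [Field k] {m a b c p q : ℕ}

/-- There is a section of degree `acd` on the weighted plane that vanishes to order `3d` at the
identity of the torus and does not vanish on the curve `Y = 1`.  The order of vanishing is read off
on a chart of the blow-up. -/
def HasSection (k : Type*) [Field k] (m a b c p q d : ℕ) : Prop :=
  ∃ ξ : MvPolynomial (Fin 3) k, ξ.IsWeightedHomogeneous ![a, b, c] (a * c * d) ∧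
    (X - 1 : k[X][X]) ^ (3 * d) ∣ theta m p q (C.comp C) X (1 + (X - 1) * C X) ξ ∧
    (theta m p q C X 1 ξ : k[X]) ≠ 0

lemma hasSection_zero : HasSection k m a b c p q 0 :=
  ⟨1, by simpa using MvPolynomial.isWeightedHomogeneous_one k _, by simp, by simp⟩

lemma HasSection.add {d e : ℕ} (hd : HasSection k m a b c p q d)
    (he : HasSection k m a b c p q e) : HasSection k m a b c p q (d + e) := by
  obtain ⟨ξ, h₁, h₂, h₃⟩ := hd
  obtain ⟨ζ, h₁', h₂', h₃'⟩ := he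
  refine ⟨ξ * ζ, by rw [mul_add]; exact h₁.mul h₁', ?_, ?_⟩
  · rw [mul_add, pow_add, map_mul]
    exact mul_dvd_mul h₂ h₂'
  · rw [map_mul]
    exact mul_ne_zero h₃ h₃'

/-- The powers of `Y` that occur in column `κ` of the Newton polygon of a section of degree `acd`:
they belong to the monomials `xⁱyʲzˡ` of this degree with `7i + 5mj + 8l = 8ad + κ`. -/
def columnPowers (k : Type*) [Field k] (m a c p q d κ : ℕ) : Set k[X] :=
  {f | ∃ i j l, 3 * i + m * j = c * κ ∧ m * j + 3 * l + a * κ = a * (3 * d) ∧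
    f = X ^ (p * i + q * j)}

lemma weight_fin_three (μ : Fin 3 →₀ ℕ) :
    Finsupp.weight ![a, b, c] μ = μ 0 * a + μ 1 * b + μ 2 * c := by
  rw [Finsupp.weight_apply, Finsupp.sum_fintype _ _ (by simp), Fin.sum_univ_three]
  simp

/-- The decomposition of a section into columns. -/
lemma IsTriple.exists_columns (h : IsTriple m a b c p q) {d : ℕ} {ξ : MvPolynomial (Fin 3) k}
    (hξ : ξ.IsWeightedHomogeneous ![a, b, c] (a * c * d)) :
    ∃ P : k[X][X], theta m p q (C.comp C) X (C X) ξ = X ^ (8 * a * d) * P ∧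
      ∀ κ, P.coeff κ ∈ Submodule.span k (columnPowers k m a c p q d κ) := by
  have hcol (μ) (hμ : μ ∈ ξ.support) := h.exists_column (d := d) (i := μ 0) (j := μ 1) (l := μ 2)
    (by rw [← weight_fin_three]; exact hξ (MvPolynomial.mem_support_iff.mp hμ))
  choose! κ hκ₁ hκ₂ hκ₃ using hcol
  refine ⟨∑ μ ∈ ξ.support, C (C (ξ.coeff μ)) *
      (X ^ κ μ * C X ^ (p * μ 0 + q * μ 1)), ?_, fun n => ?_⟩
  · rw [theta_eq_sum, Finset.mul_sum]
    refine Finset.sum_congr rfl fun μ hμ => ?_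
    rw [hκ₁ μ hμ, pow_add, RingHom.comp_apply]
    ring
  · rw [finsetSum_coeff]
    refine Submodule.sum_mem _ fun μ hμ => ?_
    rw [coeff_C_mul, mul_comm (X ^ _), ← C_pow, coeff_C_mul_X_pow, ← smul_eq_C_mul]
    split_ifs with hn
    · subst hn
      exact Submodule.smul_mem _ _ (Submodule.subset_span ⟨_, _, _, hκ₂ μ hμ, hκ₃ μ hμ, rfl⟩)
    · simp

lemma IsTriple.exists_section_of_column (h : IsTriple m a b c p q) {d κ : ℕ} {f : k[X]}
    (hf : f ∈ Submodule.span k (columnPowers k m a c p q d κ)) :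
    ∃ ξ : MvPolynomial (Fin 3) k, ξ.IsWeightedHomogeneous ![a, b, c] (a * c * d) ∧
      theta m p q (C.comp C) X (C X) ξ = X ^ (8 * a * d) * (C f * X ^ κ) := by
  induction hf using Submodule.span_induction with
  | mem f hf =>
    obtain ⟨i, j, l, h₁, h₂, rfl⟩ := hf
    obtain ⟨h₃, h₄⟩ := h.weight_of_column h₁ h₂
    let μ : Fin 3 →₀ ℕ := Finsupp.equivFunOnFinite.symm ![i, j, l]
    refine ⟨MvPolynomial.monomial μ 1, MvPolynomial.isWeightedHomogeneous_monomial _ _ _ ?_, ?_⟩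
    · rw [weight_fin_three]
      exact h₃
    · rw [theta_monomial]
      change _ * (X ^ (i * 7 + j * (5 * m) + l * 8) * C X ^ (p * i + q * j)) = _
      rw [h₄, pow_add, map_one, one_mul, C_pow]
      ring
  | zero => exact ⟨0, MvPolynomial.isWeightedHomogeneous_zero k _ _, by simp⟩
  | add f g _ _ hf hg =>
    obtain ⟨ξ, h₁, h₂⟩ := hf
    obtain ⟨ζ, h₁', h₂'⟩ := hg
    refine ⟨ξ + ζ, h₁.add h₁', ?_⟩
    rw [map_add, h₂, h₂', C_add]
    ring
  | smul r f _ hf =>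
    obtain ⟨ξ, h₁, h₂⟩ := hf
    refine ⟨MvPolynomial.C r * ξ, ?_, ?_⟩
    · simpa using (MvPolynomial.isWeightedHomogeneous_C (![a, b, c]) r).mul h₁
    · rw [map_mul, h₂, theta_C, smul_eq_C_mul, C_mul, RingHom.comp_apply]
      ring

lemma columnPowers_eq_empty (h : IsTriple m a b c p q) {d κ : ℕ} (hκ : 3 * d < κ) :
    columnPowers k m a c p q d κ = ∅ := by
  rw [Set.eq_empty_iff_forall_notMem]
  rintro f ⟨i, j, l, -, h₂, -⟩
  have := Nat.mul_lt_mul_of_pos_left hκ h.a_pos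
  omega

lemma columnPowers_zero_subset (h : IsTriple m a b c p q) {d : ℕ} :
    columnPowers k m a c p q d 0 ⊆ {1} := by
  rintro f ⟨i, j, l, h₁, -, rfl⟩
  have hm := h.m_pos
  have hj : j = 0 := by
    by_contra hj
    have := Nat.mul_pos hm (Nat.pos_of_ne_zero hj)
    omega
  have hi : i = 0 := by subst hj; omega
  simp [hi, hj]

lemma columnPowers_last_subset (h : IsTriple m a b c p q) {d : ℕ} :
    columnPowers k m a c p q d (3 * d) ⊆ {X ^ (p * (c * d))} := by
  rintro f ⟨i, j, l, h₁, h₂, rfl⟩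
  have hm := h.m_pos
  have hj : j = 0 := by
    by_contra hj
    have := Nat.mul_pos hm (Nat.pos_of_ne_zero hj)
    omega
  have hi : i = c * d := by subst hj; linarith
  simp [hi, hj]

lemma natDegree_le_of_columns (h : IsTriple m a b c p q) {d : ℕ} {P : k[X][X]}
    (hP : ∀ κ, P.coeff κ ∈ Submodule.span k (columnPowers k m a c p q d κ)) :
    P.natDegree ≤ 3 * d := by
  rw [natDegree_le_iff_coeff_eq_zero]
  intro κ hκ
  simpa [columnPowers_eq_empty h hκ] using hP κ

/-- The restriction of a section to the curve `Y = 1` has degree at most `3d` and vanishes to order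
`3d` at `X = 1`. -/
lemma map_eval_one_eq {d : ℕ} {P : k[X][X]} (hdeg : P.natDegree ≤ 3 * d)
    {G : k[X][X]} (hG : blowupSubst k P = (X - 1) ^ (3 * d) * G)
    (h0 : P.map (evalRingHom 1) ≠ 0) :
    ∃ r : k, r ≠ 0 ∧ G.map (evalRingHom 0) = C r ∧
      P.map (evalRingHom 1) = (X - 1) ^ (3 * d) * C r := by
  have h1 : P.map (evalRingHom 1) = (X - 1) ^ (3 * d) * G.map (evalRingHom 0) := by
    rw [← map_eval_blowupSubst, hG]
    simp
  have h2 : G.map (evalRingHom 0) ≠ 0 := by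
    intro h2
    rw [h2, mul_zero] at h1
    exact h0 h1
  have h3 : (G.map (evalRingHom 0)).natDegree = 0 := by
    have h4 := (natDegree_map_le (f := evalRingHom (1 : k)) (p := P)).trans hdeg
    have h5 : (X - 1 : k[X]) ≠ 0 := by simpa using X_sub_C_ne_zero (1 : k)
    have h6 : (X - 1 : k[X]).natDegree = 1 := by simpa using natDegree_X_sub_C (1 : k)
    rw [h1, natDegree_mul (pow_ne_zero _ h5) h2, natDegree_pow, h6] at h4
    omega
  obtain ⟨r, hr⟩ := natDegree_eq_zero.mp h3
  refine ⟨r, ?_, hr.symm, by rw [h1, hr]⟩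
  rintro rfl
  exact h2 (by rw [← hr, C_0])

/-- Division of sections to sufficiently high order along the curve `Y = 1`. -/
lemma exists_quotient {d r : ℕ} {P P' : k[X][X]} (hdeg : P'.natDegree ≤ 3 * d)
    (hP : (X - 1) ^ (3 * (d + r)) ∣ blowupSubst k P) (hP' : (X - 1) ^ (3 * d) ∣ blowupSubst k P')
    (h0 : P'.map (evalRingHom 1) ≠ 0) :
    ∃ Q, (X - 1) ^ (3 * r) ∣ blowupSubst k Q ∧ C (X - 1) ^ (3 * r + 1) ∣ P' * Q - P := by
  obtain ⟨G, hG⟩ := hP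
  obtain ⟨G', hG'⟩ := hP'
  obtain ⟨e, he, he', -⟩ := map_eval_one_eq hdeg hG' h0
  -- `G'` is a nonzero constant modulo `U`, hence invertible modulo `Uⁿ`.
  obtain ⟨H, hH⟩ : C X ∣ G' - C (C e) := by
    rw [C_dvd_iff_dvd_coeff]
    intro i
    rw [X_dvd_iff, coeff_zero_eq_eval_zero]
    have := congr_arg (fun f => f.coeff i) he'
    simp only [coeff_map, coe_evalRingHom] at this
    rw [coeff_sub, eval_sub, this, coeff_C, coeff_C]
    split_ifs <;> simp
  have hinv : ∃ V, C X ^ (3 * r + 1) ∣ G' * V - 1 := by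
    have h1 := mul_neg_geom_sum (-(C X * H * C (C e⁻¹))) (3 * r + 1)
    refine ⟨C (C e⁻¹) * ∑ i ∈ Finset.range (3 * r + 1), (-(C X * H * C (C e⁻¹))) ^ i, ?_⟩
    have h2 : G' * C (C e⁻¹) = 1 - -(C X * H * C (C e⁻¹)) := by
      have : (C (C e) : k[X][X]) * C (C e⁻¹) = 1 := by
        rw [← C_mul, ← C_mul, mul_inv_cancel₀ he, C_1, C_1]
      linear_combination this + C (C e⁻¹) * hH
    obtain ⟨T, hT⟩ : (C X : k[X][X]) ^ (3 * r + 1) ∣ (-(C X * H * C (C e⁻¹))) ^ (3 * r + 1) :=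
      pow_dvd_pow_of_dvd ⟨-(H * C (C e⁻¹)), by ring⟩ _
    exact ⟨-T, by rw [← mul_assoc, h2, h1, hT]; ring⟩
  obtain ⟨V, hV⟩ := hinv
  obtain ⟨Q, hQ, hQ'⟩ := exists_blowupSubst_sub_dvd (3 * r) (G * V)
  refine ⟨Q, hQ, C_X_sub_one_pow_dvd _ ?_⟩
  have : blowupSubst k (P' * Q - P) =
      blowupSubst k P' * (blowupSubst k Q - (X - 1) ^ (3 * r) * (G * V)) +
        (X - 1) ^ (3 * (d + r)) * G * (G' * V - 1) := by
    rw [map_sub, map_mul, hG, hG']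
    ring
  rw [this]
  exact dvd_add (hQ'.mul_left _) (hV.mul_left _)

lemma mem_span_of_forall {R : Type*} [CommRing R] [Algebra k R] {s t : Set R} (y : R)
    (h : ∀ x ∈ s, y * x ∈ Submodule.span k t) {x : R} (hx : x ∈ Submodule.span k s) :
    y * x ∈ Submodule.span k t := by
  induction hx using Submodule.span_induction with
  | mem x hx => exact h x hx
  | zero => simp
  | add x z _ _ hx hz => rw [mul_add]; exact Submodule.add_mem _ hx hz
  | smul r x _ hx => rw [mul_smul_comm]; exact Submodule.smul_mem _ _ hx

/-- If a section of degree `ac(d + r)` is, over a quotient `k[Y] → R`, the product of one of degree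
`acd` and some polynomial `Q`, then the columns of `Q` consist of powers of `Y` that come from honest
monomials of degree `acr`.  Dividing from the first column on bounds the exponents of `x` from
below, dividing from the last column on bounds those of `z`. -/
lemma IsTriple.coeff_mem_of_mul_eq (h : IsTriple m a b c p q) {R : Type*} [CommRing R]
    [Nontrivial R] [Algebra k R] (f : k[X] →ₐ[k] R) {yi : R} (hy : f X * yi = 1) {d r : ℕ}
    {P P' : k[X][X]} {Q : R[X]}
    (hP : ∀ κ, P.coeff κ ∈ Submodule.span k (columnPowers k m a c p q (d + r) κ))
    (hP' : ∀ κ, P'.coeff κ ∈ Submodule.span k (columnPowers k m a c p q d κ))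
    {e₀ e₁ : k} (he₀ : e₀ ≠ 0) (he₁ : e₁ ≠ 0) (h₀ : P'.coeff 0 = C e₀)
    (h₁ : P'.coeff (3 * d) = C e₁ * X ^ (p * (c * d)))
    (hPQ : P'.map f.toRingHom * Q = P.map f.toRingHom) :
    Q.natDegree ≤ 3 * r ∧
      ∀ κ ≤ 3 * r, Q.coeff κ ∈ Submodule.span k (f '' columnPowers k m a c p q r κ) := by
  have hf (e κ) (F : k[X][X])
      (hF : ∀ κ, F.coeff κ ∈ Submodule.span k (columnPowers k m a c p q e κ)) :
      (F.map f.toRingHom).coeff κ ∈ Submodule.span k (f '' columnPowers k m a c p q e κ) := by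
    rw [coeff_map]
    have := Submodule.mem_map_of_mem (f := f.toLinearMap) (hF κ)
    rwa [Submodule.map_span] at this
  have hfC (e : k) : f (C e) = algebraMap k R e := f.commutes e
  have hdegP : (P.map f.toRingHom).natDegree ≤ 3 * (d + r) :=
    natDegree_map_le.trans (natDegree_le_of_columns h hP)
  have hdegP' : (P'.map f.toRingHom).natDegree ≤ 3 * d :=
    natDegree_map_le.trans (natDegree_le_of_columns h hP')
  have hunit : IsUnit ((P'.map f.toRingHom).coeff (3 * d)) := by
    rw [coeff_map, h₁]
    simp only [AlgHom.toRingHom_eq_coe, RingHom.coe_coe, map_mul, map_pow, hfC]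
    exact ((isUnit_iff_ne_zero.mpr he₁).map _).mul ((IsUnit.of_mul_eq_one _ hy).pow _)
  have hdegQ : Q.natDegree ≤ 3 * r := by
    rcases eq_or_ne Q 0 with rfl | hQ
    · simp
    have h2 : (P'.map f.toRingHom).natDegree = 3 * d :=
      le_antisymm hdegP' (le_natDegree_of_ne_zero hunit.ne_zero)
    have h3 : (P'.map f.toRingHom).leadingCoeff * Q.leadingCoeff ≠ 0 := by
      rw [leadingCoeff, h2]
      rw [Ne, hunit.mul_right_eq_zero]
      exact leadingCoeff_ne_zero.mpr hQ
    have h4 := natDegree_mul' h3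
    rw [hPQ, h2] at h4
    omega
  refine ⟨hdegQ, fun κ hκ => ?_⟩
  have hm3 : a + c = 3 * (5 * m - 2) := by have := h.ha; have := h.hc; omega
  -- Division from the first column on.
  have hleft := coeff_mem_of_coeff_mul_mem (k := k)
    (fun κ => Submodule.span k {g : R | ∃ i j, 3 * i + m * j = c * κ ∧ g = f X ^ (p * i + q * j)})
    (fun κ₁ κ₂ x y => span_mul_mem (by
      rintro _ ⟨i, j, hij, rfl⟩ _ ⟨i', j', hij', rfl⟩
      exact ⟨i + i', j + j', by linarith, by ring⟩))
    (P'.map f.toRingHom) Q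
    (fun κ => Submodule.span_mono (by
      rintro _ ⟨_, ⟨i, j, l, hij, -, rfl⟩, rfl⟩
      exact ⟨i, j, hij, by simp⟩) (hf _ _ _ hP'))
    (fun κ => by
      rw [hPQ]
      exact Submodule.span_mono (by
        rintro _ ⟨_, ⟨i, j, l, hij, -, rfl⟩, rfl⟩
        exact ⟨i, j, hij, by simp⟩) (hf _ _ _ hP))
    he₀ (by rw [coeff_map, h₀]; exact hfC e₀) κ
  -- Division from the last column on.
  have hcoeff (e κ) (F : k[X][X])
      (hF : ∀ κ, F.coeff κ ∈ Submodule.span k (columnPowers k m a c p q e κ)) :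
      (C (yi ^ (p * (c * e))) * reflect (3 * e) (F.map f.toRingHom)).coeff κ ∈
        Submodule.span k {g : R | ∃ i j l, 3 * i = c * κ + m * j ∧ 3 * l + m * j = a * κ ∧
          g = f X ^ (q * j) * yi ^ (p * i)} := by
    rw [coeff_C_mul, coeff_reflect]
    rcases le_or_gt κ (3 * e) with hκ | hκ
    · rw [revAt_le hκ]
      obtain ⟨κ', hκ'⟩ := Nat.exists_eq_add_of_le hκ
      rw [hκ', Nat.add_sub_cancel_left]
      refine mem_span_of_forall _ ?_ (hf e κ' F hF)
      rintro _ ⟨_, ⟨i, j, l, hij, hjl, rfl⟩, rfl⟩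
      have h2 : 3 * (c * e) = c * κ + c * κ' := by rw [← mul_add, ← hκ']; ring
      have h3 : a * (3 * e) = a * κ + a * κ' := by rw [← mul_add, ← hκ']
      obtain ⟨i', hi'⟩ := Nat.exists_eq_add_of_le (show i ≤ c * e by
        have := Nat.mul_le_mul_left c (show κ' ≤ 3 * e by omega)
        nlinarith)
      refine Submodule.subset_span ⟨i', j, l, by omega, by omega, ?_⟩
      have h4 : yi ^ (p * i) * f X ^ (p * i) = 1 := by
        rw [← mul_pow, mul_comm, hy, one_pow]
      rw [hi', map_pow, mul_add, pow_add, pow_add]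
      linear_combination yi ^ (p * i') * f X ^ (q * j) * h4
    · rw [revAt_eq_self_of_lt hκ]
      have := hf e κ F hF
      rw [columnPowers_eq_empty h hκ] at this
      have h2 : (F.map f.toRingHom).coeff κ = 0 := by simpa using this
      rw [h2, mul_zero]
      exact Submodule.zero_mem _
  have hright := coeff_mem_of_coeff_mul_mem (k := k)
    (fun κ => Submodule.span k {g : R | ∃ i j l, 3 * i = c * κ + m * j ∧ 3 * l + m * j = a * κ ∧
      g = f X ^ (q * j) * yi ^ (p * i)})
    (fun κ₁ κ₂ x y => span_mul_mem (by
      rintro _ ⟨i, j, l, hij, hjl, rfl⟩ _ ⟨i', j', l', hij', hjl', rfl⟩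
      exact ⟨i + i', j + j', l + l', by linarith, by linarith, by ring⟩))
    (C (yi ^ (p * (c * d))) * reflect (3 * d) (P'.map f.toRingHom))
    (C (yi ^ (p * (c * r))) * reflect (3 * r) Q)
    (fun κ => hcoeff d κ P' hP')
    (fun κ => by
      have h2 : C (yi ^ (p * (c * d))) * reflect (3 * d) (P'.map f.toRingHom) *
          (C (yi ^ (p * (c * r))) * reflect (3 * r) Q) =
          C (yi ^ (p * (c * (d + r)))) * reflect (3 * (d + r)) (P.map f.toRingHom) := by
        rw [← hPQ, mul_add 3, reflect_mul _ _ hdegP' hdegQ, mul_add c, mul_add p, pow_add, C_mul]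
        ring
      rw [h2]
      exact hcoeff (d + r) κ P hP)
    he₁ (by
      rw [coeff_C_mul, coeff_reflect, revAt_le (Nat.zero_le _), Nat.sub_zero, coeff_map, h₁]
      simp only [AlgHom.toRingHom_eq_coe, RingHom.coe_coe, map_mul, map_pow, hfC]
      have h4 : yi ^ (p * (c * d)) * f X ^ (p * (c * d)) = 1 := by
        rw [← mul_pow, mul_comm, hy, one_pow]
      linear_combination algebraMap k R e₁ * h4) (3 * r - κ)
  rw [coeff_C_mul, coeff_reflect, revAt_le (Nat.sub_le _ _), Nat.sub_sub_self hκ] at hright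
  obtain ⟨κ', hκ'⟩ := Nat.exists_eq_add_of_le hκ
  have h3r : 3 * r - κ = κ' := by omega
  rw [h3r] at hright
  -- In the left half of the Newton triangle the exponents of `z` are automatically nonnegative, in
  -- the right half those of `x` are.
  rcases le_total (c * κ) (a * κ') with hcase | hcase
  · refine Submodule.span_mono ?_ hleft
    rintro _ ⟨i, j, hij, rfl⟩
    refine ⟨X ^ (p * i + q * j), ⟨i, j, a * r + i - (5 * m - 2) * κ, hij, ?_, rfl⟩, by simp⟩
    have h2 : a * (3 * r) = a * κ + a * κ' := by rw [hκ', mul_add]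
    have h3 : a * κ + c * κ = 3 * ((5 * m - 2) * κ) := by rw [← add_mul, hm3, mul_assoc]
    have h4 : a * (3 * r) = 3 * (a * r) := by ring
    omega
  · have h5 : f X ^ (p * (c * r)) * (yi ^ (p * (c * r)) * Q.coeff κ) = Q.coeff κ := by
      rw [← mul_assoc, ← mul_pow, hy, one_pow, one_mul]
    rw [← h5]
    refine mem_span_of_forall _ ?_ hright
    rintro _ ⟨i, j, l, hij, hjl, rfl⟩
    have h2 : 3 * (c * r) = c * κ + c * κ' := by
      calc 3 * (c * r) = c * (3 * r) := by ring
        _ = _ := by rw [hκ']; ring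
    have h2' : a * (3 * r) = a * κ + a * κ' := by rw [hκ', mul_add]
    obtain ⟨i', hi'⟩ := Nat.exists_eq_add_of_le (show i ≤ c * r by omega)
    refine Submodule.subset_span ⟨X ^ (p * i' + q * j), ⟨i', j, l, by omega, by omega, rfl⟩, ?_⟩
    have h4 : yi ^ (p * i) * f X ^ (p * i) = 1 := by
      rw [← mul_pow, mul_comm, hy, one_pow]
    rw [hi', map_pow, mul_add, pow_add, pow_add]
    linear_combination -(f X ^ (p * i') * f X ^ (q * j) * h4)

/-- The quotient of two sections: it exists as a power series along the proper transform of `Y = 1`,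
and truncating it to order `3r` gives a section. -/
lemma HasSection.of_add (h : IsTriple m a b c p q) {d r : ℕ}
    (hd : HasSection k m a b c p q d) (hdr : HasSection k m a b c p q (d + r)) :
    HasSection k m a b c p q r := by
  obtain ⟨ξ', h₁', h₂', h₃'⟩ := hd
  obtain ⟨ξ, h₁, h₂, h₃⟩ := hdr
  rw [← blowupSubst_theta] at h₂ h₂'
  rw [← map_eval_theta] at h₃ h₃'
  obtain ⟨P', hP', hcol'⟩ := h.exists_columns h₁'
  obtain ⟨P, hP, hcol⟩ := h.exists_columns h₁
  have hX (e n : ℕ) (F : k[X][X])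
      (hF : (X - 1) ^ n ∣ blowupSubst k (X ^ e * F)) : (X - 1) ^ n ∣ blowupSubst k F := by
    rw [map_mul, map_pow, blowupSubst_X] at hF
    exact prime_X_sub_one.pow_dvd_of_dvd_mul_left n
      (fun hdvd => not_X_sub_one_dvd_X (prime_X_sub_one.dvd_of_dvd_pow hdvd)) hF
  rw [hP'] at h₂' h₃'
  rw [hP] at h₂ h₃
  replace h₂' := hX _ _ _ h₂'
  replace h₂ := hX _ _ _ h₂
  rw [Polynomial.map_mul] at h₃ h₃'
  replace h₃ := right_ne_zero_of_mul h₃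
  replace h₃' := right_ne_zero_of_mul h₃'
  have hdeg' := natDegree_le_of_columns h hcol'
  obtain ⟨Q, hQ, hQP⟩ := exists_quotient hdeg' h₂ h₂' h₃'
  -- The extreme columns of the divisor are nonzero.
  obtain ⟨e, he, he'⟩ : ∃ e : k, e ≠ 0 ∧ P'.map (evalRingHom 1) = (X - C 1) ^ (3 * d) * C e := by
    obtain ⟨G', hG'⟩ := h₂'
    obtain ⟨e, he, -, he'⟩ := map_eval_one_eq hdeg' hG' h₃'
    exact ⟨e, he, by rw [C_1]; exact he'⟩
  obtain ⟨e₀, he₀⟩ : ∃ e₀, e₀ • (1 : k[X]) = P'.coeff 0 :=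
    Submodule.mem_span_singleton.mp
      (Submodule.span_mono (columnPowers_zero_subset h) (hcol' 0))
  obtain ⟨e₁, he₁⟩ : ∃ e₁ : k, e₁ • (X ^ (p * (c * d)) : k[X]) = P'.coeff (3 * d) :=
    Submodule.mem_span_singleton.mp
      (Submodule.span_mono (columnPowers_last_subset h) (hcol' _))
  rw [smul_eq_C_mul] at he₀ he₁
  rw [mul_one] at he₀
  have he₀' : e₀ ≠ 0 := by
    have := congr_arg (eval 0) he'
    rw [← coeff_zero_eq_eval_zero, coeff_map, ← he₀] at this
    simp only [coe_evalRingHom, eval_C, eval_mul, eval_pow, eval_sub, eval_X] at this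
    rw [this]
    exact mul_ne_zero (pow_ne_zero _ (by simp)) he
  have he₁' : e₁ = e := by
    have := congr_arg (fun f => f.coeff (3 * d)) he'
    have hmonic := (monic_X_sub_C (1 : k)).pow (3 * d)
    have hlead : ((X - C (1 : k)) ^ (3 * d)).coeff (3 * d) = 1 := by
      have := hmonic.coeff_natDegree
      rwa [natDegree_pow, natDegree_X_sub_C, mul_one] at this
    simpa only [coeff_map, ← he₁, coe_evalRingHom, eval_mul, eval_C, eval_pow, eval_X, one_pow,
      mul_one, coeff_mul_C, hlead, one_mul] using this
  -- Compare columns over `k[Y] / (Y - 1)ⁿ`.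
  let I : Ideal k[X] := Ideal.span {(X - 1) ^ (3 * r + 1)}
  have hmk (F : k[X][X]) : C (X - 1) ^ (3 * r + 1) ∣ F ↔ F.map (Ideal.Quotient.mk I) = 0 := by
    rw [← C_pow, C_dvd_iff_dvd_coeff, Polynomial.ext_iff]
    refine forall_congr' fun i => ?_
    rw [coeff_map, coeff_zero, Ideal.Quotient.eq_zero_iff_mem, Ideal.mem_span_singleton]
  have : Nontrivial (k[X] ⧸ I) := by
    refine Ideal.Quotient.nontrivial_iff.mpr fun htop => ?_
    have h1 : IsUnit ((X - 1 : k[X]) ^ (3 * r + 1)) := Ideal.span_singleton_eq_top.mp htop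
    have h2 : IsUnit (X - C 1 : k[X]) := by
      rw [C_1]
      exact (isUnit_pow_iff (by omega)).mp h1
    exact not_isUnit_X_sub_C (1 : k) h2
  let f : k[X] →ₐ[k] k[X] ⧸ I := Ideal.Quotient.mkₐ k I
  obtain ⟨yi, hyi⟩ : ∃ yi, f X * yi = 1 := by
    refine IsUnit.exists_right_inv ?_
    have h1 : IsNilpotent (f (X - 1)) := by
      refine ⟨3 * r + 1, ?_⟩
      rw [← map_pow]
      exact Ideal.Quotient.eq_zero_iff_mem.mpr (Ideal.mem_span_singleton_self _)
    have h2 := h1.isUnit_add_one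
    rwa [← map_one f, ← map_add, sub_add_cancel] at h2
  have hmap (F : k[X][X]) : F.map f.toRingHom = F.map (Ideal.Quotient.mk I) := rfl
  obtain ⟨hQdeg, hQcol⟩ := h.coeff_mem_of_mul_eq f hyi (Q := Q.map f.toRingHom) hcol hcol' he₀' he
    he₀.symm (by rw [← he₁, he₁'])
    (by rw [← Polynomial.map_mul, ← sub_eq_zero, ← Polynomial.map_sub]; exact (hmk _).mp hQP)
  have hlift (κ) (hκ : κ ∈ Finset.range (3 * r + 1)) :
      ∃ g ∈ Submodule.span k (columnPowers k m a c p q r κ), f g = (Q.map f.toRingHom).coeff κ := by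
    have h1 := hQcol κ (by simpa [Nat.lt_succ_iff] using hκ)
    have h2 := Submodule.map_span f.toLinearMap (columnPowers k m a c p q r κ)
    rw [AlgHom.coe_toLinearMap] at h2
    rw [← h2] at h1
    exact h1
  choose! g hg hgQ using hlift
  choose! ζ hζ hζθ using fun κ (hκ : κ ∈ Finset.range (3 * r + 1)) =>
    h.exists_section_of_column (hg κ hκ)
  let G : k[X][X] := ∑ κ ∈ Finset.range (3 * r + 1), C (g κ) * X ^ κ
  have hGθ : theta m p q (C.comp C) X (C X) (∑ κ ∈ Finset.range (3 * r + 1), ζ κ) =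
      X ^ (8 * a * r) * G := by
    rw [map_sum, Finset.mul_sum]
    exact Finset.sum_congr rfl hζθ
  have hGQ : C (X - 1) ^ (3 * r + 1) ∣ G - Q := by
    rw [hmk, Polynomial.map_sub, sub_eq_zero, ← hmap, ← hmap,
      (Q.map f.toRingHom).as_sum_range' (3 * r + 1) (by omega)]
    simp only [G, Polynomial.map_sum, Polynomial.map_mul, Polynomial.map_pow, map_C, map_X]
    exact Finset.sum_congr rfl fun κ hκ => by
      rw [← C_mul_X_pow_eq_monomial, ← hgQ κ hκ]
      rfl
  refine ⟨∑ κ ∈ Finset.range (3 * r + 1), ζ κ, ?_, ?_, ?_⟩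
  · exact (MvPolynomial.weightedHomogeneousSubmodule k _ _).sum_mem fun κ hκ => hζ κ hκ
  · rw [← blowupSubst_theta, hGθ, map_mul]
    refine Dvd.dvd.mul_left ?_ _
    obtain ⟨T, hT⟩ := hGQ
    have h1 : blowupSubst k G = blowupSubst k Q +
        (X - 1) ^ (3 * r) * ((X - 1) * C X ^ (3 * r + 1) * blowupSubst k T) := by
      rw [← sub_add_cancel G Q, hT, map_add, map_mul, map_pow]
      simp only [map_sub, blowupSubst_C_X, map_one, add_sub_cancel_left, mul_pow]
      ring
    rw [h1]
    exact dvd_add hQ (dvd_mul_right _ _)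
  · rw [← map_eval_theta, hGθ, Polynomial.map_mul, Polynomial.map_pow, map_X]
    refine mul_ne_zero (pow_ne_zero _ X_ne_zero) fun hG => h₃ ?_
    obtain ⟨T, hT⟩ := hGQ
    obtain ⟨T', hT'⟩ := hQP
    have h1 : P = P' * G - C (X - 1) ^ (3 * r + 1) * (T' + P' * T) := by
      linear_combination -hT' - P' * hT
    rw [h1, Polynomial.map_sub, Polynomial.map_mul, hG, mul_zero, Polynomial.map_mul,
      Polynomial.map_pow, map_C]
    simp

/-- The set of `d` that admit a section consists of the multiples of its least positive element. -/
lemma exists_forall_hasSection_iff (h : IsTriple m a b c p q) :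
    ∃ d₀, ∀ d, HasSection k m a b c p q d ↔ ∃ n, d = n * d₀ := by
  classical
  by_cases hex : ∃ d, 0 < d ∧ HasSection k m a b c p q d
  · obtain ⟨hpos, hd₀⟩ := Nat.find_spec hex
    set d₀ := Nat.find hex
    have hmul (n : ℕ) : HasSection k m a b c p q (n * d₀) := by
      induction n with
      | zero => simpa using hasSection_zero
      | succ n ih => simpa [add_mul] using ih.add hd₀
    refine ⟨d₀, fun d => ⟨fun hd => ⟨d / d₀, ?_⟩, fun ⟨n, hn⟩ => hn ▸ hmul n⟩⟩
    have hmod : HasSection k m a b c p q (d % d₀) :=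
      (hmul (d / d₀)).of_add h (by rwa [mul_comm, Nat.div_add_mod])
    have hzero : d % d₀ = 0 := by
      by_contra hne
      exact Nat.find_min hex (Nat.mod_lt d hpos) ⟨Nat.pos_of_ne_zero hne, hmod⟩
    rw [mul_comm, Nat.mul_div_cancel' (Nat.dvd_of_mod_eq_zero hzero)]
  · refine ⟨0, fun d => ⟨fun hd => ⟨0, ?_⟩, ?_⟩⟩
    · by_contra hne
      exact hex ⟨d, by omega, hd⟩
    · rintro ⟨n, rfl⟩
      simpa using hasSection_zero

end Good

/-! ### Inverse image ideal sheaves -/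

section IdealSheaf

variable {X Y Z : Scheme.{u}}

lemma ideal_comap_top_of_isAffine [IsAffine X] [IsAffine Y] (I : Y.IdealSheafData) (f : X ⟶ Y) :
    (I.comap f).ideal ⟨⊤, isAffineOpen_top X⟩ =
      (I.ideal ⟨⊤, isAffineOpen_top Y⟩).map f.appTop.hom := by
  have key (J : Ideal Γ(X, ⊤)) : (I.comap f).ideal ⟨⊤, isAffineOpen_top X⟩ ≤ J ↔
      (I.ideal ⟨⊤, isAffineOpen_top Y⟩).map f.appTop.hom ≤ J := by
    have h1 := OrderIsoClass.map_le_map_iff (Scheme.IdealSheafData.equivOfIsAffine (X := X))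
      (a := I.comap f) (b := Scheme.IdealSheafData.equivOfIsAffine.symm J)
    have h2 := OrderIsoClass.map_le_map_iff (Scheme.IdealSheafData.equivOfIsAffine (X := Y))
      (a := I) (b := (Scheme.IdealSheafData.equivOfIsAffine.symm J).map f)
    have h3 : (Scheme.IdealSheafData.equivOfIsAffine.symm J).ideal ⟨⊤, isAffineOpen_top X⟩ = J :=
      Scheme.IdealSheafData.equivOfIsAffine.apply_symm_apply J
    simp only [Scheme.IdealSheafData.equivOfIsAffine_apply] at h1 h2
    rw [h3] at h1
    rw [Scheme.IdealSheafData.ideal_map_of_isAffineHom, ← Ideal.map_le_iff_le_comap] at h2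
    rw [h1, ← Scheme.IdealSheafData.le_map_iff_comap_le, ← h2]
    exact Iff.of_eq (congr_arg (_ ≤ ·) h3)
  exact le_antisymm ((key _).mpr le_rfl) ((key _).mp le_rfl)

lemma ideal_top_comap_ι (I : Y.IdealSheafData) (U : Y.affineOpens) [IsAffine U.1] :
    (I.comap U.1.ι).ideal ⟨⊤, isAffineOpen_top _⟩ = (I.ideal U).map U.1.topIso.inv.hom := by
  rw [Scheme.IdealSheafData.ideal_comap_of_isOpenImmersion]
  have h1 : (⟨U.1.ι ''ᵁ ⊤, (isAffineOpen_top U.1.toScheme).image_of_isOpenImmersion U.1.ι⟩ :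
      Y.affineOpens) ≤ U := U.1.ι_image_top.le
  have h2 := I.map_ideal h1
  rw [← h2, Scheme.Opens.ι_appIso]
  exact Ideal.comap_id _

/-- The inverse image ideal sheaf is generated by the images of sections of the ideal sheaf. -/
lemma ideal_comap (I : Y.IdealSheafData) (f : X ⟶ Y) (U : Y.affineOpens) (V : X.affineOpens)
    (e : V.1 ≤ f ⁻¹ᵁ U.1) :
    (I.comap f).ideal V = (I.ideal U).map (f.appLE U.1 V.1 e).hom := by
  have : IsAffine V.1 := V.2
  have : IsAffine U.1 := U.2
  have h1 := ideal_top_comap_ι (I.comap f) V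
  have h2 : f.resLE U.1 V.1 e ≫ U.1.ι = V.1.ι ≫ f := Scheme.Hom.resLE_comp_ι ..
  rw [← Scheme.IdealSheafData.comap_comp, ← h2, Scheme.IdealSheafData.comap_comp,
    ideal_comap_top_of_isAffine, ideal_top_comap_ι, Ideal.map_map] at h1
  have h3 := congr_arg (Ideal.map V.1.topIso.hom.hom) h1
  rw [Ideal.map_map, Ideal.map_map, ← CommRingCat.hom_comp, ← CommRingCat.hom_comp,
    ← CommRingCat.hom_comp, Iso.inv_hom_id, CommRingCat.hom_id, Ideal.map_id] at h3
  rw [← h3]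
  congr 2
  have h4 : (f.resLE U.1 V.1 e).appTop = U.1.topIso.hom ≫ f.appLE U.1 V.1 e ≫ V.1.topIso.inv :=
    Scheme.Hom.resLE_app_top ..
  rw [h4, Iso.inv_hom_id_assoc, Category.assoc, Iso.inv_hom_id, Category.comp_id]

/-! ### Effective Cartier divisors -/

lemma mem_nonZeroDivisors_of_span_eq {R : Type*} [CommRing R] {f g : R}
    (hf : f ∈ nonZeroDivisors R) (h : Ideal.span {f} = Ideal.span {g}) :
    g ∈ nonZeroDivisors R := by
  obtain ⟨a, ha⟩ := Ideal.mem_span_singleton'.mp (h ▸ Ideal.mem_span_singleton_self f :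
    f ∈ Ideal.span {g})
  rw [← ha] at hf
  exact (mul_mem_nonZeroDivisors.mp hf).2

lemma IsEffectiveCartier.exists_le {J : X.IdealSheafData} (hJ : IsEffectiveCartier J) {x : X}
    {O : X.Opens} (hx : x ∈ O) :
    ∃ V : X.affineOpens, x ∈ V.1 ∧ V.1 ≤ O ∧
      ∃ f : Γ(X, V.1), f ∈ nonZeroDivisors Γ(X, V.1) ∧ J.ideal V = Ideal.span {f} := by
  obtain ⟨U, hxU, f, hf, hJU⟩ := hJ x
  obtain ⟨g, hg, hxg⟩ := U.2.exists_basicOpen_le ⟨x, hx⟩ hxU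
  have hle : X.basicOpen g ≤ U.1 := X.basicOpen_le g
  refine ⟨⟨X.basicOpen g, U.2.basicOpen g⟩, hxg, hg, algebraMap Γ(X, U.1) _ f, ?_, ?_⟩
  · have := U.2.isLocalization_basicOpen g
    exact IsLocalization.map_nonZeroDivisors_le (Submonoid.powers g) _
      (Submonoid.mem_map_of_mem _ hf)
  · rw [← J.map_ideal (U := ⟨X.basicOpen g, U.2.basicOpen g⟩) hle, hJU, Ideal.map_span,
      Set.image_singleton]
    rfl

lemma IsEffectiveCartier.comap_isOpenImmersion {J : Y.IdealSheafData} (hJ : IsEffectiveCartier J)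
    (j : X ⟶ Y) [IsOpenImmersion j] : IsEffectiveCartier (J.comap j) := by
  intro x
  obtain ⟨V, hxV, hV, f, hf, hJV⟩ := hJ.exists_le (show j x ∈ j.opensRange from ⟨x, rfl⟩)
  have hV' : IsAffineOpen (j ⁻¹ᵁ V.1) := V.2.preimage_of_isOpenImmersion j hV
  refine ⟨⟨_, hV'⟩, hxV, j.app V.1 f, ?_, ?_⟩
  · have : IsIso (j.app V.1) := j.isIso_app V.1 hV
    rw [← MulEquivClass.map_nonZeroDivisors (asIso (j.app V.1)).commRingCatIsoToRingEquiv]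
    exact Submonoid.mem_map_of_mem _ hf
  · rw [ideal_comap J j V ⟨_, hV'⟩ le_rfl, hJV, Ideal.map_span, Set.image_singleton,
      Scheme.Hom.appLE_eq_app]

lemma isEffectiveCartier_top : IsEffectiveCartier (⊤ : X.IdealSheafData) := by
  intro x
  obtain ⟨_, ⟨U, hU, rfl⟩, hxU, -⟩ :=
    X.isBasis_affineOpens.exists_subset_of_mem_open (Set.mem_univ x) isOpen_univ
  exact ⟨⟨U, hU⟩, hxU, 1, one_mem _, by simp⟩

/-! ### Charts of a blow-up -/

/-- A criterion for the lift of `b : Z ⟶ Y` to the blow-up to be an open immersion onto `Ω`: locally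
on `Ω` the blow-up maps to `Z` over `Y`, and morphisms to `Z` over `Y` are unique. -/
theorem IsBlowUp.exists_isOpenImmersion {π : X ⟶ Y} {I : Y.IdealSheafData} (hπ : IsBlowUp π I)
    {b : Z ⟶ Y} (hb : IsEffectiveCartier (I.comap b)) (Ω : X.Opens)
    (hcov : ∀ p ∈ Ω, ∃ W : X.Opens, p ∈ W ∧ ∃ σ : W.toScheme ⟶ Z, σ ≫ b = W.ι ≫ π)
    (huniq : ∀ (Z' : Scheme.{u}) (g₁ g₂ : Z' ⟶ Z), IsEffectiveCartier (I.comap (g₁ ≫ b)) →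
      g₁ ≫ b = g₂ ≫ b → g₁ = g₂)
    (hrange : ∀ l : Z ⟶ X, l ≫ π = b → ∀ z, l z ∈ Ω) :
    ∃ (l : Z ⟶ X) (_ : IsOpenImmersion l), l ≫ π = b ∧ l.opensRange = Ω := by
  have hcart {W : Scheme.{u}} (j : W ⟶ X) [IsOpenImmersion j] :
      IsEffectiveCartier (I.comap (j ≫ π)) := by
    rw [Scheme.IdealSheafData.comap_comp]
    exact hπ.isEffectiveCartier.comap_isOpenImmersion j
  choose W hW σ hσ using fun p : Ω => hcov p.1 p.2
  -- Glue the local morphisms.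
  let 𝒰 : Ω.toScheme.OpenCover := Scheme.openCoverOfIsOpenCover Ω.toScheme
    (fun p : Ω => Ω.ι ⁻¹ᵁ W p) (.mk (top_le_iff.mp fun p _ => Opens.mem_iSup.mpr ⟨p, hW p⟩))
  have hτ (p : Ω) : (Ω.ι ∣_ W p ≫ σ p) ≫ b = 𝒰.f p ≫ Ω.ι ≫ π := by
    rw [Category.assoc, hσ, morphismRestrict_ι_assoc]
    rfl
  have hfst (p p' : Ω) : (Limits.pullback.fst (𝒰.f p) (𝒰.f p') ≫ Ω.ι ∣_ W p ≫ σ p) ≫ b =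
      (Limits.pullback.fst (𝒰.f p) (𝒰.f p') ≫ 𝒰.f p ≫ Ω.ι) ≫ π :=
    (Category.assoc _ _ _).trans
      ((congr_arg (Limits.pullback.fst (𝒰.f p) (𝒰.f p') ≫ ·) (hτ p)).trans (by simp))
  have hsnd (p p' : Ω) : (Limits.pullback.snd (𝒰.f p) (𝒰.f p') ≫ Ω.ι ∣_ W p' ≫ σ p') ≫ b =
      (Limits.pullback.snd (𝒰.f p) (𝒰.f p') ≫ 𝒰.f p' ≫ Ω.ι) ≫ π :=
    (Category.assoc _ _ _).trans
      ((congr_arg (Limits.pullback.snd (𝒰.f p) (𝒰.f p') ≫ ·) (hτ p')).trans (by simp))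
  let τ : Ω.toScheme ⟶ Z := 𝒰.glueMorphisms (fun p => Ω.ι ∣_ W p ≫ σ p) fun p p' => by
    refine huniq _ _ _ ?_ ((hfst p p').trans (Eq.trans ?_ (hsnd p p').symm))
    · exact (hfst p p') ▸ hcart (Limits.pullback.fst (𝒰.f p) (𝒰.f p') ≫ 𝒰.f p ≫ Ω.ι)
    · rw [Limits.pullback.condition_assoc]
  have hτb : τ ≫ b = Ω.ι ≫ π := by
    refine 𝒰.hom_ext _ _ fun p => ?_
    rw [← Category.assoc, Scheme.Cover.ι_glueMorphisms]
    exact hτ p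
  obtain ⟨l, hl, -⟩ := hπ.existsUnique_lift Z b hb
  have hτl : τ ≫ l = Ω.ι := by
    obtain ⟨_, -, h⟩ := hπ.existsUnique_lift Ω.toScheme (Ω.ι ≫ π) (hcart Ω.ι)
    exact (h (τ ≫ l) ((Category.assoc _ _ _).trans (by rw [hl, hτb]))).trans (h _ rfl).symm
  have hlΩ : Set.range l ⊆ Set.range Ω.ι := by
    rintro _ ⟨z, rfl⟩
    rw [Scheme.Opens.range_ι]
    exact hrange l hl z
  let l' : Z ⟶ Ω := IsOpenImmersion.lift Ω.ι l hlΩ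
  have hl' : l' ≫ Ω.ι = l := IsOpenImmersion.lift_fac ..
  have hτl' : τ ≫ l' = 𝟙 _ := by
    rw [← cancel_mono Ω.ι, Category.assoc, hl', hτl, Category.id_comp]
  have hlτ : l' ≫ τ = 𝟙 _ := by
    have h1 : (l' ≫ τ) ≫ b = b := by
      rw [Category.assoc, hτb, ← Category.assoc, hl', hl]
    exact huniq _ _ _ (by rwa [h1]) (by rw [h1, Category.id_comp])
  have : IsIso l' := ⟨τ, hlτ, hτl'⟩
  have hlopen : IsOpenImmersion l := by
    rw [← hl']
    infer_instance
  refine ⟨l, hlopen, hl, ?_⟩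
  refine le_antisymm ?_ ?_
  · rintro _ ⟨z, rfl⟩
    exact hrange l hl z
  · intro p hp
    refine ⟨τ ⟨p, hp⟩, ?_⟩
    exact congr_arg (fun f : Ω.toScheme ⟶ X => f (⟨p, hp⟩ : Ω)) hτl

end IdealSheaf

section Chart

/-- `φ : A → B` is the chart of the blow-up of the ideal `(s, t)` on which `s` generates the inverse
image of that ideal: it is universal among the homomorphisms `ψ` such that `ψ s` is a nonzerodivisor
which divides `ψ t`. -/
structure IsBlowupChart {A B : Type u} [CommRing A] [CommRing B] (φ : A →+* B) (s t : A) :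
    Prop where
  mem_nonZeroDivisors : φ s ∈ nonZeroDivisors B
  dvd : φ s ∣ φ t
  exists_lift : ∀ {R : Type u} [CommRing R] (ψ : A →+* R), ψ s ∈ nonZeroDivisors R →
    ψ s ∣ ψ t → ∃ β : B →+* R, β.comp φ = ψ
  unique : ∀ {R : Type u} [CommRing R] (β₁ β₂ : B →+* R), β₁ (φ s) ∈ nonZeroDivisors R →
    β₁.comp φ = β₂.comp φ → β₁ = β₂

variable {X Y : Scheme.{u}} {π : X ⟶ Y} {I : Y.IdealSheafData}

/-- The open set where `s` is locally a nonzerodivisor that divides `t`. -/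
def chartDomain (π : X ⟶ Y) (U : Y.Opens) (s t : Γ(Y, U)) : X.Opens :=
  ⨆ (V : {V : X.affineOpens // ∃ e : V.1 ≤ π ⁻¹ᵁ U,
    (π.appLE U V.1 e) s ∈ nonZeroDivisors Γ(X, V.1) ∧
      (π.appLE U V.1 e) s ∣ (π.appLE U V.1 e) t}), V.1.1

lemma mem_chartDomain {U : Y.Opens} {s t : Γ(Y, U)} {p : X} :
    p ∈ chartDomain π U s t ↔ ∃ (V : X.affineOpens) (e : V.1 ≤ π ⁻¹ᵁ U), p ∈ V.1 ∧
      (π.appLE U V.1 e) s ∈ nonZeroDivisors Γ(X, V.1) ∧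
      (π.appLE U V.1 e) s ∣ (π.appLE U V.1 e) t := by
  rw [chartDomain, Opens.mem_iSup]
  constructor
  · rintro ⟨⟨V, e, h⟩, hp⟩
    exact ⟨V, e, hp, h⟩
  · rintro ⟨V, e, hp, h⟩
    exact ⟨⟨V, e, h⟩, hp⟩

lemma mem_chartDomain_of_mem_basicOpen {U : Y.Opens} {s t : Γ(Y, U)} {V : X.affineOpens}
    {e : V.1 ≤ π ⁻¹ᵁ U} {f α β : Γ(X, V.1)} (hf : f ∈ nonZeroDivisors Γ(X, V.1))
    (hs : (π.appLE U V.1 e) s = f * α) (ht : (π.appLE U V.1 e) t = f * β) {p : X}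
    (hp : p ∈ X.basicOpen α) : p ∈ chartDomain π U s t := by
  have hle : X.basicOpen α ≤ V.1 := X.basicOpen_le α
  refine mem_chartDomain.mpr ⟨⟨X.basicOpen α, V.2.basicOpen α⟩, hle.trans e, hp, ?_⟩
  let ρ : Γ(X, V.1) →+* Γ(X, X.basicOpen α) := (X.presheaf.map (homOfLE hle).op).hom
  have hρ (x) : (π.appLE U (X.basicOpen α) (hle.trans e)) x = ρ ((π.appLE U V.1 e) x) := by
    rw [← Scheme.Hom.appLE_map π e (homOfLE hle).op]
    rfl
  have hα : IsUnit (ρ α) := X.toRingedSpace.isUnit_res_basicOpen α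
  have hρf : ρ f ∈ nonZeroDivisors Γ(X, X.basicOpen α) := by
    have := V.2.isLocalization_basicOpen α
    exact IsLocalization.map_nonZeroDivisors_le (Submonoid.powers α) _
      (Submonoid.mem_map_of_mem _ hf)
  change (π.appLE U (X.basicOpen α) (hle.trans e)) s ∈ _ ∧
    (π.appLE U (X.basicOpen α) (hle.trans e)) s ∣ (π.appLE U (X.basicOpen α) (hle.trans e)) t
  rw [hρ, hρ, hs, ht, map_mul, map_mul]
  exact ⟨mul_mem hρf hα.mem_nonZeroDivisors, mul_dvd_mul_left _ hα.dvd⟩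

lemma IsBlowUp.exists_local (hπ : IsBlowUp π I) {U : Y.Opens} {s t : Γ(Y, U)}
    {hU : IsAffineOpen U}
    (hI : I.ideal ⟨U, hU⟩ = Ideal.span {s, t}) {p : X} (hp : π p ∈ U) :
    ∃ (V : X.affineOpens) (e : V.1 ≤ π ⁻¹ᵁ U) (f α β c d : Γ(X, V.1)), p ∈ V.1 ∧
      f ∈ nonZeroDivisors Γ(X, V.1) ∧ (π.appLE U V.1 e) s = f * α ∧
      (π.appLE U V.1 e) t = f * β ∧ c * α + d * β = 1 := by
  obtain ⟨V, hpV, e, f, hf, hIf⟩ :=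
    hπ.isEffectiveCartier.exists_le (show p ∈ π ⁻¹ᵁ U from hp)
  rw [ideal_comap I π ⟨U, hU⟩ V e, hI, Ideal.map_span, Set.image_pair] at hIf
  have h1 : (π.appLE U V.1 e).hom s ∈ Ideal.span {f} := hIf ▸ Ideal.subset_span (by simp)
  have h2 : (π.appLE U V.1 e).hom t ∈ Ideal.span {f} := hIf ▸ Ideal.subset_span (by simp)
  have h3 := Ideal.mem_span_pair.mp (hIf.symm ▸ Ideal.mem_span_singleton_self f)
  obtain ⟨α, hα⟩ := Ideal.mem_span_singleton.mp h1
  obtain ⟨β, hβ⟩ := Ideal.mem_span_singleton.mp h2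
  obtain ⟨c, d, hcd⟩ := h3
  refine ⟨V, e, f, α, β, c, d, hpV, hf, hα, hβ, ?_⟩
  refine mul_cancel_left_mem_nonZeroDivisors hf |>.mp ?_
  rw [hα, hβ] at hcd
  linear_combination hcd

/-- The preimage of `U` is covered by the domains of the two charts. -/
lemma IsBlowUp.mem_chartDomain_or (hπ : IsBlowUp π I) {U : Y.Opens} {s t : Γ(Y, U)}
    {hU : IsAffineOpen U}
    (hI : I.ideal ⟨U, hU⟩ = Ideal.span {s, t}) {p : X} (hp : π p ∈ U) :
    p ∈ chartDomain π U s t ∨ p ∈ chartDomain π U t s := by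
  obtain ⟨V, e, f, α, β, c, d, hpV, hf, hs, ht, h1⟩ := hπ.exists_local hI hp
  have h2 : p ∈ X.basicOpen α ∨ p ∈ X.basicOpen β := by
    by_contra! h
    rw [X.mem_basicOpen _ _ hpV, X.mem_basicOpen _ _ hpV] at h
    have h3 := congr_arg (X.presheaf.germ V.1 p hpV) h1
    rw [map_add, map_mul, map_mul, map_one] at h3
    have h4 : ∀ x y : X.presheaf.stalk p, ¬ IsUnit x → ¬ IsUnit (y * x) :=
      fun x y hx hxy => hx (isUnit_of_mul_isUnit_right hxy)
    have h5 := IsLocalRing.nonunits_add (h4 _ (X.presheaf.germ V.1 p hpV c) h.1)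
      (h4 _ (X.presheaf.germ V.1 p hpV d) h.2)
    rw [h3] at h5
    exact h5 isUnit_one
  exact h2.imp (mem_chartDomain_of_mem_basicOpen hf hs ht)
    (mem_chartDomain_of_mem_basicOpen hf ht hs)

lemma appLE_SpecMap_fromSpec {U : Y.Opens} (hU : IsAffineOpen U) {B : CommRingCat.{u}}
    (φ : Γ(Y, U) ⟶ B) (W : (Spec B).Opens) (e : W ≤ (Spec.map φ ≫ hU.fromSpec) ⁻¹ᵁ U) :
    (Spec.map φ ≫ hU.fromSpec).appLE U W e =
      φ ≫ (Scheme.ΓSpecIso B).inv ≫ (Spec B).presheaf.map (homOfLE le_top).op := by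
  rw [Scheme.Hom.comp_appLE, hU.fromSpec_app_self, Category.assoc,
    Scheme.ΓSpecIso_inv_naturality_assoc]
  exact congr_arg _ (Scheme.Hom.map_appLE (Spec.map φ) _ _)

lemma appLE_SpecMap_fromSpec_dvd {U : Y.Opens} (hU : IsAffineOpen U) {B : CommRingCat.{u}}
    (φ : Γ(Y, U) ⟶ B) (W : (Spec B).Opens) (e : W ≤ (Spec.map φ ≫ hU.fromSpec) ⁻¹ᵁ U)
    {s t : Γ(Y, U)} (hst : φ s ∣ φ t) :
    (Spec.map φ ≫ hU.fromSpec).appLE U W e s ∣ (Spec.map φ ≫ hU.fromSpec).appLE U W e t := by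
  rw [appLE_SpecMap_fromSpec hU φ W e]
  exact map_dvd ((Scheme.ΓSpecIso B).inv ≫ (Spec B).presheaf.map (homOfLE le_top).op).hom hst

lemma appLE_SpecMap_fromSpec_ne_zero {U : Y.Opens} (hU : IsAffineOpen U) {B : CommRingCat.{u}}
    [IsDomain B] (φ : Γ(Y, U) ⟶ B) (W : (Spec B).Opens) [Nonempty W]
    (e : W ≤ (Spec.map φ ≫ hU.fromSpec) ⁻¹ᵁ U) {s : Γ(Y, U)} (hs : φ s ≠ 0) :
    (Spec.map φ ≫ hU.fromSpec).appLE U W e s ≠ 0 := by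
  rw [appLE_SpecMap_fromSpec hU φ W e]
  have h1 : Function.Injective ((Spec B).presheaf.map (homOfLE (le_top : W ≤ ⊤)).op).hom :=
    map_injective_of_isIntegral (Spec B) (homOfLE le_top)
  have h2 : Function.Injective (Scheme.ΓSpecIso B).inv.hom :=
    (Scheme.ΓSpecIso B).symm.commRingCatIsoToRingEquiv.injective
  exact ((map_ne_zero_iff _ h1).mpr ((map_ne_zero_iff _ h2).mpr hs) :)

/-- The charts of the blow-up of an ideal with two generators. -/
theorem IsBlowUp.exists_chart (hπ : IsBlowUp π I) {U : Y.Opens} (hU : IsAffineOpen U)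
    (s t : Γ(Y, U)) (hI : I.ideal ⟨U, hU⟩ = Ideal.span {s, t}) {B : CommRingCat.{u}} [IsDomain B]
    (φ : Γ(Y, U) ⟶ B) (hφ : IsBlowupChart φ.hom s t) :
    ∃ (l : Spec B ⟶ X) (_ : IsOpenImmersion l), l ≫ π = Spec.map φ ≫ hU.fromSpec ∧
      l.opensRange = chartDomain π U s t := by
  have hφs : φ s ≠ 0 := nonZeroDivisors.ne_zero hφ.mem_nonZeroDivisors
  have hmem (z : Spec B) : (Spec.map φ ≫ hU.fromSpec) z ∈ U := by
    rw [Scheme.Hom.comp_apply, ← SetLike.mem_coe, ← hU.range_fromSpec]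
    exact ⟨_, rfl⟩
  have hspan {Z : Scheme.{u}} (g : Z ⟶ Y) {V : Z.Opens} (hV : IsAffineOpen V)
      (e : V ≤ g ⁻¹ᵁ U) :
      (I.comap g).ideal ⟨V, hV⟩ = Ideal.span {g.appLE U V e s, g.appLE U V e t} := by
    rw [ideal_comap I g ⟨U, hU⟩ ⟨V, hV⟩ e, hI, Ideal.map_span, Set.image_pair]
  have hpair {R : Type u} [CommRing R] {a b : R} (h : a ∣ b) :
      Ideal.span {a, b} = Ideal.span {a} := by
    rw [Ideal.span_insert, sup_eq_left, Ideal.span_singleton_le_span_singleton]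
    exact h
  refine hπ.exists_isOpenImmersion ?_ (chartDomain π U s t) ?_ ?_ ?_
  · intro z
    have e : (⊤ : (Spec B).Opens) ≤ (Spec.map φ ≫ hU.fromSpec) ⁻¹ᵁ U := fun z _ => hmem z
    have : Nonempty (⊤ : (Spec B).Opens) := ⟨⟨z, trivial⟩⟩
    exact ⟨⟨⊤, isAffineOpen_top _⟩, trivial, _, mem_nonZeroDivisors_of_ne_zero
      (appLE_SpecMap_fromSpec_ne_zero hU φ ⊤ e hφs), (hspan _ (isAffineOpen_top _) e).trans
      (hpair (appLE_SpecMap_fromSpec_dvd hU φ ⊤ e hφ.dvd))⟩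
  · intro p hp
    obtain ⟨⟨V, hV⟩, e, hpV, h1, h2⟩ := mem_chartDomain.mp hp
    obtain ⟨β, hβ⟩ := hφ.exists_lift (π.appLE U V e).hom h1 h2
    have hβ' : φ ≫ CommRingCat.ofHom β = π.appLE U V e := CommRingCat.hom_ext hβ
    refine ⟨V, hpV, V.toSpecΓ ≫ Spec.map (CommRingCat.ofHom β), ?_⟩
    rw [Category.assoc, ← Spec.map_comp_assoc, hβ', IsAffineOpen.SpecMap_appLE_fromSpec π hU hV e,
      hV.toSpecΓ_fromSpec_assoc]
  · intro Z' g₁ g₂ hg hgg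
    have key {V : Z'.Opens} (hV : IsAffineOpen V) (f : Γ(Z', V)) (hf : f ∈ nonZeroDivisors Γ(Z', V))
        (hVf : (I.comap (g₁ ≫ Spec.map φ ≫ hU.fromSpec)).ideal ⟨V, hV⟩ = Ideal.span {f}) :
        V.ι ≫ g₁ = V.ι ≫ g₂ := by
      obtain ⟨β₁, h₁⟩ := Spec.map_surjective (hV.fromSpec ≫ g₁)
      obtain ⟨β₂, h₂⟩ := Spec.map_surjective (hV.fromSpec ≫ g₂)
      have e : V ≤ (g₁ ≫ Spec.map φ ≫ hU.fromSpec) ⁻¹ᵁ U := fun z _ => hmem (g₁ z)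
      have h3 : (g₁ ≫ Spec.map φ ≫ hU.fromSpec).appLE U V e = φ ≫ β₁ := by
        apply Spec.map_injective
        rw [← cancel_mono hU.fromSpec, IsAffineOpen.SpecMap_appLE_fromSpec _ hU hV e,
          Spec.map_comp, h₁]
        simp only [Category.assoc]
      have h4 : φ ≫ β₁ = φ ≫ β₂ := by
        apply Spec.map_injective
        rw [← cancel_mono hU.fromSpec, Spec.map_comp, Spec.map_comp, h₁, h₂]
        simp only [Category.assoc, hgg]
      rw [hspan _ hV e, h3] at hVf
      have h5 : β₁ = β₂ := by
        refine CommRingCat.hom_ext (hφ.unique β₁.hom β₂.hom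
          (mem_nonZeroDivisors_of_span_eq hf (hVf.symm.trans (hpair ?_))) ?_)
        · exact map_dvd β₁.hom hφ.dvd
        · exact congr_arg CommRingCat.Hom.hom h4
      rw [h5, h₂] at h₁
      rw [← hV.toSpecΓ_fromSpec, Category.assoc, Category.assoc, h₁]
    choose V hV f hf hVf using hg
    let 𝒰 : Z'.OpenCover := Scheme.openCoverOfIsOpenCover Z'
      (fun p : Z' => (V p).1) (.mk (top_le_iff.mp fun p _ => Opens.mem_iSup.mpr ⟨p, hV p⟩))
    exact 𝒰.hom_ext _ _ fun p => key (V p).2 (f p) (hf p) (hVf p)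
  · intro l hl z
    have hp : π (l z) ∈ U := by
      rw [← Scheme.Hom.comp_apply, hl]
      exact hmem z
    obtain ⟨V, e, f, α, β, c, d, hpV, hf, hs, ht, h1⟩ := hπ.exists_local hI hp
    refine mem_chartDomain_of_mem_basicOpen hf hs ht ?_
    let W := l ⁻¹ᵁ V.1
    have : Nonempty W := ⟨⟨z, hpV⟩⟩
    have eW : W ≤ (Spec.map φ ≫ hU.fromSpec) ⁻¹ᵁ U := fun z _ => hmem z
    have happ (x : Γ(Y, U)) : (Spec.map φ ≫ hU.fromSpec).appLE U W eW x =
        l.app V.1 (π.appLE U V.1 e x) := by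
      have h2 (g : Spec B ⟶ Y) (hg : l ≫ π = g) (eg : W ≤ g ⁻¹ᵁ U) :
          g.appLE U W eg = π.appLE U V.1 e ≫ l.app V.1 := by
        subst hg
        rw [← Scheme.Hom.appLE_eq_app, Scheme.Hom.appLE_comp_appLE]
      rw [h2 _ hl eW]
      rfl
    have hne := appLE_SpecMap_fromSpec_ne_zero hU φ W eW hφs
    have hdvd := appLE_SpecMap_fromSpec_dvd hU φ W eW hφ.dvd
    rw [happ, hs, map_mul] at hne
    rw [happ, happ, hs, ht, map_mul, map_mul] at hdvd
    obtain ⟨v, hv⟩ := hdvd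
    have h2 := congr_arg (l.app V.1) h1
    simp only [map_add, map_mul, map_one] at h2
    have hunit : IsUnit (l.app V.1 α) := by
      refine IsUnit.of_mul_eq_one (l.app V.1 c + l.app V.1 d * v) ?_
      have h3 : l.app V.1 β = l.app V.1 α * v :=
        mul_left_cancel₀ (left_ne_zero_of_mul hne) (by rw [hv, mul_assoc])
      rw [h3] at h2
      linear_combination h2
    have h4 : z ∈ (Spec B).basicOpen (l.app V.1 α) := by
      rw [Scheme.basicOpen_of_isUnit _ hunit]
      exact hpV
    rwa [← Scheme.preimage_basicOpen] at h4

end Chart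

/-! ### Blowing up the identity of a two-dimensional torus -/

section TorusCoordinates

open Polynomial

/-- `A` is the ring of Laurent polynomials over `k` in `x` and `y`, in terms of its universal
property. -/
structure IsTorus {k A : Type u} [Field k] [CommRing A] (ι : k →+* A) (x y : A) : Prop where
  isUnit_left : IsUnit x
  isUnit_right : IsUnit y
  hom_ext : ∀ {R : Type u} [CommRing R] (ψ₁ ψ₂ : A →+* R), ψ₁.comp ι = ψ₂.comp ι →
    ψ₁ x = ψ₂ x → ψ₁ y = ψ₂ y → ψ₁ = ψ₂
  exists_lift : ∀ {R : Type u} [CommRing R] (ι' : k →+* R) (u v : R), IsUnit u → IsUnit v →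
    ∃ ψ : A →+* R, ψ.comp ι = ι' ∧ ψ x = u ∧ ψ y = v

/-- The coordinate ring `k[X, U]_{X(1 + (X - 1)U)}` of the charts of the blow-up of a
two-dimensional torus at its identity. -/
abbrev ChartRing (k : Type u) [Field k] : Type u :=
  Localization.Away (X * (1 + (X - 1) * C X) : k[X][X])

variable {k A : Type u} [Field k] [CommRing A] {ι : k →+* A} {x y : A}

lemma one_add_ne_zero : (1 + (X - 1) * C X : k[X][X]) ≠ 0 := by
  intro h
  simpa using congr_arg (eval 1) h

instance : IsDomain (ChartRing k) :=
  IsLocalization.isDomain_localization (powers_le_nonZeroDivisors_of_noZeroDivisors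
    (mul_ne_zero X_ne_zero one_add_ne_zero))

instance : IsNoetherianRing (ChartRing k) :=
  IsLocalization.isNoetherianRing (Submonoid.powers (X * (1 + (X - 1) * C X) : k[X][X])) _
    inferInstance

/-- The constants in the ring of a chart. -/
noncomputable abbrev chartConst (k : Type u) [Field k] : k →+* ChartRing k :=
  (algebraMap k[X][X] (ChartRing k)).comp (C.comp C)

/-- The coordinate `X` of a chart. -/
noncomputable abbrev chartX (k : Type u) [Field k] : ChartRing k := algebraMap k[X][X] _ X

/-- The coordinate `U` of a chart. -/
noncomputable abbrev chartU (k : Type u) [Field k] : ChartRing k := algebraMap k[X][X] _ (C X)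

lemma isUnit_chartX_mul : IsUnit (chartX k * (1 + (chartX k - 1) * chartU k)) := by
  have h := IsLocalization.Away.algebraMap_isUnit (S := ChartRing k)
    (X * (1 + (X - 1) * C X) : k[X][X])
  simpa only [map_mul, map_add, map_sub, map_one] using h

lemma isUnit_chartX : IsUnit (chartX k) := isUnit_of_mul_isUnit_left isUnit_chartX_mul

lemma isUnit_chartY : IsUnit (1 + (chartX k - 1) * chartU k) :=
  isUnit_of_mul_isUnit_right isUnit_chartX_mul

lemma chartRing_hom_ext {R : Type u} [CommRing R] {β₁ β₂ : ChartRing k →+* R}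
    (hι : β₁.comp (chartConst k) = β₂.comp (chartConst k)) (hX : β₁ (chartX k) = β₂ (chartX k))
    (hU : β₁ (chartU k) = β₂ (chartU k)) : β₁ = β₂ := by
  refine IsLocalization.ringHom_ext (Submonoid.powers (X * (1 + (X - 1) * C X) : k[X][X])) ?_
  exact Polynomial.ringHom_ext' (Polynomial.ringHom_ext' hι hU) hX

lemma algebraMap_chartRing_injective :
    Function.Injective (algebraMap k[X][X] (ChartRing k)) :=
  IsLocalization.injective _ (powers_le_nonZeroDivisors_of_noZeroDivisors
    (mul_ne_zero X_ne_zero one_add_ne_zero))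

lemma chartX_sub_one_ne_zero : chartX k - 1 ≠ 0 := by
  have h : chartX k - 1 = algebraMap k[X][X] (ChartRing k) (X - 1) := by simp
  rw [h]
  exact (map_ne_zero_iff _ algebraMap_chartRing_injective).mpr prime_X_sub_one.ne_zero

/-- The substitution `y = 1 + (x - 1)U` describes a chart of the blow-up of the identity of a
two-dimensional torus. -/
lemma IsTorus.isBlowupChart (h : IsTorus ι x y) {φ : A →+* ChartRing k}
    (hι : φ.comp ι = chartConst k) (hx : φ x = chartX k)
    (hy : φ y = 1 + (chartX k - 1) * chartU k) : IsBlowupChart φ (x - 1) (y - 1) := by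
  have hs : φ (x - 1) = chartX k - 1 := by rw [map_sub, hx, map_one]
  have ht : φ (y - 1) = (chartX k - 1) * chartU k := by
    rw [map_sub, hy, map_one, add_sub_cancel_left]
  refine ⟨?_, ?_, ?_, ?_⟩
  · rw [hs]
    exact mem_nonZeroDivisors_of_ne_zero chartX_sub_one_ne_zero
  · rw [hs, ht]
    exact dvd_mul_right _ _
  · intro R _ ψ _ ⟨r, hr⟩
    let β₀ : k[X][X] →+* R := eval₂RingHom (eval₂RingHom (ψ.comp ι) r) (ψ x)
    have hβ₀ : IsUnit (β₀ (X * (1 + (X - 1) * C X))) := by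
      have h1 : β₀ (X * (1 + (X - 1) * C X)) = ψ x * ψ y := by
        simp only [β₀, map_mul, map_add, map_sub, map_one, coe_eval₂RingHom, eval₂_X, eval₂_C]
        rw [map_sub, map_sub, map_one] at hr
        linear_combination (-ψ x) * hr
      rw [h1]
      exact (h.isUnit_left.map ψ).mul (h.isUnit_right.map ψ)
    let β : ChartRing k →+* R := IsLocalization.Away.lift _ hβ₀
    have hβ (g : k[X][X]) : β (algebraMap _ _ g) = β₀ g := IsLocalization.Away.lift_eq _ hβ₀ g
    have hβX : β (chartX k) = ψ x := (hβ X).trans (by simp [β₀])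
    have hβU : β (chartU k) = r := (hβ (C X)).trans (by simp [β₀])
    refine ⟨β, h.hom_ext _ _ ?_ ?_ ?_⟩
    · rw [RingHom.comp_assoc, hι]
      ext c
      exact (hβ (C (C c))).trans (by simp [β₀])
    · rw [RingHom.comp_apply, hx, hβX]
    · rw [RingHom.comp_apply, hy, map_add, map_mul, map_sub, map_one, hβX, hβU]
      rw [map_sub, map_sub, map_one] at hr
      linear_combination (-1 : R) * hr
  · intro R _ β₁ β₂ hβ hβφ
    have key (a : A) : β₁ (φ a) = β₂ (φ a) := DFunLike.congr_fun hβφ a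
    have hX : β₁ (chartX k) = β₂ (chartX k) := by rw [← hx, key]
    refine chartRing_hom_ext ?_ hX ?_
    · rw [← hι, ← RingHom.comp_assoc, hβφ, RingHom.comp_assoc]
    · have h1 := key (y - 1)
      rw [ht, map_mul, map_mul, ← hs, ← key] at h1
      exact (mul_cancel_left_mem_nonZeroDivisors hβ).mp h1

/-- The identity of a two-dimensional torus is cut out by `x - 1` and `y - 1`. -/
lemma IsTorus.ker_eq_span (h : IsTorus ι x y) {ε : A →+* k} (hι : ε.comp ι = RingHom.id k)
    (hx : ε x = 1) (hy : ε y = 1) : RingHom.ker ε = Ideal.span {x - 1, y - 1} := by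
  refine le_antisymm (fun a ha => ?_) ?_
  · let mk := Ideal.Quotient.mk (Ideal.span {x - 1, y - 1})
    have h1 : mk x = 1 := by
      rw [← map_one mk, Ideal.Quotient.eq]
      exact Ideal.subset_span (by simp)
    have h2 : mk y = 1 := by
      rw [← map_one mk, Ideal.Quotient.eq]
      exact Ideal.subset_span (by simp)
    have h3 : mk = (mk.comp ι).comp ε := by
      refine h.hom_ext _ _ ?_ ?_ ?_
      · rw [RingHom.comp_assoc, hι, RingHom.comp_id]
      · rw [RingHom.comp_apply, hx, map_one, h1]
      · rw [RingHom.comp_apply, hy, map_one, h2]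
    rw [← Ideal.Quotient.eq_zero_iff_mem]
    change mk a = 0
    rw [h3, RingHom.comp_apply, (RingHom.mem_ker).mp ha, map_zero]
  · rw [Ideal.span_le]
    rintro _ (rfl | rfl) <;> simp [RingHom.mem_ker, hx, hy]

lemma IsTorus.symm (h : IsTorus ι x y) : IsTorus ι y x where
  isUnit_left := h.isUnit_right
  isUnit_right := h.isUnit_left
  hom_ext ψ₁ ψ₂ h₁ h₂ h₃ := h.hom_ext ψ₁ ψ₂ h₁ h₃ h₂
  exists_lift ι' u v hu hv :=
    let ⟨ψ, h₁, h₂, h₃⟩ := h.exists_lift ι' v u hv hu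
    ⟨ψ, h₁, h₃, h₂⟩

end TorusCoordinates

/-! ### Homomorphisms on degree-zero localizations -/

section AwayLift

variable {S : Type u} [CommRing S] {σ : Type*} [SetLike σ S] [AddSubgroupClass σ S] {𝒜 : ℕ → σ}
  [GradedRing 𝒜] {R : Type*} [CommRing R]

/-- The homomorphism `g / f ^ n ↦ κ g / (κ f) ^ n` on the degree zero part of `S_f`. -/
noncomputable def awayLift (𝒜 : ℕ → σ) [GradedRing 𝒜] {f : S} (κ : S →+* R) (hf : IsUnit (κ f)) :
    HomogeneousLocalization.Away 𝒜 f →+* R :=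
  (IsLocalization.Away.lift (S := Localization.Away f) f hf).comp
    (algebraMap (HomogeneousLocalization.Away 𝒜 f) (Localization.Away f))

lemma awayLift_mk_mul {f : S} (κ : S →+* R) (hf : IsUnit (κ f)) {d : ℕ} (hfd : f ∈ 𝒜 d) (n : ℕ)
    (g : S) (hg : g ∈ 𝒜 (n • d)) :
    awayLift 𝒜 κ hf (HomogeneousLocalization.Away.mk 𝒜 hfd n g hg) * κ f ^ n = κ g := by
  rw [awayLift, RingHom.comp_apply, HomogeneousLocalization.algebraMap_apply,
    HomogeneousLocalization.Away.val_mk, ← map_pow,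
    ← IsLocalization.Away.lift_eq (S := Localization.Away f) f hf (f ^ n),
    ← map_mul, ← IsLocalization.Away.lift_eq (S := Localization.Away f) f hf g]
  congr 1
  rw [Localization.mk_eq_mk']
  exact IsLocalization.mk'_spec (Localization.Away f) g (⟨f ^ n, n, rfl⟩ : Submonoid.powers f)

lemma awayLift_injective_val {f : S} (hf : IsUnit (algebraMap S (Localization.Away f) f)) :
    Function.Injective (awayLift 𝒜 (algebraMap S (Localization.Away f)) hf) := by
  have : IsLocalization.Away.lift (S := Localization.Away f) f hf =
      RingHom.id (Localization.Away f) := by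
    refine IsLocalization.ringHom_ext (Submonoid.powers f) ?_
    rw [RingHom.id_comp]
    exact IsLocalization.Away.lift_comp f hf
  rw [awayLift, this]
  exact HomogeneousLocalization.val_injective _

end AwayLift

/-! ### The coordinate ring of the torus -/

section Laurent

open MvPolynomial

variable {k : Type u} [Field k] {w : Fin 3 → ℕ}

/-- The product of the three coordinates. -/
noncomputable abbrev coordProd (k : Type u) [Field k] : MvPolynomial (Fin 3) k := ∏ i, X i

lemma coordProd_mem : coordProd k ∈ weightedHomogeneousSubmodule k w (∑ i, w i) := by
  rw [mem_weightedHomogeneousSubmodule]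
  exact IsWeightedHomogeneous.prod _ _ _ fun i _ => isWeightedHomogeneous_X k w i

/-- The coordinate ring of the torus. -/
abbrev TorusRing (k : Type u) [Field k] (w : Fin 3 → ℕ) : Type u :=
  HomogeneousLocalization.Away (weightedHomogeneousSubmodule k w) (coordProd k)

/-- The constants in the coordinate ring of the torus. -/
noncomputable def torusConst (k : Type u) [Field k] (w : Fin 3 → ℕ) : k →+* TorusRing k w where
  toFun c := HomogeneousLocalization.Away.mk _ coordProd_mem 0 (C c)
    (by simpa using isWeightedHomogeneous_C w c)
  map_one' := by
    apply HomogeneousLocalization.val_injective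
    rw [HomogeneousLocalization.Away.val_mk]
    simp
  map_zero' := by
    apply HomogeneousLocalization.val_injective
    rw [HomogeneousLocalization.Away.val_mk, C_0, Localization.mk_zero,
      HomogeneousLocalization.val_zero]
  map_mul' c d := by
    apply HomogeneousLocalization.val_injective
    rw [HomogeneousLocalization.val_mul]
    simp only [HomogeneousLocalization.Away.val_mk, Localization.mk_mul, map_mul]
    congr 1
    simp
  map_add' c d := by
    apply HomogeneousLocalization.val_injective
    rw [HomogeneousLocalization.val_add]
    simp only [HomogeneousLocalization.Away.val_mk, map_add]
    rw [Localization.add_mk_self]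

variable {R : Type*} [CommRing R]

lemma isUnit_coordProd (κ : MvPolynomial (Fin 3) k →+* R) (hκ : ∀ i, IsUnit (κ (X i))) :
    IsUnit (κ (coordProd k)) := by
  rw [map_prod]
  exact IsUnit.prod_univ_iff.mpr hκ

/-- A homomorphism on `k[x, y, z]` that inverts the coordinates, restricted to the coordinate ring
of the torus. -/
noncomputable abbrev torusLift (w : Fin 3 → ℕ) (κ : MvPolynomial (Fin 3) k →+* R)
    (hκ : ∀ i, IsUnit (κ (X i))) : TorusRing k w →+* R :=
  awayLift _ κ (isUnit_coordProd κ hκ)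

lemma torusLift_comp_torusConst (κ : MvPolynomial (Fin 3) k →+* R) (hκ : ∀ i, IsUnit (κ (X i))) :
    (torusLift w κ hκ).comp (torusConst k w) = κ.comp C := by
  ext c
  have h := awayLift_mk_mul (𝒜 := weightedHomogeneousSubmodule k w) κ (isUnit_coordProd κ hκ)
    coordProd_mem 0 (C c) (by simpa using isWeightedHomogeneous_C w c)
  rw [pow_zero, mul_one] at h
  exact h

/-- The exponents of the Laurent monomials of weight zero. -/
def zeroWeight (w : Fin 3 → ℕ) : AddSubgroup (Fin 3 → ℤ) where
  carrier := {e | ∑ i, e i * (w i : ℤ) = 0}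
  zero_mem' := by simp
  add_mem' {e e'} he he' := by
    simp only [Set.mem_ofPred_eq, Pi.add_apply, add_mul, Finset.sum_add_distrib] at *
    rw [he, he', add_zero]
  neg_mem' {e} he := by
    simp only [Set.mem_ofPred_eq, Pi.neg_apply, neg_mul, Finset.sum_neg_distrib] at *
    rw [he, neg_zero]

lemma mem_zeroWeight {e : Fin 3 → ℤ} : e ∈ zeroWeight w ↔ ∑ i, e i * (w i : ℤ) = 0 := Iff.rfl

/-- The value of a Laurent monomial at a triple of units. -/
noncomputable def laurent (u : Fin 3 → Rˣ) (e : Fin 3 → ℤ) : Rˣ := ∏ i, u i ^ e i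

@[simp]
lemma laurent_zero (u : Fin 3 → Rˣ) : laurent u 0 = 1 := by simp [laurent]

lemma laurent_add (u : Fin 3 → Rˣ) (e e' : Fin 3 → ℤ) :
    laurent u (e + e') = laurent u e * laurent u e' := by
  simp only [laurent, Pi.add_apply, zpow_add, Finset.prod_mul_distrib]

lemma laurent_mul_prod_pow (κ : MvPolynomial (Fin 3) k →+* R) (u : Fin 3 → Rˣ)
    (hu : ∀ i, κ (X i) = u i) (e : Fin 3 → ℤ) (n : ℕ) (μ : Fin 3 →₀ ℕ)
    (hμ : ∀ i, (μ i : ℤ) = e i + n) :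
    (laurent u e : R) * κ (coordProd k) ^ n = κ (monomial μ 1) := by
  have h1 : κ (coordProd k) = ((∏ i, u i : Rˣ) : R) := by
    rw [map_prod, Units.coe_prod]
    exact Finset.prod_congr rfl fun i _ => hu i
  have h2 : κ (monomial μ 1) = ((∏ i, u i ^ μ i : Rˣ) : R) := by
    rw [monomial_eq, C_1, one_mul, Finsupp.prod_fintype _ _ (by simp), map_prod, Units.coe_prod]
    exact Finset.prod_congr rfl fun i _ => by rw [map_pow, hu, Units.val_pow_eq_pow_val]
  rw [h1, h2, ← Units.val_pow_eq_pow_val, ← Units.val_mul, laurent, ← Finset.prod_pow,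
    ← Finset.prod_mul_distrib]
  congr 1
  exact Finset.prod_congr rfl fun i _ => by
    rw [← zpow_natCast, ← zpow_natCast, ← zpow_add, hμ]

lemma isWeightedHomogeneous_monomial_shift {e : Fin 3 → ℤ} (he : e ∈ zeroWeight w) {n : ℕ}
    {μ : Fin 3 →₀ ℕ} (hμ : ∀ i, (μ i : ℤ) = e i + n) (r : k) :
    (monomial μ r).IsWeightedHomogeneous w (n • ∑ i, w i) := by
  refine isWeightedHomogeneous_monomial w μ r ?_
  rw [Finsupp.weight_apply, Finsupp.sum_fintype _ _ (by simp)]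
  zify
  simp only [smul_eq_mul, Nat.cast_mul, hμ, add_mul, Finset.sum_add_distrib, Finset.mul_sum,
    Nat.cast_sum]
  rw [mem_zeroWeight.mp he, zero_add]

lemma exists_monomial_shift (e : Fin 3 → ℤ) :
    ∃ (n : ℕ) (μ : Fin 3 →₀ ℕ), ∀ i, (μ i : ℤ) = e i + n := by
  refine ⟨∑ i, (e i).natAbs, Finsupp.equivFunOnFinite.symm
    fun i => (e i + ∑ i, ((e i).natAbs : ℕ)).toNat, fun i => ?_⟩
  have h : (e i).natAbs ≤ ∑ i, (e i).natAbs :=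
    Finset.single_le_sum (f := fun i => (e i).natAbs) (fun _ _ => Nat.zero_le _) (Finset.mem_univ i)
  simp only [Finsupp.equivFunOnFinite_symm_apply_apply, Nat.cast_sum]
  rw [Int.toNat_of_nonneg]
  have h' : ((e i).natAbs : ℤ) ≤ ∑ i, ((e i).natAbs : ℤ) := by exact_mod_cast h
  omega

/-- The Laurent monomial with exponent `e` on the torus. -/
noncomputable def torusMonomial (e : zeroWeight w) : TorusRing k w :=
  HomogeneousLocalization.Away.mk _ coordProd_mem (exists_monomial_shift e.1).choose
    (monomial (exists_monomial_shift e.1).choose_spec.choose 1)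
    (isWeightedHomogeneous_monomial_shift e.2
      (exists_monomial_shift e.1).choose_spec.choose_spec 1)

lemma torusLift_torusMonomial (κ : MvPolynomial (Fin 3) k →+* R) (hκ : ∀ i, IsUnit (κ (X i)))
    (e : zeroWeight w) :
    torusLift w κ hκ (torusMonomial e) = laurent (fun i => (hκ i).unit) e.1 := by
  have h1 := awayLift_mk_mul (𝒜 := weightedHomogeneousSubmodule k w) κ (isUnit_coordProd κ hκ)
    coordProd_mem _ _ (isWeightedHomogeneous_monomial_shift e.2
      (exists_monomial_shift e.1).choose_spec.choose_spec 1)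
  have h2 := laurent_mul_prod_pow κ (fun i => (hκ i).unit) (fun i => rfl) e.1 _ _
    (exists_monomial_shift e.1).choose_spec.choose_spec
  exact ((isUnit_coordProd κ hκ).pow _).mul_right_cancel (h1.trans h2.symm)

lemma isUnit_algebraMap_X (i : Fin 3) :
    IsUnit (algebraMap (MvPolynomial (Fin 3) k) (Localization.Away (coordProd k)) (X i)) :=
  isUnit_of_dvd_unit (map_dvd _ (Finset.dvd_prod_of_mem X (Finset.mem_univ i)))
    (IsLocalization.Away.algebraMap_isUnit (coordProd k))

lemma torusLift_algebraMap_injective : Function.Injective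
    (torusLift w (algebraMap (MvPolynomial (Fin 3) k) (Localization.Away (coordProd k)))
      isUnit_algebraMap_X) :=
  awayLift_injective_val _

lemma torusMonomial_zero : torusMonomial (0 : zeroWeight w) = (1 : TorusRing k w) := by
  apply torusLift_algebraMap_injective
  rw [torusLift_torusMonomial, map_one]
  exact congr_arg Units.val (laurent_zero _)

lemma torusMonomial_add (e e' : zeroWeight w) :
    (torusMonomial (e + e') : TorusRing k w) = torusMonomial e * torusMonomial e' := by
  apply torusLift_algebraMap_injective
  rw [map_mul, torusLift_torusMonomial, torusLift_torusMonomial, torusLift_torusMonomial,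
    ← Units.val_mul, ← laurent_add]
  rfl

/-- The Laurent monomials form a group. -/
noncomputable def torusMonomialHom (k : Type u) [Field k] (w : Fin 3 → ℕ) :
    Multiplicative (zeroWeight w) →* TorusRing k w where
  toFun e := torusMonomial (Multiplicative.toAdd e)
  map_one' := torusMonomial_zero
  map_mul' _ _ := torusMonomial_add _ _

lemma isUnit_torusMonomial (e : zeroWeight w) : IsUnit (torusMonomial e : TorusRing k w) :=
  (Group.isUnit (Multiplicative.ofAdd e)).map (torusMonomialHom k w)

/-- The functions on the torus are linear combinations of Laurent monomials. -/
lemma torusRing_induction {P : TorusRing k w → Prop} (hadd : ∀ x y, P x → P y → P (x + y))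
    (hzero : P 0) (hmon : ∀ c e, P (torusConst k w c * torusMonomial e)) (x : TorusRing k w) :
    P x := by
  obtain ⟨n, g, hg, rfl⟩ := HomogeneousLocalization.Away.mk_surjective _ coordProd_mem x
  let a (μ : Fin 3 →₀ ℕ) : TorusRing k w := if h : μ ∈ g.support then
    torusConst k w (g.coeff μ) * torusMonomial ⟨fun i => μ i - n, by
      have h1 := hg (mem_support_iff.mp h)
      rw [Finsupp.weight_apply, Finsupp.sum_fintype _ _ (by simp)] at h1
      zify at h1
      simp only [smul_eq_mul, Finset.mul_sum, Nat.cast_mul, Nat.cast_sum] at h1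
      rw [mem_zeroWeight]
      simp only [sub_mul, Finset.sum_sub_distrib]
      rw [h1, sub_self]⟩ else 0
  have ha : HomogeneousLocalization.Away.mk _ coordProd_mem n g hg = ∑ μ ∈ g.support, a μ := by
    apply torusLift_algebraMap_injective
    have hu := isUnit_coordProd (algebraMap (MvPolynomial (Fin 3) k)
      (Localization.Away (coordProd k))) isUnit_algebraMap_X
    refine (hu.pow n).mul_right_cancel ?_
    rw [awayLift_mk_mul, map_sum, Finset.sum_mul]
    conv_lhs => rw [g.as_sum, map_sum]
    refine Finset.sum_congr rfl fun μ hμ => ?_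
    simp only [a, dif_pos hμ, map_mul]
    rw [torusLift_torusMonomial, ← RingHom.comp_apply, torusLift_comp_torusConst, mul_assoc,
      laurent_mul_prod_pow _ _ (fun i => rfl) _ n μ (by simp), RingHom.comp_apply, ← map_mul,
      C_mul_monomial, mul_one]
  rw [ha]
  refine Finset.sum_induction _ P hadd hzero fun μ hμ => ?_
  simp only [a, dif_pos hμ]
  exact hmon _ _

lemma torusRing_hom_ext {ψ₁ ψ₂ : TorusRing k w →+* R}
    (hc : ψ₁.comp (torusConst k w) = ψ₂.comp (torusConst k w))
    (hm : ∀ e, ψ₁ (torusMonomial e) = ψ₂ (torusMonomial e)) : ψ₁ = ψ₂ := by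
  ext x
  induction x using torusRing_induction with
  | hadd x y hx hy => rw [map_add, map_add, hx, hy]
  | hzero => rw [map_zero, map_zero]
  | hmon c e =>
    rw [map_mul, map_mul, hm]
    congr 1
    exact DFunLike.congr_fun hc c

end Laurent

/-! ### Coordinates on the torus -/

section Coordinates

open MvPolynomial

variable {k : Type u} [Field k] {m p q : ℕ} {w : Fin 3 → ℕ}

lemma isUnit_theta_X {R : Type*} [CommRing R] (ι : k →+* R) {x y : R} (hx : IsUnit x)
    (hy : IsUnit y) (i : Fin 3) : IsUnit (theta m p q ι x y (X i)) := by
  fin_cases i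
  · exact theta_X_zero (m := m) (q := q) ι x y ▸ (hx.pow _).mul (hy.pow _)
  · exact theta_X_one (m := m) (p := p) ι x y ▸ (hx.pow _).mul (hy.pow _)
  · exact theta_X_two (m := m) (p := p) (q := q) ι x y ▸ hx.pow _

lemma theta_laurent {R : Type*} [CommRing R] (ι : k →+* R) {x y : Rˣ} (u : Fin 3 → Rˣ)
    (hu : ∀ i, theta m p q ι (x : R) y (X i) = u i) (e : Fin 3 → ℤ) :
    laurent u e = x ^ (e 0 * 7 + e 1 * (5 * m) + e 2 * 8) * y ^ (p * e 0 + q * e 1) := by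
  have h0 : u 0 = x ^ 7 * y ^ p := Units.ext (by rw [← hu, theta_X_zero]; simp)
  have h1 : u 1 = x ^ (5 * m) * y ^ q := Units.ext (by rw [← hu, theta_X_one]; simp)
  have h2 : u 2 = x ^ 8 := Units.ext (by rw [← hu, theta_X_two]; simp)
  rw [laurent, Fin.prod_univ_three, h0, h1, h2, mul_zpow, mul_zpow]
  simp only [← zpow_natCast, ← zpow_mul]
  rw [zpow_add, zpow_add, zpow_add]
  simp only [Nat.cast_mul, Nat.cast_ofNat, mul_comm (e 0), mul_comm (e 1), mul_comm (e 2)]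
  generalize x ^ (7 * e 0) = a1
  generalize x ^ (5 * m * e 1) = a2
  generalize x ^ (8 * e 2) = a3
  generalize y ^ (p * e 0) = a4
  generalize y ^ (q * e 1) = a5
  rw [mul_mul_mul_comm, mul_right_comm]

/-- The exponents of the coordinate `X` of the torus. -/
def exponentX (w : Fin 3 → ℕ) (p q : ℕ) : zeroWeight w :=
  ⟨![q * w 2, -(p * w 2), p * w 1 - q * w 0], by
    rw [mem_zeroWeight, Fin.sum_univ_three]
    simp only [Matrix.cons_val]
    ring⟩

namespace IsTriple

variable (h : IsTriple m (w 0) (w 1) (w 2) p q)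
include h

/-- The exponents of the coordinate `Y = y³ / (xᵐ zᵐ)` of the torus. -/
def exponentY : zeroWeight w :=
  ⟨![-m, 3, -m], by
    have h1 : (3 * w 1 : ℤ) = m * (w 0 + w 2) := by exact_mod_cast h.three_mul_b
    rw [mem_zeroWeight, Fin.sum_univ_three]
    simp only [Matrix.cons_val]
    linear_combination h1⟩

lemma exponent_eq (e : zeroWeight w) :
    e = (e.1 0 * 7 + e.1 1 * (5 * m) + e.1 2 * 8) • exponentX w p q +
      (p * e.1 0 + q * e.1 1) • h.exponentY := by
  have ext {e e' : zeroWeight w} (h0 : e.1 0 = e'.1 0) (h1 : e.1 1 = e'.1 1) : e = e' := by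
    have h2 := mem_zeroWeight.mp e.2
    have h3 := mem_zeroWeight.mp e'.2
    rw [Fin.sum_univ_three] at h2 h3
    have h4 : (w 2 : ℤ) ≠ 0 := by exact_mod_cast h.c_pos.ne'
    have h5 : e.1 2 = e'.1 2 := by
      refine mul_right_cancel₀ h4 ?_
      rw [h0, h1] at h2
      linarith
    ext i
    fin_cases i
    exacts [h0, h1, h5]
  have h2 := mem_zeroWeight.mp e.2
  rw [Fin.sum_univ_three] at h2
  have e1 : (3 * q : ℤ) = m * p + 1 := by exact_mod_cast h.hpq
  have e2 : (7 * w 2 : ℤ) = 8 * w 0 + 3 := by exact_mod_cast h.seven_c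
  have e3 : (5 * m * w 2 : ℤ) = 8 * w 1 + m := by exact_mod_cast h.five_mc
  apply ext
  · simp only [exponentX, exponentY, AddSubgroup.coe_add, AddSubgroup.coe_zsmul, Pi.add_apply,
      Pi.smul_apply, smul_eq_mul, Matrix.cons_val]
    linear_combination (-8 * q) * h2 - q * e.1 0 * e2 - q * e.1 1 * e3 - e.1 0 * e1
  · simp only [exponentX, exponentY, AddSubgroup.coe_add, AddSubgroup.coe_zsmul, Pi.add_apply,
      Pi.smul_apply, smul_eq_mul, Matrix.cons_val]
    linear_combination (8 * p) * h2 + p * e.1 0 * e2 + p * e.1 1 * e3 - e.1 1 * e1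

lemma theta_exponentX {R : Type*} [CommRing R] (ι : k →+* R) {x y : R} (hx : IsUnit x)
    (hy : IsUnit y) : torusLift w (theta m p q ι x y) (isUnit_theta_X ι hx hy)
      (torusMonomial (exponentX w p q)) = x := by
  have e1 : (3 * q : ℤ) = m * p + 1 := by exact_mod_cast h.hpq
  have e2 : (7 * w 2 : ℤ) = 8 * w 0 + 3 := by exact_mod_cast h.seven_c
  have e3 : (5 * m * w 2 : ℤ) = 8 * w 1 + m := by exact_mod_cast h.five_mc
  rw [torusLift_torusMonomial, theta_laurent (x := hx.unit) (y := hy.unit) ι _ (fun i => rfl)]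
  have h1 : (exponentX w p q).1 0 * 7 + (exponentX w p q).1 1 * (5 * m) +
      (exponentX w p q).1 2 * 8 = 1 := by
    simp only [exponentX, Matrix.cons_val]
    linear_combination q * e2 - p * e3 + e1
  have h2 : p * (exponentX w p q).1 0 + q * (exponentX w p q).1 1 = 0 := by
    simp only [exponentX, Matrix.cons_val]
    ring
  rw [h1, h2, zpow_one, zpow_zero, mul_one]
  rfl

lemma theta_exponentY {R : Type*} [CommRing R] (ι : k →+* R) {x y : R} (hx : IsUnit x)
    (hy : IsUnit y) : torusLift w (theta m p q ι x y) (isUnit_theta_X ι hx hy)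
      (torusMonomial h.exponentY) = y := by
  have e1 : (3 * q : ℤ) = m * p + 1 := by exact_mod_cast h.hpq
  rw [torusLift_torusMonomial, theta_laurent (x := hx.unit) (y := hy.unit) ι _ (fun i => rfl)]
  have h1 : h.exponentY.1 0 * 7 + h.exponentY.1 1 * (5 * m) + h.exponentY.1 2 * 8 = 0 := by
    simp only [exponentY, Matrix.cons_val]
    ring
  have h2 : p * h.exponentY.1 0 + q * h.exponentY.1 1 = 1 := by
    simp only [exponentY, Matrix.cons_val]
    linear_combination e1
  rw [h1, h2, zpow_one, zpow_zero, one_mul]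
  rfl

/-- The coordinate ring of the torus is the ring of Laurent polynomials in two monomials, and
`theta` expresses its elements in these coordinates. -/
lemma isTorus : IsTorus (torusConst k w) (torusMonomial (exponentX w p q))
    (torusMonomial h.exponentY) where
  isUnit_left := isUnit_torusMonomial _
  isUnit_right := isUnit_torusMonomial _
  hom_ext {R _} ψ₁ ψ₂ hι hx hy := by
    let F (ψ : TorusRing k w →+* R) : Multiplicative (zeroWeight w) →* Rˣ :=
      ((ψ : TorusRing k w →* R).comp (torusMonomialHom k w)).toHomUnits
    have hFX : F ψ₁ (Multiplicative.ofAdd (exponentX w p q)) =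
      F ψ₂ (Multiplicative.ofAdd (exponentX w p q)) := Units.ext hx
    have hFY : F ψ₁ (Multiplicative.ofAdd h.exponentY) =
      F ψ₂ (Multiplicative.ofAdd h.exponentY) := Units.ext hy
    refine torusRing_hom_ext hι fun e => ?_
    have key : F ψ₁ (Multiplicative.ofAdd e) = F ψ₂ (Multiplicative.ofAdd e) := by
      rw [h.exponent_eq e, ofAdd_add, ofAdd_zsmul, ofAdd_zsmul, map_mul, map_mul, map_zpow,
        map_zpow, map_zpow, map_zpow, hFX, hFY]
    exact congr_arg Units.val key
  exists_lift {R _} ι' x y hx hy := by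
    refine ⟨torusLift w (theta m p q ι' x y) (isUnit_theta_X ι' hx hy), ?_,
      h.theta_exponentX ι' hx hy, h.theta_exponentY ι' hx hy⟩
    rw [torusLift_comp_torusConst]
    ext c
    simp

end IsTriple

end Coordinates

/-! ### The blow-up outside the centre -/

section OpenChart

variable {X Y : Scheme.{u}} {π : X ⟶ Y}

/-- A blow-up is an isomorphism over the complement of the centre. -/
theorem IsBlowUp.exists_chart_compl {Z : Closeds Y}
    (hπ : IsBlowUp π (Scheme.IdealSheafData.vanishingIdeal Z)) (O : Y.Opens)
    (hO : (O : Set Y) = (Z : Set Y)ᶜ) :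
    ∃ (l : O.toScheme ⟶ X) (_ : IsOpenImmersion l), l ≫ π = O.ι ∧ l.opensRange = π ⁻¹ᵁ O := by
  refine hπ.exists_isOpenImmersion ?_ (π ⁻¹ᵁ O) ?_ ?_ ?_
  · have : (Scheme.IdealSheafData.vanishingIdeal Z).comap O.ι = ⊤ := by
      rw [← Scheme.IdealSheafData.support_eq_bot_iff, Scheme.IdealSheafData.support_comap]
      ext z
      have hz : O.ι z ∈ (O : Set Y) := z.2
      rw [hO] at hz
      simp only [Closeds.coe_bot, Set.mem_empty_iff_false, iff_false]
      intro h
      refine hz ?_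
      exact (Scheme.IdealSheafData.coe_support_vanishingIdeal Z).subset h
    rw [this]
    exact isEffectiveCartier_top
  · intro p hp
    exact ⟨π ⁻¹ᵁ O, hp, π ∣_ O, morphismRestrict_ι π O⟩
  · intro Z' g₁ g₂ _ h
    exact (cancel_mono O.ι).mp h
  · intro l hl z
    change π (l z) ∈ O
    rw [← Scheme.Hom.comp_apply, hl]
    exact z.2

/-- A point of a chart at which `s` generates the ideal `(s, t)` lies in the chart of `s`. -/
lemma apply_mem_chartDomain {U : Y.Opens} (hU : IsAffineOpen U) {s t : Γ(Y, U)}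
    {B : CommRingCat.{u}} [IsDomain B] {φ : Γ(Y, U) ⟶ B} {l : Spec B ⟶ X} [IsOpenImmersion l]
    (hl : l ≫ π = Spec.map φ ≫ hU.fromSpec) {f α β : B} (hf : f ≠ 0) (hs : φ s = f * α)
    (ht : φ t = f * β) {z : Spec B} (hz : α ∉ z.asIdeal) : l z ∈ chartDomain π U s t := by
  have hV : IsAffineOpen l.opensRange := isAffineOpen_opensRange l
  have hmem (z : Spec B) : (Spec.map φ ≫ hU.fromSpec) z ∈ U := by
    rw [Scheme.Hom.comp_apply, ← SetLike.mem_coe, ← hU.range_fromSpec]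
    exact ⟨_, rfl⟩
  have e : l.opensRange ≤ π ⁻¹ᵁ U := by
    rintro _ ⟨z, rfl⟩
    change π (l z) ∈ U
    rw [← Scheme.Hom.comp_apply, hl]
    exact hmem z
  have e' : (⊤ : (Spec B).Opens) ≤ l ⁻¹ᵁ l.opensRange := fun z _ => ⟨z, rfl⟩
  have eW : (⊤ : (Spec B).Opens) ≤ (Spec.map φ ≫ hU.fromSpec) ⁻¹ᵁ U := fun z _ => hmem z
  let ρ : Γ(X, l.opensRange) ⟶ B := l.appLE _ ⊤ e' ≫ (Scheme.ΓSpecIso B).hom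
  have hρ : IsIso (l.appLE l.opensRange ⊤ e') := by
    have h1 : l ⁻¹ᵁ l.opensRange = ⊤ := top_le_iff.mp e'
    have h2 : IsIso (l.app l.opensRange) := l.isIso_app _ le_rfl
    have h3 : homOfLE e' = eqToHom h1.symm := rfl
    rw [Scheme.Hom.appLE, h3]
    infer_instance
  have hρφ : π.appLE U l.opensRange e ≫ ρ = φ := by
    have h2 (g : Spec B ⟶ Y) (hg : l ≫ π = g) (eg : ⊤ ≤ g ⁻¹ᵁ U) :
        g.appLE U ⊤ eg = π.appLE U _ e ≫ l.appLE _ ⊤ e' := by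
      subst hg
      rw [Scheme.Hom.appLE_comp_appLE]
    have h3 := h2 _ hl eW
    rw [appLE_SpecMap_fromSpec] at h3
    have h4 : (Spec B).presheaf.map (homOfLE (le_refl (⊤ : (Spec B).Opens))).op = 𝟙 _ :=
      (Spec B).presheaf.map_id _
    rw [← Category.assoc, ← h3, h4, Category.comp_id, Category.assoc, Iso.inv_hom_id,
      Category.comp_id]
  have hρ' : Function.Bijective ρ.hom :=
    (asIso ρ).commRingCatIsoToRingEquiv.bijective
  obtain ⟨f', hf'⟩ := hρ'.2 f
  obtain ⟨α', hα'⟩ := hρ'.2 α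
  obtain ⟨β', hβ'⟩ := hρ'.2 β
  have hφ (x) : φ x = ρ (π.appLE U l.opensRange e x) := by rw [← hρφ]; rfl
  refine mem_chartDomain_of_mem_basicOpen (V := ⟨_, hV⟩) (e := e) (f := f') (α := α') (β := β')
    ?_ ?_ ?_ ?_
  · have : IsDomain Γ(X, l.opensRange) :=
      (asIso ρ).commRingCatIsoToRingEquiv.toMulEquiv.isDomain B
    refine mem_nonZeroDivisors_of_ne_zero fun h => hf ?_
    rw [← hf', h, map_zero]
  · apply hρ'.1
    rw [map_mul, hf', hα', ← hs, hφ]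
  · apply hρ'.1
    rw [map_mul, hf', hβ', ← ht, hφ]
  · have h1 : z ∈ (Spec B).basicOpen (l.appLE l.opensRange ⊤ e' α') := by
      have h2 : (Scheme.ΓSpecIso B).inv α = l.appLE l.opensRange ⊤ e' α' := by
        rw [← hα', ← CommRingCat.comp_apply, Category.assoc, Iso.hom_inv_id, Category.comp_id]
      rw [← h2, basicOpen_eq_of_affine]
      exact hz
    rw [Scheme.basicOpen_appLE] at h1
    exact h1.2

end OpenChart

/-! ### Points of `Proj` on a standard open subset -/

section Away

variable {S : Type u} [CommRing S] {σ : Type*} [SetLike σ S] [AddSubgroupClass σ S] (𝒜 : ℕ → σ)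
  [GradedRing 𝒜] {f : S} {d : ℕ} (hf : f ∈ 𝒜 d) (hd : 0 < d)

lemma SpecMap_awayToSection_awayι :
    Spec.map (Proj.awayToSection 𝒜 f) ≫ Proj.awayι 𝒜 f hf hd =
      (Proj.isAffineOpen_basicOpen 𝒜 f hf hd).fromSpec := by
  rw [← cancel_epi (Proj.isAffineOpen_basicOpen 𝒜 f hf hd).isoSpec.hom,
    IsAffineOpen.isoSpec_hom_fromSpec, IsAffineOpen.isoSpec_hom, ← Category.assoc]
  exact (Proj.basicOpenIsoSpec 𝒜 f hf hd).hom_inv_id_assoc (Proj.basicOpen 𝒜 f).ι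

lemma awayι_mem_basicOpen (P : Spec (.of (HomogeneousLocalization.Away 𝒜 f))) :
    Proj.awayι 𝒜 f hf hd P ∈ Proj.basicOpen 𝒜 f := by
  rw [← Proj.opensRange_awayι 𝒜 f hf hd]
  exact ⟨P, rfl⟩

lemma mem_awayι_apply_iff {n : ℕ} {g : S} (hg : g ∈ 𝒜 (n • d))
    (P : Spec (.of (HomogeneousLocalization.Away 𝒜 f))) :
    g ∈ (Proj.awayι 𝒜 f hf hd P).asHomogeneousIdeal ↔
      HomogeneousLocalization.Away.mk 𝒜 hf n g hg ∈ P.asIdeal := by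
  have key {n : ℕ} {g : S} (hg : g ∈ 𝒜 (n • d)) (hn : 0 < n) :
      g ∈ (Proj.awayι 𝒜 f hf hd P).asHomogeneousIdeal ↔
        HomogeneousLocalization.Away.mk 𝒜 hf n g hg ∈ P.asIdeal := by
    have h1 := Proj.awayι_preimage_basicOpen 𝒜 hf hd hg (by positivity)
    have h2 : P ∈ Proj.awayι 𝒜 f hf hd ⁻¹ᵁ Proj.basicOpen 𝒜 g ↔ P ∈ PrimeSpectrum.basicOpen
      (HomogeneousLocalization.Away.isLocalizationElem hf hg) := by rw [h1]; rfl
    have h3 : HomogeneousLocalization.Away.isLocalizationElem hf hg =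
        HomogeneousLocalization.Away.mk 𝒜 hf n g hg ^ d := by
      apply HomogeneousLocalization.val_injective
      rw [HomogeneousLocalization.val_pow, HomogeneousLocalization.Away.isLocalizationElem,
        HomogeneousLocalization.Away.val_mk, HomogeneousLocalization.Away.val_mk,
        Localization.mk_pow]
      congr 1
      ext
      simp [← pow_mul]
    rw [h3] at h2
    exact (not_iff_not.mp h2).trans (P.2.pow_mem_iff_mem d hd)
  rcases Nat.eq_zero_or_pos n with rfl | hn
  · have hg' : g * f ∈ 𝒜 (1 • d) := by
      have := SetLike.mul_mem_graded hg hf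
      rwa [zero_smul, zero_add, ← one_smul ℕ d] at this
    have h1 : HomogeneousLocalization.Away.mk 𝒜 hf 0 g hg =
        HomogeneousLocalization.Away.mk 𝒜 hf 1 (g * f) hg' := by
      apply HomogeneousLocalization.val_injective
      rw [HomogeneousLocalization.Away.val_mk, HomogeneousLocalization.Away.val_mk,
        Localization.mk_eq_mk_iff, Localization.r_iff_exists]
      exact ⟨1, by simp [mul_comm]⟩
    rw [h1, ← key hg' one_pos]
    have h2 := (Proj.mem_basicOpen 𝒜 f _).mp (awayι_mem_basicOpen 𝒜 hf hd P)
    exact ⟨fun h => Ideal.mul_mem_right _ _ h, fun h =>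
      ((Proj.awayι 𝒜 f hf hd P).isPrime.mem_or_mem h).resolve_right h2⟩
  · exact key hg hn

end Away

/-! ### The identity of the torus -/

section Identity

open MvPolynomial

variable {k : Type u} [Field k] {m p q : ℕ} {w : Fin 3 → ℕ}

lemma mem_zeroLocus {Z : Set (MvPolynomial (Fin 3) k)} {x : weightedPlane k w} :
    x ∈ zeroLocus w Z ↔ ∀ g ∈ Z, g ∈ x.asHomogeneousIdeal := Iff.rfl

lemma aeval_X_pow_of_isWeightedHomogeneous {g : MvPolynomial (Fin 3) k} {n : ℕ}
    (hg : g.IsWeightedHomogeneous w n) :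
    aeval (fun i => (Polynomial.X : Polynomial k) ^ w i) g =
      Polynomial.C (eval (fun _ => 1) g) * Polynomial.X ^ n := by
  rw [g.as_sum, map_sum, map_sum, map_sum, Finset.sum_mul]
  refine Finset.sum_congr rfl fun μ hμ => ?_
  rw [aeval_monomial, eval_monomial]
  have h1 := hg (mem_support_iff.mp hμ)
  rw [Finsupp.weight_apply] at h1
  have h2 : (μ.prod fun i j => ((Polynomial.X : Polynomial k) ^ w i) ^ j) =
      Polynomial.X ^ n := by
    rw [← h1, Finsupp.sum, ← Finset.prod_pow_eq_pow_sum, Finsupp.prod]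
    exact Finset.prod_congr rfl fun i _ => by rw [← pow_mul, smul_eq_mul, mul_comm]
  rw [h2]
  simp [Polynomial.algebraMap_eq]

lemma mem_monomialPrime_iff {g : MvPolynomial (Fin 3) k} {n : ℕ}
    (hg : g.IsWeightedHomogeneous w n) :
    g ∈ monomialPrime k w ↔ eval (fun _ => 1) g = 0 := by
  rw [monomialPrime, RingHom.mem_ker]
  refine (congr_arg (· = 0) (aeval_X_pow_of_isWeightedHomogeneous hg)).to_iff.trans ?_
  simp

lemma eval_one_weightedHomogeneousComponent {g : MvPolynomial (Fin 3) k}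
    (hg : g ∈ monomialPrime k w) (n : ℕ) :
    eval (fun _ => 1) (weightedHomogeneousComponent w n g) = 0 := by
  rw [monomialPrime, RingHom.mem_ker] at hg
  have h1 : (aeval (fun i => (Polynomial.X : Polynomial k) ^ w i)) g =
      ∑ᶠ i, Polynomial.C (eval (fun _ => 1) (weightedHomogeneousComponent w i g)) *
        Polynomial.X ^ i := by
    conv_lhs => rw [← sum_weightedHomogeneousComponent w g]
    rw [map_finsum _ (weightedHomogeneousComponent_finsupp g)]
    exact finsum_congr fun i => aeval_X_pow_of_isWeightedHomogeneous
      (weightedHomogeneousComponent_isWeightedHomogeneous i g)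
  have h2 : (Function.support fun i => weightedHomogeneousComponent w i g).Finite :=
    weightedHomogeneousComponent_finsupp g
  rw [finsum_eq_sum_of_support_subset (s := h2.toFinset)] at h1
  · have h3 := congr_arg (Polynomial.coeff · n) (h1.symm.trans hg)
    simp only [Polynomial.finsetSum_coeff, Polynomial.coeff_C_mul, Polynomial.coeff_X_pow,
      mul_ite, mul_one, mul_zero, Finset.sum_ite_eq, Polynomial.coeff_zero] at h3
    by_contra h4
    refine h4 ((if_pos ?_).symm.trans h3)
    simp only [Set.Finite.mem_toFinset, Function.mem_support]
    intro h5
    exact h4 (by rw [h5, map_zero])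
  · intro i hi
    simp only [Set.Finite.coe_toFinset, Function.mem_support] at hi ⊢
    intro h5
    exact hi (by rw [h5, map_zero, Polynomial.C_0, zero_mul])

/-- The value of a function on the torus at the identity. -/
noncomputable def evalOne (k : Type u) [Field k] (w : Fin 3 → ℕ) : TorusRing k w →+* k :=
  torusLift w (eval fun _ => 1) fun i => by simp

lemma evalOne_comp : (evalOne k w).comp (torusConst k w) = RingHom.id k := by
  rw [evalOne, torusLift_comp_torusConst]
  ext c
  simp

lemma evalOne_torusMonomial (e : zeroWeight w) : evalOne k w (torusMonomial e) = 1 := by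
  rw [evalOne, torusLift_torusMonomial]
  simp [laurent]

lemma evalOne_mk {n : ℕ} {g : MvPolynomial (Fin 3) k}
    (hg : g ∈ weightedHomogeneousSubmodule k w (n • ∑ i, w i)) :
    evalOne k w (HomogeneousLocalization.Away.mk _ coordProd_mem n g hg) =
      eval (fun _ => 1) g := by
  have := awayLift_mk_mul (eval fun _ => (1 : k))
    (isUnit_coordProd (eval fun _ => (1 : k)) (fun i => by simp)) coordProd_mem n g hg
  rw [← this, evalOne]
  simp

namespace IsTriple

variable (h : IsTriple m (w 0) (w 1) (w 2) p q)
include h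

lemma pos (i : Fin 3) : 0 < w i := by
  fin_cases i
  exacts [h.a_pos, h.b_pos, h.c_pos]

lemma sum_pos : 0 < ∑ i, w i := Finset.sum_pos (fun i _ => h.pos i) Finset.univ_nonempty

omit h in
lemma exists_X_notMem (x : weightedPlane k w) : ∃ i, X i ∉ x.asHomogeneousIdeal := by
  by_contra! hx
  refine x.not_irrelevant_le fun g hg => ?_
  have h1 : Ideal.span (X '' Set.univ) ≤ x.asHomogeneousIdeal.toIdeal := by
    rw [Ideal.span_le]
    rintro _ ⟨j, -, rfl⟩
    exact hx j
  refine h1 (mem_ideal_span_X_image.mpr fun μ hμ => ?_)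
  by_contra! h2
  have h3 : μ = 0 := Finsupp.ext fun i => h2 i (Set.mem_univ i)
  have h4 : weightedHomogeneousComponent w 0 g = 0 := by
    have h5 := (HomogeneousIdeal.mem_irrelevant_iff _ _).mp hg
    rw [GradedRing.proj_apply] at h5
    rw [← h5]
    exact (weightedDecomposition.decompose'_apply k w g 0).symm
  have h5 : coeff 0 (weightedHomogeneousComponent w 0 g) = coeff 0 g := by
    rw [coeff_weightedHomogeneousComponent, if_pos (map_zero _)]
  rw [h4, coeff_zero] at h5
  exact mem_support_iff.mp hμ (h3 ▸ h5.symm)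

/-- The open immersion of the torus. -/
noncomputable abbrev torusι (k : Type u) [Field k] :
    Spec (.of (TorusRing k w)) ⟶ weightedPlane k w :=
  Proj.awayι (weightedHomogeneousSubmodule k w) (coordProd k) coordProd_mem h.sum_pos

lemma torusι_mem_torusIdentity_iff (P : Spec (.of (TorusRing k w))) :
    h.torusι k P ∈ torusIdentity k w ↔ RingHom.ker (evalOne k w) ≤ P.asIdeal := by
  rw [torusIdentity, mem_zeroLocus]
  constructor
  · intro hP F hF
    obtain ⟨n, g, hg, rfl⟩ := HomogeneousLocalization.Away.mk_surjective _ coordProd_mem F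
    rw [RingHom.mem_ker, evalOne_mk] at hF
    exact (mem_awayι_apply_iff _ coordProd_mem h.sum_pos hg P).mp
      (hP g ((mem_monomialPrime_iff hg).mpr hF))
  · intro hP g hg
    have key (n : ℕ) : weightedHomogeneousComponent w n g ∈
        (h.torusι k P).asHomogeneousIdeal := by
      set N := ∑ i, w i with hN
      have h1 : weightedHomogeneousComponent w n g ^ N ∈
          weightedHomogeneousSubmodule k w (n • N) := by
        rw [mem_weightedHomogeneousSubmodule, smul_eq_mul, mul_comm]
        exact (weightedHomogeneousComponent_isWeightedHomogeneous n g).pow N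
      refine (h.torusι k P).isPrime.mem_of_pow_mem N ?_
      refine (mem_awayι_apply_iff _ coordProd_mem h.sum_pos h1 P).mpr (hP ?_)
      rw [RingHom.mem_ker, evalOne_mk, map_pow, eval_one_weightedHomogeneousComponent hg,
        zero_pow h.sum_pos.ne']
    rw [← sum_weightedHomogeneousComponent w g]
    exact finsum_induction (· ∈ (h.torusι k P).asHomogeneousIdeal) (zero_mem _)
      (fun _ _ => add_mem) key

lemma mem_basicOpen_of_mem_torusIdentity {x : weightedPlane k w} (hx : x ∈ torusIdentity k w) :
    x ∈ Proj.basicOpen (weightedHomogeneousSubmodule k w) (coordProd k) := by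
  rw [torusIdentity, mem_zeroLocus] at hx
  have key {i : Fin 3} (hi : X i ∈ x.asHomogeneousIdeal) (j : Fin 3) :
      X j ∈ x.asHomogeneousIdeal := by
    have h1 : (X j ^ w i - X i ^ w j : MvPolynomial (Fin 3) k) ∈ x.asHomogeneousIdeal := by
      refine hx _ ?_
      rw [SetLike.mem_coe, monomialPrime, RingHom.mem_ker]
      simp [← pow_mul, mul_comm (w i)]
    have h2 : (X i ^ w j : MvPolynomial (Fin 3) k) ∈ x.asHomogeneousIdeal :=
      Ideal.pow_mem_of_mem _ hi _ (h.pos j)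
    have h3 := add_mem h1 h2
    rw [sub_add_cancel] at h3
    exact x.isPrime.mem_of_pow_mem _ h3
  rw [Proj.mem_basicOpen]
  intro h1
  obtain ⟨i, -, hi⟩ := (x.isPrime.prod_mem_iff).mp h1
  obtain ⟨j, hj⟩ := exists_X_notMem x
  exact hj (key hi j)
end IsTriple

end Identity

/-! ### The charts of the blow-up of the plane -/

section Charts

variable {k A A' : Type u} [Field k] [CommRing A] [CommRing A'] {ι : k →+* A} {x y : A}

lemma IsTorus.map_equiv (h : IsTorus ι x y) (e : A ≃+* A') :
    IsTorus ((e : A →+* A').comp ι) (e x) (e y) where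
  isUnit_left := h.isUnit_left.map e
  isUnit_right := h.isUnit_right.map e
  hom_ext {R _} ψ₁ ψ₂ h₁ h₂ h₃ := by
    have key := h.hom_ext (ψ₁.comp (e : A →+* A')) (ψ₂.comp (e : A →+* A')) h₁ h₂ h₃
    ext a
    obtain ⟨a, rfl⟩ := e.surjective a
    exact DFunLike.congr_fun key a
  exists_lift {R _} ι' u v hu hv := by
    obtain ⟨ψ, h₁, h₂, h₃⟩ := h.exists_lift ι' u v hu hv
    refine ⟨ψ.comp (e.symm : A' →+* A), ?_, by simpa using h₂, by simpa using h₃⟩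
    rw [← h₁]
    ext c
    simp

variable {m p q : ℕ} {w : Fin 3 → ℕ} (h : IsTriple m (w 0) (w 1) (w 2) p q) {X : Scheme.{u}}
  {π : X ⟶ weightedPlane k w}

/-- The homomorphism `theta` in the chart where `X - 1` generates the ideal of the identity. -/
noncomputable def chartTheta (k : Type u) [Field k] (m p q : ℕ) :
    MvPolynomial (Fin 3) k →+* ChartRing k :=
  theta m p q (chartConst k) (chartX k) (1 + (chartX k - 1) * chartU k)

/-- The homomorphism `theta` in the chart where `Y - 1` generates the ideal of the identity. -/
noncomputable def chartTheta' (k : Type u) [Field k] (m p q : ℕ) :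
    MvPolynomial (Fin 3) k →+* ChartRing k :=
  theta m p q (chartConst k) (1 + (chartX k - 1) * chartU k) (chartX k)

lemma isUnit_chartTheta (i : Fin 3) : IsUnit (chartTheta k m p q (MvPolynomial.X i)) :=
  isUnit_theta_X _ isUnit_chartX isUnit_chartY i

lemma isUnit_chartTheta' (i : Fin 3) : IsUnit (chartTheta' k m p q (MvPolynomial.X i)) :=
  isUnit_theta_X _ isUnit_chartY isUnit_chartX i

/-- The map to the torus of the chart where `X - 1` generates the ideal of the identity. -/
noncomputable def chartHom (k : Type u) [Field k] (w : Fin 3 → ℕ) (m p q : ℕ) :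
    TorusRing k w →+* ChartRing k :=
  torusLift w (chartTheta k m p q) isUnit_chartTheta

/-- The map to the torus of the chart where `Y - 1` generates the ideal of the identity. -/
noncomputable def chartHom' (k : Type u) [Field k] (w : Fin 3 → ℕ) (m p q : ℕ) :
    TorusRing k w →+* ChartRing k :=
  torusLift w (chartTheta' k m p q) isUnit_chartTheta'

lemma chartHom_comp_torusConst :
    (chartHom k w m p q).comp (torusConst k w) = chartConst k := by
  rw [chartHom, torusLift_comp_torusConst]
  exact RingHom.ext fun c => theta_C ..

lemma chartHom'_comp_torusConst :
    (chartHom' k w m p q).comp (torusConst k w) = chartConst k := by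
  rw [chartHom', torusLift_comp_torusConst]
  exact RingHom.ext fun c => theta_C ..

namespace IsTriple

include h

lemma chartHom_exponentX :
    chartHom k w m p q (torusMonomial (exponentX w p q)) = chartX k :=
  h.theta_exponentX _ isUnit_chartX isUnit_chartY

lemma chartHom_exponentY :
    chartHom k w m p q (torusMonomial h.exponentY) = 1 + (chartX k - 1) * chartU k :=
  h.theta_exponentY _ isUnit_chartX isUnit_chartY

lemma chartHom'_exponentX :
    chartHom' k w m p q (torusMonomial (exponentX w p q)) = 1 + (chartX k - 1) * chartU k :=
  h.theta_exponentX _ isUnit_chartY isUnit_chartX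

lemma chartHom'_exponentY :
    chartHom' k w m p q (torusMonomial h.exponentY) = chartX k :=
  h.theta_exponentY _ isUnit_chartY isUnit_chartX

lemma ker_evalOne : RingHom.ker (evalOne k w) =
    Ideal.span {torusMonomial (exponentX w p q) - 1, torusMonomial h.exponentY - 1} :=
  h.isTorus.ker_eq_span evalOne_comp (evalOne_torusMonomial _) (evalOne_torusMonomial _)

/-- The blow-up of the identity of the torus is covered by the complement of the exceptional divisor
and by two charts. -/
theorem exists_charts (hπ : IsBlowUpAtIdentity π) :
    ∃ (ls lt : Spec (.of (ChartRing k)) ⟶ X) (_ : IsOpenImmersion ls) (_ : IsOpenImmersion lt),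
      ls ≫ π = Spec.map (CommRingCat.ofHom (chartHom k w m p q)) ≫ h.torusι k ∧
      lt ≫ π = Spec.map (CommRingCat.ofHom (chartHom' k w m p q)) ≫ h.torusι k ∧
      (∀ x, π x ∈ torusIdentity k w → x ∈ ls.opensRange ∨ x ∈ lt.opensRange) ∧
      ∀ z, chartU k ∉ z.asIdeal → lt z ∈ ls.opensRange := by
  let U := Proj.basicOpen (MvPolynomial.weightedHomogeneousSubmodule k w) (coordProd k)
  have hU : IsAffineOpen U := Proj.isAffineOpen_basicOpen _ _ coordProd_mem h.sum_pos
  let a : CommRingCat.of (TorusRing k w) ≅ Γ(weightedPlane k w, U) :=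
    Proj.basicOpenIsoAway _ _ coordProd_mem h.sum_pos
  let e : TorusRing k w ≃+* Γ(weightedPlane k w, U) := a.commRingCatIsoToRingEquiv
  have hT := h.isTorus (k := k).map_equiv e
  set x := torusMonomial (k := k) (exponentX w p q) with hx
  set y := torusMonomial (k := k) h.exponentY with hy
  have hae : Spec.map a.hom ≫ h.torusι k = hU.fromSpec :=
    SpecMap_awayToSection_awayι _ coordProd_mem h.sum_pos
  have hI : (Scheme.IdealSheafData.vanishingIdeal (torusIdentity k w)).ideal ⟨U, hU⟩ =
      Ideal.span {e x - 1, e y - 1} := by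
    let ε : Γ(weightedPlane k w, U) →+* k := (evalOne k w).comp (e.symm : _ →+* TorusRing k w)
    have hε (r : TorusRing k w) : ε (e r) = evalOne k w r := by simp [ε]
    have hker := hT.ker_eq_span (ε := ε) (RingHom.ext fun c => (hε _).trans
      (DFunLike.congr_fun evalOne_comp c)) ((hε _).trans (evalOne_torusMonomial _))
      ((hε _).trans (evalOne_torusMonomial _))
    have hZ : hU.fromSpec ⁻¹' (torusIdentity k w : Set (weightedPlane k w)) =
        PrimeSpectrum.zeroLocus (RingHom.ker ε : Set Γ(weightedPlane k w, U)) := by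
      ext P
      rw [Set.mem_preimage, ← hae, Scheme.Hom.comp_apply, SetLike.mem_coe,
        h.torusι_mem_torusIdentity_iff]
      constructor
      · intro hP r hr
        obtain ⟨r, rfl⟩ := e.surjective r
        exact hP ((hε r).symm.trans hr)
      · intro hP r hr
        exact hP ((hε r).trans hr)
    have hprime : (RingHom.ker ε).IsPrime := RingHom.ker_isPrime ε
    refine (congr_arg PrimeSpectrum.vanishingIdeal hZ).trans ?_
    rw [PrimeSpectrum.vanishingIdeal_zeroLocus_eq_radical, hprime.radical, hker]
  let φ : Γ(weightedPlane k w, U) ⟶ .of (ChartRing k) :=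
    a.inv ≫ CommRingCat.ofHom (chartHom k w m p q)
  let φ' : Γ(weightedPlane k w, U) ⟶ .of (ChartRing k) :=
    a.inv ≫ CommRingCat.ofHom (chartHom' k w m p q)
  have hφ (r : TorusRing k w) : φ.hom (e r) = chartHom k w m p q r :=
    congr_arg (chartHom k w m p q) (e.symm_apply_apply r)
  have hφ' (r : TorusRing k w) : φ'.hom (e r) = chartHom' k w m p q r :=
    congr_arg (chartHom' k w m p q) (e.symm_apply_apply r)
  have hc : IsBlowupChart φ.hom (e x - 1) (e y - 1) :=
    hT.isBlowupChart (RingHom.ext fun c => (hφ _).trans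
      (DFunLike.congr_fun chartHom_comp_torusConst c)) ((hφ _).trans h.chartHom_exponentX)
      ((hφ _).trans h.chartHom_exponentY)
  have hc' : IsBlowupChart φ'.hom (e y - 1) (e x - 1) :=
    hT.symm.isBlowupChart (RingHom.ext fun c => (hφ' _).trans
      (DFunLike.congr_fun chartHom'_comp_torusConst c)) ((hφ' _).trans h.chartHom'_exponentY)
      ((hφ' _).trans h.chartHom'_exponentX)
  have hI' := hI
  rw [Set.pair_comm] at hI'
  obtain ⟨ls, hls, hls₁, hls₂⟩ := hπ.exists_chart hU _ _ hI φ hc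
  obtain ⟨lt, hlt, hlt₁, hlt₂⟩ := hπ.exists_chart hU _ _ hI' φ' hc'
  have hfrom : h.torusι k = Spec.map a.inv ≫ hU.fromSpec := by
    rw [← hae, ← Spec.map_comp_assoc, Iso.hom_inv_id, Spec.map_id, Category.id_comp]
  refine ⟨ls, lt, hls, hlt, ?_, ?_, fun z hz => ?_, fun z hz => ?_⟩
  · rw [hls₁, hfrom, ← Spec.map_comp_assoc]
  · rw [hlt₁, hfrom, ← Spec.map_comp_assoc]
  · rw [hls₂, hlt₂]
    exact hπ.mem_chartDomain_or hI (h.mem_basicOpen_of_mem_torusIdentity hz)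
  · rw [hls₂]
    refine apply_mem_chartDomain hU hlt₁ (f := chartX k - 1) (β := 1) chartX_sub_one_ne_zero ?_ ?_ hz
    · rw [map_sub, map_one]
      exact (congr_arg (· - 1) ((hφ' x).trans h.chartHom'_exponentX)).trans
        (add_sub_cancel_left _ _)
    · rw [map_sub, map_one, mul_one]
      exact congr_arg (· - 1) ((hφ' y).trans h.chartHom'_exponentY)

end IsTriple

end Charts

/-! ### Integrality and open covers -/

section Local

variable {X : Scheme.{u}}

/-- A scheme is integral if it is covered by integral open subschemes with the same generic point. -/
lemma isIntegral_of_exists_isOpenImmersion (η : X)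
    (h : ∀ x : X, ∃ (Z : Scheme.{u}) (_ : IsIntegral Z) (l : Z ⟶ X) (_ : IsOpenImmersion l),
      x ∈ l.opensRange ∧ l (genericPoint Z) = η) : IsIntegral X := by
  have h1 : ∀ x : X, _root_.IsReduced (X.presheaf.stalk x) := by
    intro x
    obtain ⟨Z, _, l, _, ⟨z, rfl⟩, -⟩ := h x
    exact isReduced_of_injective (l.stalkMap z).hom
      (asIso (l.stalkMap z)).commRingCatIsoToRingEquiv.injective
  have h2 : IsReduced X := isReduced_of_isReduced_stalk X
  have h3 : IsGenericPoint η (⊤ : Set X) := by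
    rw [isGenericPoint_iff_specializes]
    intro x
    refine ⟨fun _ => trivial, fun _ => ?_⟩
    obtain ⟨Z, _, l, _, ⟨z, rfl⟩, hη⟩ := h x
    rw [← hη]
    exact ((genericPoint_spec Z).specializes trivial).map l.continuous
  have h4 : IrreducibleSpace X := by
    have h5 : IsIrreducible (⊤ : Set X) := h3.isIrreducible
    exact { isPreirreducible_univ := h5.2, toNonempty := ⟨η⟩ }
  exact isIntegral_of_irreducibleSpace_of_isReduced X

lemma isLocallyNoetherian_of_exists_isOpenImmersion
    (h : ∀ x : X, ∃ (Z : Scheme.{u}) (_ : IsLocallyNoetherian Z) (l : Z ⟶ X)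
      (_ : IsOpenImmersion l), x ∈ l.opensRange) : IsLocallyNoetherian X := by
  choose Z hZ l hl hx using h
  let 𝒰 : X.OpenCover := Scheme.Cover.mkOfCovers X Z l (fun x => ⟨x, hx x⟩) hl
  rw [isLocallyNoetherian_iff_openCover 𝒰]
  exact hZ

/-- Two irreducible open subschemes of which one contains the generic point of the other have the
same generic point. -/
lemma apply_genericPoint_eq_of_mem {Z₁ Z₂ : Scheme.{u}} [IrreducibleSpace Z₁] [IrreducibleSpace Z₂]
    (l₁ : Z₁ ⟶ X) (l₂ : Z₂ ⟶ X) [IsOpenImmersion l₁] [IsOpenImmersion l₂]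
    (h : l₁ (genericPoint Z₁) ∈ l₂.opensRange) : l₁ (genericPoint Z₁) = l₂ (genericPoint Z₂) := by
  obtain ⟨z₂, h₂⟩ := h
  have h3 : l₂ (genericPoint Z₂) ⤳ l₁ (genericPoint Z₁) := by
    rw [← h₂]
    exact ((genericPoint_spec Z₂).specializes trivial).map l₂.continuous
  obtain ⟨z₁, h₁⟩ := h3.mem_open l₁.opensRange.isOpen ⟨_, rfl⟩
  have h4 : l₁ (genericPoint Z₁) ⤳ l₂ (genericPoint Z₂) := by
    rw [← h₁]
    exact ((genericPoint_spec Z₁).specializes trivial).map l₁.continuous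
  exact (h4.antisymm h3).eq

end Local

/-! ### The weighted projective plane -/

section Plane

open MvPolynomial

variable {k : Type u} [Field k] {m p q : ℕ} {w : Fin 3 → ℕ}

instance {f : MvPolynomial (Fin 3) k} [Fact (f ≠ 0)] :
    IsDomain (HomogeneousLocalization.Away (weightedHomogeneousSubmodule k w) f) := by
  have : IsDomain (Localization.Away f) := IsLocalization.isDomain_localization
    (powers_le_nonZeroDivisors_of_noZeroDivisors Fact.out)
  exact (HomogeneousLocalization.val_injective (Submonoid.powers f)).isDomain
    (algebraMap (HomogeneousLocalization.Away (weightedHomogeneousSubmodule k w) f)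
      (Localization.Away f))

instance : Fact (coordProd k ≠ 0) :=
  ⟨Finset.prod_ne_zero_iff.mpr fun i _ => X_ne_zero i⟩

lemma X_mem_weightedHomogeneousSubmodule (i : Fin 3) :
    (X i : MvPolynomial (Fin 3) k) ∈ weightedHomogeneousSubmodule k w (w i) :=
  isWeightedHomogeneous_X k w i

namespace IsTriple

variable (h : IsTriple m (w 0) (w 1) (w 2) p q)
include h

lemma isNoetherianRing_degree_zero :
    IsNoetherianRing (weightedHomogeneousSubmodule k w 0) := by
  refine isNoetherianRing_of_surjective k _
    (algebraMap k (weightedHomogeneousSubmodule k w 0)) fun ⟨g, hg⟩ => ?_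
  refine ⟨g.coeff 0, Subtype.ext (MvPolynomial.ext _ _ fun μ => ?_)⟩
  change (C (g.coeff 0)).coeff μ = g.coeff μ
  rw [coeff_C]
  split_ifs with hμ
  · rw [hμ]
  · by_contra h0
    have h1 := hg (Ne.symm h0)
    rw [Finsupp.weight_apply, Finsupp.sum, Finset.sum_eq_zero_iff] at h1
    refine hμ (Finsupp.ext fun i => ?_).symm
    by_contra hi
    have h2 := h1 i (Finsupp.mem_support_iff.mpr hi)
    rw [smul_eq_mul, mul_eq_zero] at h2
    exact h2.elim hi (h.pos i).ne'

lemma isLocallyNoetherian_plane : IsLocallyNoetherian (weightedPlane k w) := by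
  have := h.isNoetherianRing_degree_zero (k := k)
  have : IsScalarTower k (weightedHomogeneousSubmodule k w 0) (MvPolynomial (Fin 3) k) :=
    ⟨fun r g f => Algebra.smul_mul_assoc r g.1 f⟩
  have : Algebra.FiniteType (weightedHomogeneousSubmodule k w 0) (MvPolynomial (Fin 3) k) :=
    Algebra.FiniteType.of_restrictScalars_finiteType k _ _
  exact LocallyOfFiniteType.isLocallyNoetherian
    (Proj.toSpecZero (weightedHomogeneousSubmodule k w))

lemma exists_mem_range_awayι (x : weightedPlane k w) :
    ∃ i, x ∈ (Proj.awayι (weightedHomogeneousSubmodule k w) (X i)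
      (X_mem_weightedHomogeneousSubmodule i) (h.pos i)).opensRange := by
  obtain ⟨i, hi⟩ := exists_X_notMem x
  refine ⟨i, ?_⟩
  rw [Proj.opensRange_awayι]
  exact hi

lemma isIntegral_plane : IsIntegral (weightedPlane k w) := by
  refine isIntegral_of_exists_isOpenImmersion (h.torusι k (genericPoint _)) fun x => ?_
  obtain ⟨i, hi⟩ := h.exists_mem_range_awayι x
  have : Fact ((X i : MvPolynomial (Fin 3) k) ≠ 0) := ⟨X_ne_zero i⟩
  refine ⟨_, inferInstance, _, inferInstance, hi, ?_⟩
  refine (apply_genericPoint_eq_of_mem (h.torusι k) _ ?_).symm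
  rw [Proj.opensRange_awayι]
  have h1 : h.torusι k (genericPoint _) ∈ (h.torusι k).opensRange := ⟨_, rfl⟩
  rw [Proj.opensRange_awayι] at h1
  exact Proj.basicOpen_mono _ _ _ (Finset.dvd_prod_of_mem _ (Finset.mem_univ i)) h1

lemma compactSpace_plane : CompactSpace (weightedPlane k w) := by
  refine ⟨?_⟩
  have h1 : (Set.univ : Set (weightedPlane k w)) =
      ⋃ i, Set.range (Proj.awayι (weightedHomogeneousSubmodule k w) (X i)
        (X_mem_weightedHomogeneousSubmodule i) (h.pos i)) :=
    (Set.eq_univ_of_forall fun x => Set.mem_iUnion.mpr (h.exists_mem_range_awayι x)).symm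
  rw [h1]
  exact isCompact_iUnion fun i => isCompact_range (Scheme.Hom.continuous _)

end IsTriple

/-- The complement of the identity of the torus. -/
noncomputable def identityCompl (k : Type u) [Field k] (w : Fin 3 → ℕ) :
    (weightedPlane k w).Opens :=
  ⟨(torusIdentity k w : Set (weightedPlane k w))ᶜ, (torusIdentity k w).isClosed.isOpen_compl⟩

end Plane

/-! ### The cover of the blow-up of the plane -/

section Charts

variable {k : Type u} [Field k] {m p q : ℕ} {w : Fin 3 → ℕ}

/-- The open subschemes that cover the blow-up `π : X ⟶ ℙ` of the identity of the torus: the charts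
`s` and `t` over the torus, with coordinate rings `k[X, U]` localized at `X` and
`Y = 1 + (X - 1)U`, respectively `k[Y, U]` localized at `Y` and `X = 1 + (Y - 1)U`, and the
complement `o` of the exceptional divisor. -/
structure IsBlowupCover (h : IsTriple m (w 0) (w 1) (w 2) p q) {X : Scheme.{u}}
    (π : X ⟶ weightedPlane k w) (s t : Spec (.of (ChartRing k)) ⟶ X)
    (o : (identityCompl k w).toScheme ⟶ X) [IsOpenImmersion s] [IsOpenImmersion t]
    [IsOpenImmersion o] : Prop where
  chart_comp : s ≫ π = Spec.map (CommRingCat.ofHom (chartHom k w m p q)) ≫ h.torusι k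
  chart'_comp : t ≫ π = Spec.map (CommRingCat.ofHom (chartHom' k w m p q)) ≫ h.torusι k
  compl_comp : o ≫ π = (identityCompl k w).ι
  opensRange_compl : o.opensRange = π ⁻¹ᵁ identityCompl k w
  mem_range_or : ∀ x, π x ∈ torusIdentity k w → x ∈ s.opensRange ∨ x ∈ t.opensRange
  chart'_mem_range : ∀ z, chartU k ∉ z.asIdeal → t z ∈ s.opensRange

variable {h : IsTriple m (w 0) (w 1) (w 2) p q} {X : Scheme.{u}} {π : X ⟶ weightedPlane k w}

variable (h) in
lemma exists_isBlowupCover (hπ : IsBlowUpAtIdentity π) :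
    ∃ (s t : Spec (.of (ChartRing k)) ⟶ X) (o : (identityCompl k w).toScheme ⟶ X)
      (_ : IsOpenImmersion s) (_ : IsOpenImmersion t) (_ : IsOpenImmersion o),
      IsBlowupCover h π s t o := by
  obtain ⟨ls, lt, h1, h2, h3, h4, h5, h6⟩ := h.exists_charts hπ
  obtain ⟨l, h7, h8, h9⟩ := hπ.exists_chart_compl (identityCompl k w) rfl
  exact ⟨ls, lt, l, h1, h2, h7, h3, h4, h8, h9, h5, h6⟩

namespace IsBlowupCover

variable {s t : Spec (.of (ChartRing k)) ⟶ X} {o : (identityCompl k w).toScheme ⟶ X}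
  [IsOpenImmersion s] [IsOpenImmersion t] [IsOpenImmersion o] (c : IsBlowupCover h π s t o)
include c

lemma chart_mem_torusIdentity_iff (z) :
    π (s z) ∈ torusIdentity k w ↔ chartX k - 1 ∈ z.asIdeal := by
  have h1 : π (s z) = h.torusι k (Spec.map (CommRingCat.ofHom (chartHom k w m p q)) z) := by
    rw [← Scheme.Hom.comp_apply, c.chart_comp, Scheme.Hom.comp_apply]
  rw [h1, h.torusι_mem_torusIdentity_iff, h.ker_evalOne, Ideal.span_le, Set.pair_subset_iff]
  have h2 (r : TorusRing k w) :
      r ∈ (Spec.map (CommRingCat.ofHom (chartHom k w m p q)) z).asIdeal ↔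
        chartHom k w m p q r ∈ z.asIdeal := Iff.rfl
  rw [SetLike.mem_coe, SetLike.mem_coe, h2, h2, map_sub, map_sub, map_one, h.chartHom_exponentX,
    h.chartHom_exponentY, add_sub_cancel_left]
  exact and_iff_left_of_imp fun h3 => Ideal.mul_mem_right _ _ h3

lemma chart'_mem_torusIdentity_iff (z) :
    π (t z) ∈ torusIdentity k w ↔ chartX k - 1 ∈ z.asIdeal := by
  have h1 : π (t z) =
      h.torusι k (Spec.map (CommRingCat.ofHom (chartHom' k w m p q)) z) := by
    rw [← Scheme.Hom.comp_apply, c.chart'_comp, Scheme.Hom.comp_apply]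
  rw [h1, h.torusι_mem_torusIdentity_iff, h.ker_evalOne, Ideal.span_le, Set.pair_subset_iff]
  have h2 (r : TorusRing k w) :
      r ∈ (Spec.map (CommRingCat.ofHom (chartHom' k w m p q)) z).asIdeal ↔
        chartHom' k w m p q r ∈ z.asIdeal := Iff.rfl
  rw [SetLike.mem_coe, SetLike.mem_coe, h2, h2, map_sub, map_sub, map_one, h.chartHom'_exponentX,
    h.chartHom'_exponentY, add_sub_cancel_left]
  exact and_iff_right_of_imp fun h3 => Ideal.mul_mem_right _ _ h3

lemma mem_range_compl_iff (x : X) :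
    x ∈ o.opensRange ↔ π x ∉ torusIdentity k w := by
  rw [c.opensRange_compl]
  rfl

lemma genericPoint_mem_range_compl :
    s (genericPoint _) ∈ o.opensRange := by
  rw [c.mem_range_compl_iff, c.chart_mem_torusIdentity_iff, genericPoint_eq_bot_of_affine]
  exact chartX_sub_one_ne_zero

lemma genericPoint_mem_range_compl' :
    t (genericPoint _) ∈ o.opensRange := by
  rw [c.mem_range_compl_iff, c.chart'_mem_torusIdentity_iff, genericPoint_eq_bot_of_affine]
  exact chartX_sub_one_ne_zero

lemma isIntegral_compl : IsIntegral (identityCompl k w).toScheme := by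
  have := h.isIntegral_plane (k := k)
  have : Nonempty (identityCompl k w) := by
    obtain ⟨z, -⟩ := c.genericPoint_mem_range_compl
    exact ⟨z⟩
  infer_instance

theorem isIntegral : IsIntegral X := by
  have := c.isIntegral_compl
  refine isIntegral_of_exists_isOpenImmersion (o (genericPoint _)) fun x => ?_
  by_cases hx : π x ∈ torusIdentity k w
  · obtain hx | hx := c.mem_range_or x hx
    · exact ⟨_, inferInstance, s, inferInstance, hx,
        apply_genericPoint_eq_of_mem _ _ c.genericPoint_mem_range_compl⟩
    · exact ⟨_, inferInstance, t, inferInstance, hx,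
        apply_genericPoint_eq_of_mem _ _ c.genericPoint_mem_range_compl'⟩
  · exact ⟨_, inferInstance, o, inferInstance, (c.mem_range_compl_iff x).mpr hx, rfl⟩

theorem isLocallyNoetherian : IsLocallyNoetherian X := by
  have := h.isLocallyNoetherian_plane (k := k)
  refine isLocallyNoetherian_of_exists_isOpenImmersion fun x => ?_
  by_cases hx : π x ∈ torusIdentity k w
  · obtain hx | hx := c.mem_range_or x hx
    · exact ⟨_, inferInstance, s, inferInstance, hx⟩
    · exact ⟨_, inferInstance, t, inferInstance, hx⟩
  · exact ⟨_, inferInstance, o, inferInstance, (c.mem_range_compl_iff x).mpr hx⟩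

theorem noetherianSpace : NoetherianSpace X := by
  have := h.isLocallyNoetherian_plane (k := k)
  have := h.compactSpace_plane (k := k)
  have : IsNoetherian (weightedPlane k w) := {}
  have : CompactSpace X := by
    refine ⟨?_⟩
    have h1 : (Set.univ : Set X) =
        Set.range s ∪ Set.range t ∪ Set.range o := by
      refine (Set.eq_univ_of_forall fun x => ?_).symm
      by_cases hx : π x ∈ torusIdentity k w
      · exact Or.inl (c.mem_range_or x hx)
      · exact Or.inr ((c.mem_range_compl_iff x).mpr hx)
    rw [h1]
    have : CompactSpace (identityCompl k w).toScheme :=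
      isCompact_iff_compactSpace.mp (NoetherianSpace.isCompact _)
    exact ((isCompact_range s.continuous).union (isCompact_range t.continuous)).union
      (isCompact_range o.continuous)
  have := c.isLocallyNoetherian
  have : IsNoetherian X := {}
  infer_instance

end IsBlowupCover

end Charts

/-! ### Germs and rational functions -/

section Factor

lemma exists_mul_toStalk_eq {B : Type u} [CommRing B] (z : PrimeSpectrum B)
    (f : (structurePresheafInCommRingCat B).stalk z) :
    ∃ b b', b' ∉ z.asIdeal ∧
      f * (StructureSheaf.toStalk B z).hom b' = (StructureSheaf.toStalk B z).hom b := by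
  let : Algebra B ((structurePresheafInCommRingCat B).stalk z) :=
    StructureSheaf.stalkAlgebra B z
  have h1 : IsLocalization.AtPrime ((structurePresheafInCommRingCat B).stalk z) z.asIdeal :=
    StructureSheaf.IsLocalization.to_stalk B z
  obtain ⟨⟨b, b'⟩, hb⟩ := IsLocalization.surj z.asIdeal.primeCompl f
  exact ⟨b, b', b'.2, hb⟩

variable {X Y : Scheme.{u}} [IsIntegral X] {B : Type u} [CommRing B]

/-- `φ : B → K(X)` is the pullback of functions along `g : X ⟶ Y`, for the open subscheme
`j : Spec B ⟶ Y`. -/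
def IsPullbackHom (g : X ⟶ Y) (j : Spec (.of B) ⟶ Y) (φ : B →+* X.functionField) : Prop :=
  Spec.map (CommRingCat.ofHom φ) ≫ j = X.fromSpecStalk (genericPoint X) ≫ g

variable {g : X ⟶ Y} {j : Spec (.of B) ⟶ Y} [IsOpenImmersion j]

omit [IsIntegral X] in
lemma exists_stalk_factor {q : X} {z : Spec (.of B)} (hq : g q = j z) :
    ∃ ρ : B →+* X.presheaf.stalk q,
      Spec.map (CommRingCat.ofHom ρ) ≫ j = X.fromSpecStalk q ≫ g ∧
      ∀ b, IsUnit (ρ b) ↔ b ∉ z.asIdeal := by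
  have h1 : Set.range (X.fromSpecStalk q ≫ g) ⊆ Set.range j := by
    rintro _ ⟨y, rfl⟩
    have h2 : X.fromSpecStalk q y ⤳ q := by
      have : X.fromSpecStalk q y ∈ Set.range (X.fromSpecStalk q) := ⟨y, rfl⟩
      rwa [Scheme.range_fromSpecStalk] at this
    have h3 := h2.map g.continuous
    rw [hq] at h3
    rw [Scheme.Hom.comp_apply]
    exact h3.mem_open j.opensRange.isOpen ⟨z, rfl⟩
  obtain ⟨ψ, hψ⟩ := Spec.map_surjective (IsOpenImmersion.lift j (X.fromSpecStalk q ≫ g) h1)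
  have h4 : Spec.map ψ ≫ j = X.fromSpecStalk q ≫ g := by
    rw [hψ, IsOpenImmersion.lift_fac]
  refine ⟨ψ.hom, h4, fun b => ?_⟩
  have h5 : Spec.map ψ (IsLocalRing.closedPoint (X.presheaf.stalk q)) = z := by
    refine j.isOpenEmbedding.injective ?_
    refine (Scheme.Hom.comp_apply _ _ _).symm.trans ?_
    rw [h4, ← hq]
    exact (Scheme.Hom.comp_apply _ _ _).trans (congr_arg g Scheme.fromSpecStalk_closedPoint)
  have h6 : b ∈ z.asIdeal ↔ ψ.hom b ∈ IsLocalRing.maximalIdeal (X.presheaf.stalk q) := by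
    rw [← h5]
    rfl
  rw [h6, IsLocalRing.mem_maximalIdeal, mem_nonunits_iff, not_not]

omit [IsIntegral X] in
lemma stalk_factor_unique {q : X} {ρ ρ' : B →+* X.presheaf.stalk q}
    (h : Spec.map (CommRingCat.ofHom ρ) ≫ j = X.fromSpecStalk q ≫ g)
    (h' : Spec.map (CommRingCat.ofHom ρ') ≫ j = X.fromSpecStalk q ≫ g) : ρ = ρ' := by
  have := Spec.map_injective ((cancel_mono j).mp (h.trans h'.symm))
  exact congr_arg CommRingCat.Hom.hom this

lemma IsPullbackHom.comp_stalk {φ : B →+* X.functionField} (hφ : IsPullbackHom g j φ) {q : X}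
    {ρ : B →+* X.presheaf.stalk q}
    (h : Spec.map (CommRingCat.ofHom ρ) ≫ j = X.fromSpecStalk q ≫ g) :
    (algebraMap (X.presheaf.stalk q) X.functionField).comp ρ = φ := by
  refine stalk_factor_unique (g := g) (j := j) (q := genericPoint X) ?_ hφ
  have h1 : CommRingCat.ofHom ((algebraMap (X.presheaf.stalk q) X.functionField).comp ρ) =
    CommRingCat.ofHom ρ ≫
      X.presheaf.stalkSpecializes ((genericPoint_spec X).specializes trivial) := rfl
  refine (congr_arg (Spec.map · ≫ j) h1).trans ?_
  rw [Spec.map_comp, Category.assoc, h, ← Category.assoc]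
  exact congr_arg (· ≫ g) (Scheme.SpecMap_stalkSpecializes_fromSpecStalk _)

/-- Functions on `Spec B ⊆ Y` pull back to germs on `X`. -/
lemma IsPullbackHom.exists_stalk {φ : B →+* X.functionField} (hφ : IsPullbackHom g j φ) {q : X}
    {z : Spec (.of B)} (hq : g q = j z) :
    ∃ ρ : B →+* X.presheaf.stalk q,
      (algebraMap (X.presheaf.stalk q) X.functionField).comp ρ = φ ∧
      (∀ b, IsUnit (ρ b) ↔ b ∉ z.asIdeal) ∧
      Spec.map (CommRingCat.ofHom ρ) ≫ j = X.fromSpecStalk q ≫ g := by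
  obtain ⟨ρ, h1, h2⟩ := exists_stalk_factor (g := g) (j := j) hq
  exact ⟨ρ, hφ.comp_stalk h1, h2, h1⟩

omit [IsIntegral X] in
/-- Where `X ⟶ Y` is a local isomorphism, the germs are fractions of functions on
`Spec B ⊆ Y`. -/
lemma exists_mul_stalk_eq {q : X} [IsIso (g.stalkMap q)] {z : Spec (.of B)} (hq : g q = j z)
    {ρ : B →+* X.presheaf.stalk q}
    (h : Spec.map (CommRingCat.ofHom ρ) ≫ j = X.fromSpecStalk q ≫ g)
    (f : X.presheaf.stalk q) : ∃ b b', b' ∉ z.asIdeal ∧ f * ρ b' = ρ b := by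
  let χ : Y.presheaf.stalk (g q) ⟶ (Spec (.of B)).presheaf.stalk z :=
    (Y.presheaf.stalkCongr (Inseparable.of_eq hq)).hom ≫ j.stalkMap z
  obtain ⟨τ, hτ, hτ'⟩ : ∃ τ : CommRingCat.of B ⟶ (Spec (.of B)).presheaf.stalk z,
      (Spec (.of B)).fromSpecStalk z = Spec.map τ ∧ τ = StructureSheaf.toStalk B z :=
    ⟨_, Spec.fromSpecStalk_eq' _ _, rfl⟩
  let e : (Spec (.of B)).presheaf.stalk z ⟶ X.presheaf.stalk q := inv χ ≫ g.stalkMap q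
  have h1 : Spec.map (τ ≫ e) ≫ j = X.fromSpecStalk q ≫ g := by
    have h2 : Spec.map χ ≫ Y.fromSpecStalk (g q) =
        Spec.map τ ≫ j := by
      rw [← hτ, ← Scheme.SpecMap_stalkMap_fromSpecStalk, Spec.map_comp,
        Category.assoc]
      congr 1
      exact Scheme.SpecMap_stalkSpecializes_fromSpecStalk (specializes_of_eq hq.symm)
    rw [Spec.map_comp, Category.assoc, ← h2, Spec.map_comp, Category.assoc, Spec.map_inv,
      IsIso.inv_hom_id_assoc, Scheme.SpecMap_stalkMap_fromSpecStalk]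
  have h3 : ρ = (τ ≫ e).hom := stalk_factor_unique h h1
  have h4 (a : (Spec (.of B)).presheaf.stalk z) :
      ∃ b b', b' ∉ z.asIdeal ∧ a * τ.hom b' = τ.hom b := by
    rw [hτ']
    exact exists_mul_toStalk_eq z a
  obtain ⟨b, b', hb', hb⟩ := h4 ((inv e).hom f)
  refine ⟨b, b', hb', ?_⟩
  have h5 := congr_arg e.hom hb
  rw [map_mul] at h5
  rw [h3]
  refine Eq.trans ?_ h5
  congr 1
  exact (congr_arg (fun a => a.hom f) (IsIso.inv_hom_id e)).symm

end Factor

/-! ### Prime divisors and orders of vanishing -/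

section Order

variable {X : Scheme.{u}} [IsIntegral X]

/-- A point of codimension one has no generizations but itself and the generic point. -/
lemma eq_or_eq_genericPoint_of_specializes {x y : X} (hy : Order.coheight y = 1) (h : x ⤳ y) :
    x = y ∨ x = genericPoint X := by
  by_cases hxy : y ⤳ x
  · exact Or.inl (h.antisymm hxy).eq
  right
  have h1 : y < x := lt_of_le_not_ge h hxy
  have h2 : Order.coheight x = 0 := by
    have := Order.coheight_add_one_le h1
    rw [hy] at this
    simpa using (ENat.add_le_add_iff_right (k := 1) ENat.one_ne_top).mp (this.trans (zero_add 1).ge)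
  have h3 : IsMax x := Order.coheight_eq_zero.mp h2
  have h4 : x ⤳ genericPoint X := h3 (b := ⊤) le_top
  exact (h4.antisymm ((genericPoint_spec X).specializes trivial)).eq

lemma eq_of_specializes {x y : X} (hx : Order.coheight x = 1) (hy : Order.coheight y = 1)
    (h : x ⤳ y) : x = y := by
  refine (eq_or_eq_genericPoint_of_specializes hy h).resolve_right fun h1 => ?_
  have h2 : Order.coheight (⊤ : X) = 0 := Order.coheight_top X
  have h3 : x = ⊤ := h1
  rw [h3, h2] at hx
  exact zero_ne_one hx

/-- A closed subset that is not everything contains finitely many prime divisors. -/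
lemma finite_primeDivisor_mem [NoetherianSpace X] {Z : Set X} (hZ : IsClosed Z)
    (hη : genericPoint X ∉ Z) : {x : PrimeDivisor X | x.1 ∈ Z}.Finite := by
  obtain ⟨S, hS, hS₁, hS₂, rfl⟩ := NoetherianSpace.exists_finite_set_isClosed_irreducible hZ
  have h1 : ∀ T ∈ S, ∃ t : X, IsGenericPoint t T := fun T hT =>
    QuasiSober.sober (hS₂ T hT) (hS₁ T hT)
  choose! g hg using h1
  refine Set.Finite.of_finite_image (f := Subtype.val) ((hS.image g).subset ?_)
    Subtype.val_injective.injOn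
  rintro _ ⟨x, ⟨T, hT, hx⟩, rfl⟩
  refine ⟨T, hT, (eq_or_eq_genericPoint_of_specializes x.2
    ((hg T hT).specializes hx)).resolve_right fun h2 => hη ⟨T, hT, ?_⟩⟩
  rw [← h2]
  exact (hg T hT).mem

variable [IsLocallyNoetherian X]

lemma ord_algebraMap_of_isUnit {q : X} {u : X.presheaf.stalk q} (hu : IsUnit u) :
    Scheme.ord (algebraMap _ X.functionField u) q = 0 := by
  by_cases hq : Order.coheight q = 1
  · have := krullDimLE_of_coheight_le hq.le
    have h0 : algebraMap _ X.functionField u ≠ 0 := (hu.map _).ne_zero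
    rw [Scheme.ord_eq_iff hq h0]
    exact Ring.ordFrac_of_isUnit hu
  · rw [Scheme.ord_eq_zero_of_coheight_neq_one hq]

lemma ord_algebraMap_nonneg {q : X} {u : X.presheaf.stalk q} (hu : u ≠ 0) :
    0 ≤ Scheme.ord (algebraMap _ X.functionField u) q := by
  by_cases hq : Order.coheight q = 1
  · have := krullDimLE_of_coheight_le hq.le
    have h0 : algebraMap _ X.functionField u ≠ 0 :=
      (map_ne_zero_iff _ (IsFractionRing.injective _ _)).mpr hu
    rw [Scheme.le_ord_iff hq h0]
    exact Ring.ordFrac_ge_one_of_ne_zero hu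
  · rw [Scheme.ord_eq_zero_of_coheight_neq_one hq]

/-- A point whose local ring has a principal maximal ideal is a prime divisor, along which the
generator vanishes to order one. -/
lemma coheight_and_ord_of_maximalIdeal {q : X} {ϖ : X.presheaf.stalk q} (hϖ : ϖ ≠ 0)
    (hmax : IsLocalRing.maximalIdeal (X.presheaf.stalk q) = Ideal.span {ϖ}) :
    Order.coheight q = 1 ∧ Scheme.ord (algebraMap _ X.functionField ϖ) q = 1 := by
  have hF : ¬ IsField (X.presheaf.stalk q) := by
    rw [IsLocalRing.isField_iff_maximalIdeal_eq, hmax, Ideal.span_singleton_eq_bot]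
    exact hϖ
  have : IsDiscreteValuationRing (X.presheaf.stalk q) :=
    ((IsDiscreteValuationRing.TFAE (X.presheaf.stalk q) hF).out 0 4 rfl rfl).mpr ⟨⟨ϖ, hmax⟩⟩
  have h1 : Order.coheight q = 1 := by
    have := ringKrullDim_stalk_eq_coheight q
    rw [IsDiscreteValuationRing.ringKrullDim_eq_one] at this
    exact_mod_cast this.symm
  refine ⟨h1, ?_⟩
  rw [Scheme.ord_eq_iff h1 ((map_ne_zero_iff _ (IsFractionRing.injective _ _)).mpr hϖ)]
  exact Ring.ordFrac_irreducible ((IsDiscreteValuationRing.irreducible_iff_uniformizer ϖ).mpr hmax)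

lemma ord_one (q : X) : Scheme.ord (1 : X.functionField) q = 0 := by
  have := Scheme.ord_mul (x := q) (one_ne_zero (α := X.functionField)) one_ne_zero
  rw [one_mul] at this
  omega

lemma ord_inv {f : X.functionField} (q : X) (hf : f ≠ 0) :
    Scheme.ord f⁻¹ q = - Scheme.ord f q := by
  have := Scheme.ord_mul (x := q) hf (inv_ne_zero hf)
  rw [mul_inv_cancel₀ hf, ord_one] at this
  omega

lemma ord_zpow {f : X.functionField} (q : X) (hf : f ≠ 0) (n : ℤ) :
    Scheme.ord (f ^ n) q = n * Scheme.ord f q := by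
  have key (n : ℕ) : Scheme.ord (f ^ n) q = n * Scheme.ord f q := by
    induction n with
    | zero => simp [ord_one]
    | succ n ih =>
      rw [pow_succ, Scheme.ord_mul (pow_ne_zero n hf) hf, ih]
      push_cast
      ring
  obtain ⟨n, rfl | rfl⟩ := n.eq_nat_or_neg
  · rw [zpow_natCast, key]
  · rw [zpow_neg, zpow_natCast, ord_inv _ (pow_ne_zero n hf), key, neg_mul]

end Order

/-! ### Compatibilities of degree-zero localizations -/

section AwayLift

variable {S σ R R' : Type u} [CommRing S] [CommRing R] [CommRing R'] [SetLike σ S]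
  [AddSubgroupClass σ S] {𝒜 : ℕ → σ} [GradedRing 𝒜]

lemma comp_awayLift {f : S} {d : ℕ} (hfd : f ∈ 𝒜 d) (κ : S →+* R) (hf : IsUnit (κ f))
    (φ : R →+* R') (hf' : IsUnit (φ.comp κ f)) :
    φ.comp (awayLift 𝒜 κ hf) = awayLift 𝒜 (φ.comp κ) hf' := by
  ext F
  obtain ⟨n, g, hg, rfl⟩ := HomogeneousLocalization.Away.mk_surjective _ hfd F
  refine (hf'.pow n).mul_left_injective ?_
  have h1 := congr_arg φ (awayLift_mk_mul κ hf hfd n g hg)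
  rw [map_mul, map_pow] at h1
  exact h1.trans (awayLift_mk_mul (φ.comp κ) hf' hfd n g hg).symm

lemma awayLift_comp_awayMap {f g x : S} {d e : ℕ} (hfd : f ∈ 𝒜 d) (hge : g ∈ 𝒜 e)
    (hx : x = f * g) (κ : S →+* R) (hf : IsUnit (κ f)) (hκx : IsUnit (κ x)) :
    (awayLift 𝒜 κ hκx).comp (HomogeneousLocalization.awayMap 𝒜 hge hx) = awayLift 𝒜 κ hf := by
  ext F
  obtain ⟨n, a, ha, rfl⟩ := HomogeneousLocalization.Away.mk_surjective _ hfd F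
  refine (hκx.pow n).mul_left_injective ?_
  beta_reduce
  rw [RingHom.comp_apply, HomogeneousLocalization.awayMap_mk, awayLift_mk_mul, map_mul, map_pow,
    ← awayLift_mk_mul κ hf hfd n a ha, hx, map_mul, mul_pow]
  ring

lemma SpecMap_awayLift_awayι {f g : S} {d e : ℕ} (hfd : f ∈ 𝒜 d) (hd : 0 < d) (hge : g ∈ 𝒜 e)
    (he : 0 < e) (κ : S →+* R) (hf : IsUnit (κ f)) (hg : IsUnit (κ g)) :
    Spec.map (CommRingCat.ofHom (awayLift 𝒜 κ hf)) ≫ Proj.awayι 𝒜 f hfd hd =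
      Spec.map (CommRingCat.ofHom (awayLift 𝒜 κ hg)) ≫ Proj.awayι 𝒜 g hge he := by
  have hx : IsUnit (κ (f * g)) := by rw [map_mul]; exact hf.mul hg
  have hdeg {n n' : ℕ} (h : f * g ∈ 𝒜 n) (hn : 0 < n) (h' : f * g ∈ 𝒜 n') (hn' : 0 < n')
      (e : n = n') : Proj.awayι 𝒜 (f * g) h hn = Proj.awayι 𝒜 (f * g) h' hn' := by
    subst e
    rfl
  rw [← awayLift_comp_awayMap hfd hge rfl κ hf hx,
    ← awayLift_comp_awayMap hge hfd (mul_comm f g) κ hg hx, CommRingCat.ofHom_comp,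
    CommRingCat.ofHom_comp, Spec.map_comp, Spec.map_comp, Category.assoc, Category.assoc,
    Proj.SpecMap_awayMap_awayι _ hfd hd hge rfl,
    Proj.SpecMap_awayMap_awayι _ hge he hfd (mul_comm f g)]
  exact congr_arg _ (hdeg _ _ _ _ (add_comm d e))

end AwayLift

/-! ### Rational functions on an affine chart -/

section Chart

variable {X : Scheme.{u}} [IsIntegral X] {R : Type u} [CommRing R] [IsDomain R]

lemma exists_isPullbackHom (l : Spec (.of R) ⟶ X) [IsOpenImmersion l] :
    ∃ φ : R →+* X.functionField, IsPullbackHom (𝟙 X) l φ ∧ Function.Injective φ := by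
  have h1 : genericPoint X = l (genericPoint (Spec (.of R))) :=
    (genericPoint_eq_of_isOpenImmersion l).symm
  obtain ⟨φ, h2, h3⟩ := exists_stalk_factor (g := 𝟙 X) (j := l) (q := genericPoint X) h1
  refine ⟨φ, h2, (injective_iff_map_eq_zero φ).mpr fun b hb => ?_⟩
  have h4 : ¬ IsUnit (φ b) := by
    rw [hb]
    exact not_isUnit_zero (M₀ := X.functionField)
  have h5 : b ∈ (genericPoint (Spec (.of R))).asIdeal := by
    by_contra h6
    exact h4 ((h3 b).mpr h6)
  rw [genericPoint_eq_bot_of_affine] at h5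
  exact h5

/-- The embedding of the coordinate ring of an affine open subscheme in the function field. -/
noncomputable def chartFun (l : Spec (.of R) ⟶ X) [IsOpenImmersion l] : R →+* X.functionField :=
  (exists_isPullbackHom l).choose

variable (l : Spec (.of R) ⟶ X) [IsOpenImmersion l]

lemma isPullbackHom_chartFun : IsPullbackHom (𝟙 X) l (chartFun l) :=
  (exists_isPullbackHom l).choose_spec.1

lemma chartFun_injective : Function.Injective (chartFun l) :=
  (exists_isPullbackHom l).choose_spec.2

lemma exists_stalk_chartFun (z : Spec (.of R)) :
    ∃ ρ : R →+* X.presheaf.stalk (l z),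
      (∀ b, algebraMap (X.presheaf.stalk (l z)) X.functionField (ρ b) = chartFun l b) ∧
      (∀ b, IsUnit (ρ b) ↔ b ∉ z.asIdeal) ∧
      ∀ f, ∃ b b', b' ∉ z.asIdeal ∧ f * ρ b' = ρ b := by
  obtain ⟨ρ, h1, h2, h3⟩ := (isPullbackHom_chartFun l).exists_stalk (q := l z) (z := z) rfl
  exact ⟨ρ, fun b => DFunLike.congr_fun h1 b, h2, exists_mul_stalk_eq (g := 𝟙 X) (j := l) rfl h3⟩

lemma exists_chartFun_div (f : X.functionField) :
    ∃ b b', b' ≠ 0 ∧ f = chartFun l b / chartFun l b' := by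
  have h1 : genericPoint X = l (genericPoint (Spec (.of R))) :=
    (genericPoint_eq_of_isOpenImmersion l).symm
  obtain ⟨b, b', h2, h3⟩ := exists_mul_stalk_eq (g := 𝟙 X) (j := l) (q := genericPoint X) h1
    (isPullbackHom_chartFun l) f
  rw [genericPoint_eq_bot_of_affine] at h2
  have h4 : b' ≠ 0 := h2
  exact ⟨b, b', h4, eq_div_of_mul_eq
    ((map_ne_zero_iff _ (chartFun_injective l)).mpr h4) h3⟩

variable [IsLocallyNoetherian X]

lemma ord_chartFun_eq_zero {z : Spec (.of R)} {b : R} (hb : b ∉ z.asIdeal) :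
    Scheme.ord (chartFun l b) (l z) = 0 := by
  obtain ⟨ρ, h1, h2, -⟩ := exists_stalk_chartFun l z
  rw [← h1]
  exact ord_algebraMap_of_isUnit ((h2 b).mpr hb)

lemma ord_chartFun_nonneg (z : Spec (.of R)) {b : R} (hb : b ≠ 0) :
    0 ≤ Scheme.ord (chartFun l b) (l z) := by
  obtain ⟨ρ, h1, h2, -⟩ := exists_stalk_chartFun l z
  rw [← h1]
  refine ord_algebraMap_nonneg fun h3 => hb (chartFun_injective l ?_)
  rw [← h1, h3, map_zero, map_zero]

/-- A principal prime ideal in an affine chart gives a prime divisor. -/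
lemma coheight_and_ord_of_span {z : Spec (.of R)} {ϖ : R} (hϖ : ϖ ≠ 0)
    (hz : z.asIdeal = Ideal.span {ϖ}) :
    Order.coheight (l z) = 1 ∧ Scheme.ord (chartFun l ϖ) (l z) = 1 := by
  obtain ⟨ρ, h1, h2, h3⟩ := exists_stalk_chartFun l z
  rw [← h1]
  refine coheight_and_ord_of_maximalIdeal (fun h4 => hϖ (chartFun_injective l ?_)) ?_
  · rw [← h1, h4, map_zero, map_zero]
  refine le_antisymm (fun f hf => ?_) ?_
  · obtain ⟨b, b', hb', hb⟩ := h3 f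
    have h4 := (h2 b').mpr hb'
    have h5 : b ∈ z.asIdeal := by
      by_contra h6
      have h7 := (h2 b).mpr h6
      rw [← hb] at h7
      exact hf (isUnit_of_mul_isUnit_left h7)
    rw [hz, Ideal.mem_span_singleton] at h5
    rw [Ideal.mem_span_singleton, ← h4.dvd_mul_right, hb]
    exact map_dvd ρ h5
  · rw [Ideal.span_singleton_le_iff_mem]
    intro h4
    refine (h2 ϖ).mp h4 ?_
    rw [hz]
    exact Ideal.mem_span_singleton_self ϖ

/-- On an affine chart with factorial coordinate ring, a rational function without poles is
regular. -/
lemma exists_chartFun_eq [UniqueFactorizationMonoid R] {f : X.functionField}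
    (hf : ∀ (z : Spec (.of R)) (ϖ : R), Prime ϖ → z.asIdeal = Ideal.span {ϖ} →
      0 ≤ Scheme.ord f (l z)) : ∃ b, f = chartFun l b := by
  by_cases hf0 : f = 0
  · exact ⟨0, by rw [hf0, map_zero]⟩
  obtain ⟨b, b', hb', rfl⟩ := exists_chartFun_div l f
  have hb : b ≠ 0 := by
    rintro rfl
    rw [map_zero, zero_div] at hf0
    exact hf0 rfl
  obtain ⟨a, a', c, h1, rfl, rfl⟩ := UniqueFactorizationMonoid.exists_reduced_factors b hb b'
  have hc := left_ne_zero_of_mul hb'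
  have ha := right_ne_zero_of_mul hb
  have ha' := right_ne_zero_of_mul hb'
  have h0 {r : R} (hr : r ≠ 0) : chartFun l r ≠ 0 :=
    (map_ne_zero_iff _ (chartFun_injective l)).mpr hr
  rw [map_mul, map_mul, mul_div_mul_left _ _ (h0 hc)] at hf ⊢
  have h2 : IsUnit a' := by
    by_contra h3
    obtain ⟨ϖ, hϖ, hϖa⟩ := WfDvdMonoid.exists_irreducible_factor h3 ha'
    rw [UniqueFactorizationMonoid.irreducible_iff_prime] at hϖ
    let z : Spec (.of R) := ⟨Ideal.span {ϖ}, (Ideal.span_singleton_prime hϖ.ne_zero).mpr hϖ⟩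
    have hz : z.asIdeal = Ideal.span {ϖ} := rfl
    have h4 := hf z ϖ hϖ hz
    have h5 : a ∉ z.asIdeal := fun h6 =>
      hϖ.not_isUnit (h1 (Ideal.mem_span_singleton.mp h6) hϖa)
    rw [div_eq_mul_inv, Scheme.ord_mul (h0 ha) (inv_ne_zero (h0 ha')), ord_inv _ (h0 ha'),
      ord_chartFun_eq_zero l h5] at h4
    obtain ⟨e, rfl⟩ := hϖa
    have he := right_ne_zero_of_mul ha'
    rw [map_mul, Scheme.ord_mul (h0 hϖ.ne_zero) (h0 he),
      (coheight_and_ord_of_span l hϖ.ne_zero hz).2] at h4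
    have := ord_chartFun_nonneg l z he
    omega
  obtain ⟨v, rfl⟩ := h2
  exact ⟨a * (v⁻¹ : Rˣ), by rw [map_mul, map_units_inv, div_eq_mul_inv]⟩

end Chart

/-! ### Homogeneous polynomials as rational functions -/

section Coordinates

open MvPolynomial

variable {k : Type u} [Field k] {m p q : ℕ} {w : Fin 3 → ℕ}
  {h : IsTriple m (w 0) (w 1) (w 2) p q} {Y : Scheme.{u}} {π : Y ⟶ weightedPlane k w}
  {s t : Spec (.of (ChartRing k)) ⟶ Y} {o : (identityCompl k w).toScheme ⟶ Y}
  [IsOpenImmersion s] [IsOpenImmersion t] [IsOpenImmersion o] [IsIntegral Y]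

/-- The embedding of homogeneous polynomials in the function field of `Y`, where a monomial of degree
one is set equal to `1`.  A quotient of two homogeneous polynomials of the same degree goes to the
rational function that it defines. -/
noncomputable def coord (m p q : ℕ) (s : Spec (.of (ChartRing k)) ⟶ Y) [IsOpenImmersion s] :
    MvPolynomial (Fin 3) k →+* Y.functionField :=
  (chartFun s).comp (chartTheta k m p q)

lemma isUnit_coord_X (i : Fin 3) : IsUnit (coord m p q s (X i)) :=
  (isUnit_chartTheta i).map (chartFun s)

lemma torusLift_coord : torusLift w (coord m p q s) isUnit_coord_X =
    (chartFun s).comp (chartHom k w m p q) :=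
  (comp_awayLift coordProd_mem _ _ _ _).symm

namespace IsBlowupCover

variable (c : IsBlowupCover h π s t o)
include c

lemma isPullbackHom_torus :
    IsPullbackHom π (h.torusι k) (torusLift w (coord m p q s) isUnit_coord_X) := by
  rw [IsPullbackHom, torusLift_coord, CommRingCat.ofHom_comp, Spec.map_comp, Category.assoc,
    ← c.chart_comp, ← Category.assoc, isPullbackHom_chartFun s, Category.comp_id]

lemma apply_genericPoint :
    π (genericPoint Y) = h.torusι k (genericPoint (Spec (.of (TorusRing k w)))) := by
  have := h.isIntegral_plane (k := k)
  have := c.isIntegral_compl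
  rw [genericPoint_eq_of_isOpenImmersion (h.torusι k), ← genericPoint_eq_of_isOpenImmersion o,
    ← Scheme.Hom.comp_apply, c.compl_comp, genericPoint_eq_of_isOpenImmersion]

lemma coord_ne_zero {n : ℕ} {g : MvPolynomial (Fin 3) k} (hg : g.IsWeightedHomogeneous w n)
    (hg0 : g ≠ 0) : coord m p q s g ≠ 0 := by
  set N := ∑ i, w i with hN
  have h1 : g ^ N ∈ weightedHomogeneousSubmodule k w (n • N) := by
    rw [mem_weightedHomogeneousSubmodule, smul_eq_mul, mul_comm]
    exact hg.pow N
  let b : TorusRing k w := HomogeneousLocalization.Away.mk _ coordProd_mem n (g ^ N) h1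
  have hb : b ≠ 0 := by
    intro h2
    have h3 := awayLift_mk_mul (algebraMap (MvPolynomial (Fin 3) k)
      (Localization.Away (coordProd k))) (IsLocalization.Away.algebraMap_isUnit (coordProd k))
      coordProd_mem n (g ^ N) h1
    have h4 : HomogeneousLocalization.Away.mk _ coordProd_mem n (g ^ N) h1 = 0 := h2
    rw [h4, map_zero, zero_mul, eq_comm, IsLocalization.to_map_eq_zero_iff
      (Localization.Away (coordProd k)) (M := Submonoid.powers (coordProd k))] at h3
    · exact pow_ne_zero N hg0 h3
    · exact powers_le_nonZeroDivisors_of_noZeroDivisors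
        (Finset.prod_ne_zero_iff.mpr fun i _ => X_ne_zero i)
  obtain ⟨ρ, h2, h3⟩ := exists_stalk_factor c.apply_genericPoint
  have h2 := stalk_factor_unique h2 c.isPullbackHom_torus
  have h4 : IsUnit (ρ b) := by
    rw [h3, genericPoint_eq_bot_of_affine]
    exact hb
  have h5 : torusLift w (coord m p q s) isUnit_coord_X b ≠ 0 := by
    rw [← h2]
    exact IsUnit.ne_zero (M₀ := Y.functionField) h4
  intro h6
  have h7 := awayLift_mk_mul (coord m p q s) (isUnit_coordProd (coord m p q s) isUnit_coord_X)
      coordProd_mem n (g ^ N) h1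
  rw [map_pow, h6, zero_pow h.sum_pos.ne', mul_eq_zero] at h7
  exact h7.elim h5 (pow_ne_zero _ (isUnit_coordProd (coord m p q s) isUnit_coord_X).ne_zero)

lemma isPullbackHom_away {H : MvPolynomial (Fin 3) k} {d : ℕ}
    (hH : H ∈ weightedHomogeneousSubmodule k w d) (hd : 0 < d)
    (hu : IsUnit (coord m p q s H)) :
    IsPullbackHom π (Proj.awayι _ H hH hd) (awayLift _ (coord m p q s) hu) := by
  rw [IsPullbackHom, SpecMap_awayLift_awayι hH hd coordProd_mem h.sum_pos _ _
    (isUnit_coordProd (coord m p q s) isUnit_coord_X)]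
  exact c.isPullbackHom_torus

/-- A quotient of homogeneous polynomials of the same degree is regular where the denominator does
not vanish, and invertible there if and only if the numerator does not vanish either. -/
lemma exists_stalk_coord_div {x : Y} {g H : MvPolynomial (Fin 3) k} {d : ℕ} (hd : 0 < d)
    (hg : g.IsWeightedHomogeneous w d) (hH : H.IsWeightedHomogeneous w d)
    (hx : H ∉ (π x).asHomogeneousIdeal) :
    ∃ u : Y.presheaf.stalk x, algebraMap (Y.presheaf.stalk x) Y.functionField u *
      coord m p q s H = coord m p q s g ∧ (IsUnit u ↔ g ∉ (π x).asHomogeneousIdeal) := by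
  have hH0 : H ≠ 0 := by
    rintro rfl
    exact hx (zero_mem _)
  have hu : IsUnit (coord m p q s H) := (c.coord_ne_zero hH hH0).isUnit
  have hH' : H ∈ weightedHomogeneousSubmodule k w d := hH
  have h1 : π x ∈ (Proj.awayι _ H hH' hd).opensRange := by
    rw [Proj.opensRange_awayι]
    exact hx
  obtain ⟨z, hz⟩ := h1
  obtain ⟨ρ, h2, h3, -⟩ := (c.isPullbackHom_away hH' hd hu).exists_stalk hz.symm
  have hg' : g ∈ weightedHomogeneousSubmodule k w (1 • d) := by rwa [one_smul]
  refine ⟨ρ (HomogeneousLocalization.Away.mk _ hH' 1 g hg'), ?_, ?_⟩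
  · have h4 := awayLift_mk_mul (coord m p q s) hu hH' 1 g hg'
    rw [pow_one, ← h2] at h4
    exact h4
  · rw [h3, ← hz]
    exact (mem_awayι_apply_iff _ hH' hd hg' z).not.symm

omit [IsIntegral Y] in
lemma isIso_stalkMap {x : Y} (hx : π x ∉ torusIdentity k w) : IsIso (π.stalkMap x) := by
  obtain ⟨y, rfl⟩ := (c.mem_range_compl_iff x).mpr hx
  have : IsOpenImmersion (o ≫ π) := by
    rw [c.compl_comp]
    infer_instance
  have h1 : IsIso (π.stalkMap (o y) ≫ o.stalkMap y) := by
    have h2 : IsIso ((o ≫ π).stalkMap y) := inferInstance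
    rwa [Scheme.Hom.stalkMap_comp] at h2
  exact @IsIso.of_isIso_comp_right _ _ _ _ _ (π.stalkMap (o y)) (o.stalkMap y) _ h1

/-- Away from the exceptional divisor, the germs of functions are quotients of homogeneous polynomials
of the same degree. -/
lemma exists_eq_coord_div {x : Y} (hx : π x ∉ torusIdentity k w) (a : Y.presheaf.stalk x) :
    ∃ (d : ℕ) (g H : MvPolynomial (Fin 3) k), 0 < d ∧ g.IsWeightedHomogeneous w d ∧
      H.IsWeightedHomogeneous w d ∧ H ∉ (π x).asHomogeneousIdeal ∧
      algebraMap (Y.presheaf.stalk x) Y.functionField a * coord m p q s H = coord m p q s g := by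
  obtain ⟨i, hi⟩ := IsTriple.exists_X_notMem (π x)
  have hX := X_mem_weightedHomogeneousSubmodule (k := k) (w := w) i
  have hu : IsUnit (coord m p q s (X i)) := isUnit_coord_X i
  have h1 : π x ∈ (Proj.awayι _ (X i) hX (h.pos i)).opensRange := by
    rw [Proj.opensRange_awayι]
    exact hi
  obtain ⟨z, hz⟩ := h1
  obtain ⟨ρ, h2, h3, h4⟩ := (c.isPullbackHom_away hX (h.pos i) hu).exists_stalk hz.symm
  have := c.isIso_stalkMap hx
  obtain ⟨b, b', hb', hb⟩ := exists_mul_stalk_eq hz.symm h4 a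
  obtain ⟨n, g, hg, rfl⟩ := HomogeneousLocalization.Away.mk_surjective _ hX b
  obtain ⟨n', g', hg', rfl⟩ := HomogeneousLocalization.Away.mk_surjective _ hX b'
  have h5 := awayLift_mk_mul (coord m p q s) hu hX n g hg
  have h6 := awayLift_mk_mul (coord m p q s) hu hX n' g' hg'
  have h7 : g' ∉ (π x).asHomogeneousIdeal := by
    rw [← hz]
    exact (mem_awayι_apply_iff _ hX (h.pos i) hg' z).not.mpr hb'
  have h8 (j : ℕ) : (X i ^ j : MvPolynomial (Fin 3) k).IsWeightedHomogeneous w (j * w i) :=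
    (isWeightedHomogeneous_X k w i).pow j
  refine ⟨n * w i + (n' + 1) * w i, g * X i ^ (n' + 1), g' * X i ^ (n + 1), ?_, ?_, ?_, ?_, ?_⟩
  · have := h.pos i
    positivity
  · exact IsWeightedHomogeneous.mul hg (h8 _)
  · have := IsWeightedHomogeneous.mul hg' (h8 (n + 1))
    convert this using 1
    simp only [smul_eq_mul]
    ring
  · intro h9
    obtain h9 | h9 := (π x).isPrime.mem_or_mem h9
    · exact h7 h9
    · exact hi ((π x).isPrime.mem_of_pow_mem _ h9)
  · have h9 := congr_arg (algebraMap (Y.presheaf.stalk x) Y.functionField) hb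
    rw [map_mul] at h9
    have h10 (b) : algebraMap (Y.presheaf.stalk x) Y.functionField (ρ b) =
        awayLift _ (coord m p q s) hu b := DFunLike.congr_fun h2 b
    rw [h10, h10] at h9
    rw [map_mul, map_mul, map_pow, map_pow, ← h5, ← h6, pow_succ, pow_succ, ← h9]
    ring

end IsBlowupCover

end Coordinates

/-! ### Torus-invariant curves in the plane -/

section Monomials

open MvPolynomial

variable {k : Type u} [Field k] {m p q : ℕ} {w : Fin 3 → ℕ}

lemma isWeightedHomogeneous_of_X_mul {i : Fin 3} {g : MvPolynomial (Fin 3) k} {d : ℕ}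
    (hg : (X i * g).IsWeightedHomogeneous w d) (h0 : g ≠ 0) :
    ∃ d', d' + w i = d ∧ g.IsWeightedHomogeneous w d' := by
  have key {μ : Fin 3 →₀ ℕ} (hμ : coeff μ g ≠ 0) : w i + Finsupp.weight w μ = d := by
    have h1 : coeff (Finsupp.single i 1 + μ) (X i * g) ≠ 0 := by rwa [coeff_X_mul]
    have h2 := hg h1
    rwa [map_add, Finsupp.weight_single, one_smul] at h2
  obtain ⟨μ, hμ⟩ := MvPolynomial.ne_zero_iff.mp h0
  refine ⟨Finsupp.weight w μ, by rw [add_comm]; exact key hμ, fun ν hν => ?_⟩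
  have h1 := key hμ
  have h2 := key hν
  omega

lemma isWeightedHomogeneous_prod_X_pow (n : Fin 3 → ℕ) :
    (∏ i, X i ^ n i : MvPolynomial (Fin 3) k).IsWeightedHomogeneous w (∑ i, n i * w i) :=
  IsWeightedHomogeneous.prod _ _ _ fun i _ => (isWeightedHomogeneous_X k w i).pow (n i)

namespace IsTriple

variable (h : IsTriple m (w 0) (w 1) (w 2) p q)
include h

/-- The torus-invariant curves of the weighted projective plane have torus-invariant local equations:
this is the exponent of a Laurent monomial of degree zero that contains the `i`-th coordinate to the
power one. -/
lemma exists_exponent (i : Fin 3) : ∃ e : zeroWeight w, e.1 i = 1 := by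
  have e1 : (3 * q : ℤ) = m * p + 1 := by exact_mod_cast h.hpq
  have e2 : (w 2 : ℤ) = 8 * m - 3 := by have := h.hc; omega
  have e3 : (w 0 : ℤ) = 7 * m - 3 := by have := h.ha; omega
  have e4 : (w 1 : ℤ) = 5 * m ^ 2 - 2 * m := by have := h.hb; zify at this; linarith
  have hx0 : (exponentX w p q).1 0 = q * w 2 := rfl
  have hx1 : (exponentX w p q).1 1 = -(p * w 2) := rfl
  have hx2 : (exponentX w p q).1 2 = p * w 1 - q * w 0 := rfl
  have hy0 : h.exponentY.1 0 = -m := rfl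
  have hy1 : h.exponentY.1 1 = 3 := rfl
  have hy2 : h.exponentY.1 2 = -m := rfl
  have key (α β : ℤ) (j : Fin 3) : (α • exponentX w p q + β • h.exponentY).1 j =
      α * (exponentX w p q).1 j + β * h.exponentY.1 j := rfl
  fin_cases i
  · refine ⟨(-1 : ℤ) • exponentX w p q + (p - 8 * q : ℤ) • h.exponentY, ?_⟩
    rw [key]
    simp only [Fin.zero_eta, hx0, hy0, e2]
    linear_combination e1
  · refine ⟨(-1 : ℤ) • exponentX w p q + (3 - 8 * q + p : ℤ) • h.exponentY, ?_⟩
    rw [key]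
    simp only [Fin.mk_one, hx1, hy1, e2]
    linear_combination -8 * e1
  · refine ⟨(1 : ℤ) • exponentX w p q + (p * (5 * m - 2) - 7 * q + p : ℤ) • h.exponentY, ?_⟩
    rw [key]
    simp only [Fin.reduceFinMk, hx2, hy2, e3, e4]
    linear_combination e1

omit h in
lemma X_notMem_of_mem_basicOpen {x : weightedPlane k w}
    (hx : x ∈ Proj.basicOpen (weightedHomogeneousSubmodule k w) (coordProd k)) (i : Fin 3) :
    X i ∉ x.asHomogeneousIdeal := by
  rw [Proj.mem_basicOpen] at hx
  exact fun h1 => hx (Ideal.mem_of_dvd _ (Finset.dvd_prod_of_mem X (Finset.mem_univ i)) h1)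

lemma notMem_torusIdentity {x : weightedPlane k w} {i : Fin 3} (hx : X i ∈ x.asHomogeneousIdeal) :
    x ∉ torusIdentity k w := fun h1 =>
  X_notMem_of_mem_basicOpen (h.mem_basicOpen_of_mem_torusIdentity h1) i hx

/-- The generic point of the curve where the `i`-th coordinate vanishes. -/
noncomputable def coordPoint (i : Fin 3) : weightedPlane k w where
  asHomogeneousIdeal := ⟨Ideal.span {X i}, Ideal.homogeneous_span _ _ (by
    rintro _ rfl
    exact ⟨w i, isWeightedHomogeneous_X k w i⟩)⟩
  isPrime := (Ideal.span_singleton_prime (X_ne_zero i)).mpr (X_prime (i := i))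
  not_irrelevant_le := by
    intro hle
    obtain ⟨j, hj⟩ : ∃ j, j ≠ i := exists_ne i
    have h1 : (X j : MvPolynomial (Fin 3) k) ∈ Ideal.span {X i} :=
      hle (HomogeneousIdeal.mem_irrelevant_of_mem _ (h.pos j)
        (X_mem_weightedHomogeneousSubmodule j))
    rw [Ideal.mem_span_singleton, X_dvd_X] at h1
    exact hj h1.symm

lemma mem_coordPoint {i : Fin 3} {g : MvPolynomial (Fin 3) k} :
    g ∈ (h.coordPoint (k := k) i).asHomogeneousIdeal ↔ X i ∣ g :=
  Ideal.mem_span_singleton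

end IsTriple

end Monomials

/-! ### Orders along the coordinate divisors -/

section CoordinateDivisors

open MvPolynomial

variable {k : Type u} [Field k] {m p q : ℕ} {w : Fin 3 → ℕ}
  {h : IsTriple m (w 0) (w 1) (w 2) p q} {Y : Scheme.{u}} {π : Y ⟶ weightedPlane k w}
  {s t : Spec (.of (ChartRing k)) ⟶ Y} {o : (identityCompl k w).toScheme ⟶ Y}
  [IsOpenImmersion s] [IsOpenImmersion t] [IsOpenImmersion o] [IsIntegral Y]

/-- The Laurent monomial with exponent `e` in the function field of `Y`; for `e` of degree zero it
is a rational function. -/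
noncomputable def coordMonomial (m p q : ℕ) (s : Spec (.of (ChartRing k)) ⟶ Y) [IsOpenImmersion s]
    (e : Fin 3 → ℤ) : Y.functionField := ∏ i, coord m p q s (X i) ^ e i

lemma coord_X_ne_zero (i : Fin 3) : coord m p q s (X i) ≠ 0 := (isUnit_coord_X i).ne_zero

lemma coordMonomial_ne_zero (e : Fin 3 → ℤ) : coordMonomial m p q s e ≠ 0 :=
  Finset.prod_ne_zero_iff.mpr fun i _ => zpow_ne_zero _ (coord_X_ne_zero i)

lemma coordMonomial_add (e e' : Fin 3 → ℤ) :
    coordMonomial m p q s (e + e') = coordMonomial m p q s e * coordMonomial m p q s e' := by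
  rw [coordMonomial, coordMonomial, coordMonomial, ← Finset.prod_mul_distrib]
  exact Finset.prod_congr rfl fun i _ => zpow_add₀ (coord_X_ne_zero i) _ _

lemma coordMonomial_sub (e e' : Fin 3 → ℤ) :
    coordMonomial m p q s (e - e') = coordMonomial m p q s e / coordMonomial m p q s e' := by
  rw [eq_div_iff (coordMonomial_ne_zero e'), ← coordMonomial_add, sub_add_cancel]

lemma coordMonomial_zsmul (n : ℤ) (e : Fin 3 → ℤ) :
    coordMonomial m p q s (n • e) = coordMonomial m p q s e ^ n := by
  simp only [coordMonomial, Pi.smul_apply, smul_eq_mul, mul_comm n, zpow_mul, Finset.prod_zpow]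

lemma coordMonomial_natCast (n : Fin 3 → ℕ) :
    coordMonomial m p q s (fun i => n i) = coord m p q s (∏ i, X i ^ n i) := by
  simp only [coordMonomial, zpow_natCast, map_prod, map_pow]

lemma coordMonomial_single (i : Fin 3) :
    coordMonomial m p q s (Pi.single i 1) = coord m p q s (X i) := by
  rw [coordMonomial, Finset.prod_eq_single i]
  · rw [Pi.single_eq_same, zpow_one]
  · intro j _ hj
    rw [Pi.single_eq_of_ne hj, zpow_zero]
  · simp

namespace IsBlowupCover

variable (c : IsBlowupCover h π s t o)
include c

/-- A homogeneous rational function is regular at the points where the exponents of the vanishing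
coordinates are nonnegative. -/
lemma exists_stalk_coord {x : Y} {G H : MvPolynomial (Fin 3) k} {d d' : ℕ}
    (hG : G.IsWeightedHomogeneous w d) (hH : H.IsWeightedHomogeneous w d')
    (hx : H ∉ (π x).asHomogeneousIdeal) {e : Fin 3 → ℤ}
    (hdeg : d + ∑ i, e i * (w i : ℤ) = d') (he : ∀ i, X i ∈ (π x).asHomogeneousIdeal → 0 ≤ e i) :
    ∃ u : Y.presheaf.stalk x, algebraMap (Y.presheaf.stalk x) Y.functionField u *
      coord m p q s H = coord m p q s G * coordMonomial m p q s e ∧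
      (IsUnit u ↔ G ∉ (π x).asHomogeneousIdeal ∧
        ∀ i, X i ∈ (π x).asHomogeneousIdeal → e i = 0) := by
  obtain ⟨j, hj⟩ := IsTriple.exists_X_notMem (π x)
  let n : Fin 3 → ℕ := fun i => (e i).toNat
  let n' : Fin 3 → ℕ := fun i => (-e i).toNat
  have hn (i) : (n i : ℤ) = e i + n' i := by
    simp only [n, n']
    omega
  have h1 := (hG.mul (isWeightedHomogeneous_prod_X_pow n)).mul (isWeightedHomogeneous_X k w j)
  have h2 := (hH.mul (isWeightedHomogeneous_prod_X_pow n')).mul (isWeightedHomogeneous_X k w j)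
  have h3 : d' + ∑ i, n' i * w i = d + ∑ i, n i * w i := by
    zify
    simp only [hn, add_mul, Finset.sum_add_distrib]
    linarith
  rw [h3] at h2
  have hprime := (π x).isPrime
  have hmul {a b : MvPolynomial (Fin 3) k} : a * b ∉ (π x).asHomogeneousIdeal ↔
      a ∉ (π x).asHomogeneousIdeal ∧ b ∉ (π x).asHomogeneousIdeal := by
    rw [← not_or]
    exact hprime.mul_mem_iff_mem_or_mem.not
  have hprod {a : Fin 3 → ℕ} : (∏ i, X i ^ a i : MvPolynomial (Fin 3) k) ∉
      (π x).asHomogeneousIdeal ↔ ∀ i, X i ∈ (π x).asHomogeneousIdeal → a i = 0 := by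
    have h4 : (∏ i, X i ^ a i : MvPolynomial (Fin 3) k) ∈ (π x).asHomogeneousIdeal ↔
        ∃ i, (X i ^ a i : MvPolynomial (Fin 3) k) ∈ (π x).asHomogeneousIdeal :=
      hprime.prod_mem_iff.trans (by simp)
    rw [h4, not_exists]
    refine forall_congr' fun i => ⟨fun h5 h6 => ?_, fun h5 h6 => ?_⟩
    · by_contra h7
      exact h5 (Ideal.pow_mem_of_mem _ h6 _ (Nat.pos_of_ne_zero h7))
    · have h7 := hprime.mem_of_pow_mem _ h6
      rw [h5 h7, pow_zero] at h6
      exact hprime.ne_top ((Ideal.eq_top_iff_one _).mpr h6)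
  obtain ⟨u, hu, hu'⟩ := c.exists_stalk_coord_div (by have := h.pos j; omega) h1 h2 (by
    rw [hmul, hmul, hprod]
    refine ⟨⟨hx, fun i hi => ?_⟩, hj⟩
    have := he i hi
    simp only [n']
    omega)
  refine ⟨u, ?_, ?_⟩
  · have h4 : (fun i => (n i : ℤ)) = e + fun i => (n' i : ℤ) := funext hn
    have h5 := coordMonomial_natCast (m := m) (p := p) (q := q) (s := s) n
    rw [h4, coordMonomial_add, coordMonomial_natCast] at h5
    simp only [map_mul] at hu
    rw [← h5] at hu
    have h6 : coord m p q s (∏ i, X i ^ n' i) ≠ 0 := by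
      rw [← coordMonomial_natCast]
      exact coordMonomial_ne_zero _
    refine mul_right_cancel₀ (mul_ne_zero h6 (coord_X_ne_zero (m := m) (p := p) (q := q) (s := s) j)) ?_
    linear_combination hu
  · rw [hu', hmul, hmul, hprod]
    constructor
    · rintro ⟨⟨h4, h5⟩, -⟩
      refine ⟨h4, fun i hi => ?_⟩
      have h6 := h5 i hi
      have h7 := he i hi
      simp only [n] at h6
      omega
    · rintro ⟨h4, h5⟩
      refine ⟨⟨h4, fun i hi => ?_⟩, hj⟩
      simp only [n, h5 i hi, Int.toNat_zero]

variable [IsLocallyNoetherian Y]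

/-- A homogeneous rational function has no pole where the exponents of the vanishing coordinates are
nonnegative. -/
lemma ord_coord_nonneg {x : Y} {G : MvPolynomial (Fin 3) k} {d : ℕ}
    (hG : G.IsWeightedHomogeneous w d) (hG0 : G ≠ 0) {e : Fin 3 → ℤ}
    (hdeg : d + ∑ i, e i * (w i : ℤ) = 0) (he : ∀ i, X i ∈ (π x).asHomogeneousIdeal → 0 ≤ e i) :
    0 ≤ Scheme.ord (coord m p q s G * coordMonomial m p q s e) x := by
  obtain ⟨u, hu, -⟩ := c.exists_stalk_coord (x := x) hG (isWeightedHomogeneous_one k w)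
    ((Ideal.ne_top_iff_one _).mp (π x).isPrime.ne_top) hdeg he
  rw [map_one, mul_one] at hu
  rw [← hu]
  refine ord_algebraMap_nonneg fun h0 => ?_
  rw [h0, map_zero, eq_comm] at hu
  exact mul_ne_zero (c.coord_ne_zero hG hG0) (coordMonomial_ne_zero e) hu

lemma ord_coord_eq_zero {x : Y} {G : MvPolynomial (Fin 3) k} {d : ℕ}
    (hG : G.IsWeightedHomogeneous w d) (hGx : G ∉ (π x).asHomogeneousIdeal) {e : Fin 3 → ℤ}
    (hdeg : d + ∑ i, e i * (w i : ℤ) = 0) (he : ∀ i, X i ∈ (π x).asHomogeneousIdeal → e i = 0) :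
    Scheme.ord (coord m p q s G * coordMonomial m p q s e) x = 0 := by
  obtain ⟨u, hu, hu'⟩ := c.exists_stalk_coord (x := x) hG (isWeightedHomogeneous_one k w)
    ((Ideal.ne_top_iff_one _).mp (π x).isPrime.ne_top) hdeg (fun i hi => (he i hi).ge)
  rw [map_one, mul_one] at hu
  rw [← hu]
  exact ord_algebraMap_of_isUnit (hu'.mpr ⟨hGx, he⟩)

/-- The proper transform of the curve where the `i`-th coordinate vanishes is a prime divisor.  A
Laurent monomial of degree zero with exponent one at the `i`-th coordinate generates the maximal ideal
of its local ring. -/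
lemma exists_coordDivisor (i : Fin 3) : ∃ x : PrimeDivisor Y,
    (∀ g, g ∈ (π x.1).asHomogeneousIdeal ↔ X i ∣ g) ∧
      ∀ e : zeroWeight w, Scheme.ord (coordMonomial m p q s e.1) x.1 = e.1 i := by
  have hP : h.coordPoint (k := k) i ∉ torusIdentity k w :=
    h.notMem_torusIdentity (h.mem_coordPoint.mpr dvd_rfl)
  let y : (identityCompl k w).toScheme := ⟨h.coordPoint i, hP⟩
  have hy : π (o y) = h.coordPoint i := by
    rw [← Scheme.Hom.comp_apply, c.compl_comp]
    rfl
  have hmem (g) : g ∈ (π (o y)).asHomogeneousIdeal ↔ X i ∣ g := by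
    rw [hy]
    exact h.mem_coordPoint
  have hX {j : Fin 3} : (X j : MvPolynomial (Fin 3) k) ∈ (π (o y)).asHomogeneousIdeal ↔
      j = i := by
    rw [hmem, X_dvd_X, eq_comm]
  have hone : (1 : MvPolynomial (Fin 3) k) ∉ (π (o y)).asHomogeneousIdeal :=
    (Ideal.ne_top_iff_one _).mp (π (o y)).isPrime.ne_top
  obtain ⟨v, hv⟩ := h.exists_exponent i
  have hv0 := mem_zeroWeight.mp v.2
  obtain ⟨ϖ, hϖ, hϖ'⟩ := c.exists_stalk_coord (x := o y) (isWeightedHomogeneous_one k w)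
    (isWeightedHomogeneous_one k w) hone (e := v.1) (by simpa using hv0)
    (fun j hj => by rw [hX.mp hj, hv]; exact zero_le_one)
  rw [map_one, one_mul, mul_one] at hϖ
  have hϖ0 : ϖ ≠ 0 := by
    rintro rfl
    rw [map_zero] at hϖ
    exact coordMonomial_ne_zero _ hϖ.symm
  have hinj := IsFractionRing.injective (Y.presheaf.stalk (o y)) Y.functionField
  have hmax : IsLocalRing.maximalIdeal (Y.presheaf.stalk (o y)) = Ideal.span {ϖ} := by
    refine le_antisymm (fun a ha => ?_) ?_
    · by_cases ha0 : a = 0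
      · rw [ha0]
        exact zero_mem _
      obtain ⟨d, g, H, hd, hg, hH, hHx, h1⟩ := c.exists_eq_coord_div
        (h.notMem_torusIdentity (hX.mpr rfl)) a
      obtain ⟨u, h2, h3⟩ := c.exists_stalk_coord_div hd hg hH hHx
      have hH0 : coord m p q s H ≠ 0 := c.coord_ne_zero hH (by
        rintro rfl
        exact hHx (zero_mem _))
      have h4 : a = u := hinj (mul_right_cancel₀ hH0 (h1.trans h2.symm))
      have h5 : g ∈ (π (o y)).asHomogeneousIdeal := by
        by_contra h6
        exact ha (h4 ▸ h3.mpr h6)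
      obtain ⟨g', rfl⟩ := (hmem g).mp h5
      have hg0 : g' ≠ 0 := by
        rintro rfl
        rw [mul_zero, map_zero, mul_eq_zero, or_iff_left hH0] at h1
        exact ha0 ((map_eq_zero_iff _ hinj).mp h1)
      obtain ⟨d', hd', hg'⟩ := isWeightedHomogeneous_of_X_mul hg hg0
      obtain ⟨u', h6, -⟩ := c.exists_stalk_coord (x := o y) hg' hH hHx
        (e := Pi.single i 1 - v.1) (by
          simp only [Pi.sub_apply, sub_mul, Finset.sum_sub_distrib, hv0]
          simp only [Pi.single_apply, ite_mul, one_mul, zero_mul, Finset.sum_ite_eq',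
            Finset.mem_univ, if_true, sub_zero]
          exact_mod_cast hd')
        (fun j hj => by rw [hX.mp hj, Pi.sub_apply, Pi.single_eq_same, hv, sub_self])
      rw [Ideal.mem_span_singleton]
      refine ⟨u', hinj (mul_right_cancel₀ hH0 ?_)⟩
      rw [map_mul, h1, hϖ, mul_assoc, h6, coordMonomial_sub, coordMonomial_single, map_mul]
      have := coordMonomial_ne_zero (m := m) (p := p) (q := q) (s := s) v.1
      field_simp
    · rw [Ideal.span_singleton_le_iff_mem]
      intro h1
      have h2 := (hϖ'.mp h1).2 i (hX.mpr rfl)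
      rw [hv] at h2
      exact one_ne_zero h2
  obtain ⟨h1, h2⟩ := coheight_and_ord_of_maximalIdeal hϖ0 hmax
  refine ⟨⟨o y, h1⟩, hmem, fun e => ?_⟩
  rw [hϖ] at h2
  have he0 := mem_zeroWeight.mp e.2
  have h3 : e.1 = e.1 i • v.1 + (e.1 - e.1 i • v.1) := (add_sub_cancel _ _).symm
  have h4 : Scheme.ord (coordMonomial m p q s (e.1 - e.1 i • v.1)) (o y) = 0 := by
    have := c.ord_coord_eq_zero (x := o y) (isWeightedHomogeneous_one k w) hone
      (e := e.1 - e.1 i • v.1) (by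
        simp only [Pi.sub_apply, Pi.smul_apply, smul_eq_mul, sub_mul, Finset.sum_sub_distrib, he0,
          mul_assoc, ← Finset.mul_sum, hv0]
        simp)
      (fun j hj => by
        rw [hX.mp hj, Pi.sub_apply, Pi.smul_apply, hv, smul_eq_mul, mul_one, sub_self])
    rwa [map_one, one_mul] at this
  change Scheme.ord _ (o y) = _
  conv_lhs => rw [h3]
  rw [coordMonomial_add, Scheme.ord_mul (coordMonomial_ne_zero _) (coordMonomial_ne_zero _), h4,
    coordMonomial_zsmul, ord_zpow _ (coordMonomial_ne_zero _), h2, mul_one, add_zero]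

end IsBlowupCover

end CoordinateDivisors

/-! ### Prime elements of the ring of a chart -/

section ChartPrimes

open Polynomial

variable {k : Type u} [Field k]

lemma exists_mul_pow_eq_algebraMap (b : ChartRing k) :
    ∃ (n : ℕ) (g : k[X][X]), b * (chartX k * (1 + (chartX k - 1) * chartU k)) ^ n =
      algebraMap k[X][X] (ChartRing k) g := by
  obtain ⟨n, g, hg⟩ := IsLocalization.Away.surj (X * (1 + (X - 1) * C X) : k[X][X]) b
  refine ⟨n, g, ?_⟩
  rw [← hg]
  simp

lemma isUnit_chartX_mul_pow (n : ℕ) :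
    IsUnit ((chartX k * (1 + (chartX k - 1) * chartU k)) ^ n) :=
  (isUnit_chartX.mul isUnit_chartY).pow n

/-- Inverting `X` and `Y` does not affect divisibility by powers of other primes. -/
lemma pow_dvd_of_algebraMap_chartRing_pow_dvd {f g : k[X][X]} (hf : Prime f)
    (hf' : ¬ f ∣ X * (1 + (X - 1) * C X)) {N : ℕ}
    (h : algebraMap k[X][X] (ChartRing k) f ^ N ∣ algebraMap k[X][X] (ChartRing k) g) :
    f ^ N ∣ g := by
  obtain ⟨b, hb⟩ := h
  obtain ⟨n, b', hb'⟩ := exists_mul_pow_eq_algebraMap b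
  have h1 : algebraMap k[X][X] (ChartRing k) (g * (X * (1 + (X - 1) * C X)) ^ n) =
      algebraMap k[X][X] (ChartRing k) (f ^ N * b') := by
    rw [map_mul, map_mul, map_pow _ f, hb, ← hb']
    simp
    ring
  have h2 := algebraMap_chartRing_injective h1
  exact hf.pow_dvd_of_dvd_mul_right N (fun h3 => hf' (hf.dvd_of_dvd_pow h3)) ⟨b', h2⟩

lemma dvd_of_algebraMap_chartRing_dvd {f g : k[X][X]} (hf : Prime f)
    (hf' : ¬ f ∣ X * (1 + (X - 1) * C X))
    (h : algebraMap k[X][X] (ChartRing k) f ∣ algebraMap k[X][X] (ChartRing k) g) : f ∣ g := by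
  rw [← pow_one f]
  exact pow_dvd_of_algebraMap_chartRing_pow_dvd hf hf' (by rwa [pow_one])

lemma prime_algebraMap_chartRing {f : k[X][X]} (hf : Prime f)
    (hf' : ¬ f ∣ X * (1 + (X - 1) * C X)) : Prime (algebraMap k[X][X] (ChartRing k) f) := by
  refine ⟨(map_ne_zero_iff _ algebraMap_chartRing_injective).mpr hf.ne_zero, fun h => ?_,
    fun a b hab => ?_⟩
  · refine hf.not_isUnit (isUnit_of_dvd_one (dvd_of_algebraMap_chartRing_dvd hf hf' ?_))
    exact h.dvd
  · obtain ⟨n, a', ha'⟩ := exists_mul_pow_eq_algebraMap a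
    obtain ⟨n', b', hb'⟩ := exists_mul_pow_eq_algebraMap b
    rw [← (isUnit_chartX_mul_pow n).dvd_mul_right (b := a), ha',
      ← (isUnit_chartX_mul_pow n').dvd_mul_right (b := b), hb']
    refine (hf.dvd_or_dvd (dvd_of_algebraMap_chartRing_dvd hf hf' ?_)).imp (map_dvd _) (map_dvd _)
    rw [map_mul, ← ha', ← hb', mul_mul_mul_comm]
    exact hab.mul_right _

lemma not_X_sub_one_dvd : ¬ (X - 1 : k[X][X]) ∣ X * (1 + (X - 1) * C X) := by
  intro h
  obtain h | h := prime_X_sub_one.dvd_or_dvd h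
  · exact not_X_sub_one_dvd_X h
  · exact prime_X_sub_one.not_isUnit (isUnit_of_dvd_one
      ((dvd_add_left (dvd_mul_right _ _)).mp h))

lemma not_C_X_dvd : ¬ (C X : k[X][X]) ∣ X * (1 + (X - 1) * C X) := by
  intro h
  obtain ⟨g, hg⟩ | h := prime_C_X.dvd_or_dvd h
  · have := congr_arg (map (evalRingHom 0)) hg
    rw [Polynomial.map_mul, map_C, coe_evalRingHom, eval_X, C_0, zero_mul, map_X] at this
    exact X_ne_zero this
  · exact prime_C_X.not_isUnit (isUnit_of_dvd_one ((dvd_add_left (dvd_mul_left _ _)).mp h))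

lemma algebraMap_X_sub_one : algebraMap k[X][X] (ChartRing k) (X - 1) = chartX k - 1 := by
  rw [map_sub, map_one]

lemma prime_chartX_sub_one : Prime (chartX k - 1) :=
  algebraMap_X_sub_one (k := k) ▸ prime_algebraMap_chartRing prime_X_sub_one not_X_sub_one_dvd

lemma prime_chartU : Prime (chartU k) := prime_algebraMap_chartRing prime_C_X not_C_X_dvd

lemma not_X_sub_one_dvd_C_X : ¬ (X - 1 : k[X][X]) ∣ C X := by
  rintro ⟨g, hg⟩
  have := congr_arg (eval 1) hg
  rw [eval_mul, eval_sub, eval_X, eval_one, sub_self, zero_mul, eval_C] at this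
  exact X_ne_zero this

lemma not_chartX_sub_one_dvd_chartU : ¬ chartX k - 1 ∣ chartU k := by
  intro h
  rw [← algebraMap_X_sub_one] at h
  exact not_X_sub_one_dvd_C_X (dvd_of_algebraMap_chartRing_dvd prime_X_sub_one not_X_sub_one_dvd h)

lemma not_chartU_dvd_chartX_sub_one : ¬ chartU k ∣ chartX k - 1 := by
  intro h
  rw [← algebraMap_X_sub_one] at h
  exact not_C_X_dvd_X_sub_one (dvd_of_algebraMap_chartRing_dvd prime_C_X not_C_X_dvd h)

/-- The generic point of the locus where a prime element vanishes. -/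
noncomputable def primePoint {R : Type u} [CommRing R] {ϖ : R} (hϖ : Prime ϖ) : Spec (.of R) :=
  ⟨Ideal.span {ϖ}, (Ideal.span_singleton_prime hϖ.ne_zero).mpr hϖ⟩

lemma primePoint_asIdeal {R : Type u} [CommRing R] {ϖ : R} (hϖ : Prime ϖ) :
    (primePoint hϖ).asIdeal = Ideal.span {ϖ} := rfl

lemma mem_primePoint {R : Type u} [CommRing R] {ϖ r : R} (hϖ : Prime ϖ) :
    r ∈ (primePoint hϖ).asIdeal ↔ ϖ ∣ r := Ideal.mem_span_singleton

lemma primePoint_specializes {R : Type u} [CommRing R] {ϖ : R} (hϖ : Prime ϖ) {z : Spec (.of R)}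
    (hz : ϖ ∈ z.asIdeal) : primePoint hϖ ⤳ z := by
  rw [specializes_iff_mem_closure]
  exact (PrimeSpectrum.le_iff_mem_closure (primePoint hϖ) z).mp
    ((Ideal.span_singleton_le_iff_mem _).mpr hz)

end ChartPrimes

/-! ### Prime divisors of the blow-up -/

section PrimeDivisors

open MvPolynomial

variable {k : Type u} [Field k] {m p q : ℕ} {w : Fin 3 → ℕ}
  {h : IsTriple m (w 0) (w 1) (w 2) p q} {Y : Scheme.{u}} {π : Y ⟶ weightedPlane k w}
  {s t : Spec (.of (ChartRing k)) ⟶ Y} {o : (identityCompl k w).toScheme ⟶ Y}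
  [IsOpenImmersion s] [IsOpenImmersion t] [IsOpenImmersion o]

lemma IsTriple.mem_torusι_comap_iff (h : IsTriple m (w 0) (w 1) (w 2) p q) {R : Type u} [CommRing R]
    (κ : MvPolynomial (Fin 3) k →+* R) (hκ : ∀ i, IsUnit (κ (X i))) {g : MvPolynomial (Fin 3) k}
    {d : ℕ} (hg : g.IsWeightedHomogeneous w d) (z : Spec (.of R)) :
    g ∈ (h.torusι k (Spec.map (CommRingCat.ofHom (torusLift w κ hκ)) z)).asHomogeneousIdeal ↔
      κ g ∈ z.asIdeal := by
  set N := ∑ i, w i with hN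
  have h1 : g ^ N ∈ weightedHomogeneousSubmodule k w (d • N) := by
    rw [mem_weightedHomogeneousSubmodule, smul_eq_mul, mul_comm]
    exact hg.pow N
  set x := h.torusι k (Spec.map (CommRingCat.ofHom (torusLift w κ hκ)) z)
  have h2 : g ∈ x.asHomogeneousIdeal ↔ g ^ N ∈ x.asHomogeneousIdeal :=
    ⟨fun h' => Ideal.pow_mem_of_mem _ h' _ h.sum_pos, x.isPrime.mem_of_pow_mem N⟩
  rw [h2, mem_awayι_apply_iff _ coordProd_mem h.sum_pos h1]
  have h3 := awayLift_mk_mul κ (isUnit_coordProd κ hκ) coordProd_mem d (g ^ N) h1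
  have h4 : κ g ∈ z.asIdeal ↔ κ g ^ N ∈ z.asIdeal :=
    ⟨fun h' => Ideal.pow_mem_of_mem _ h' _ h.sum_pos, z.isPrime.mem_of_pow_mem N⟩
  rw [h4, ← map_pow, ← h3,
    Ideal.mul_unit_mem_iff_mem _ ((isUnit_coordProd κ hκ).pow d)]
  rfl

/-- The image of `y³ - xᵐzᵐ` is a monomial times `Y - 1`. -/
lemma IsTriple.theta_curve (h : IsTriple m (w 0) (w 1) (w 2) p q) {R : Type*} [CommRing R]
    (ι : k →+* R) (u v : R) :
    theta m p q ι u v (X 1 ^ 3 - X 0 ^ m * X 2 ^ m) = u ^ (15 * m) * v ^ (m * p) * (v - 1) := by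
  rw [map_sub, map_mul, map_pow, map_pow, map_pow, theta_X_zero, theta_X_one, theta_X_two]
  have h1 : (u ^ (5 * m) * v ^ q) ^ 3 = u ^ (15 * m) * v ^ (m * p) * v := by
    rw [mul_pow, ← pow_mul, ← pow_mul, mul_assoc (u ^ _), ← pow_succ, ← h.hpq]
    congr 2 <;> ring
  have h2 : (u ^ 7 * v ^ p) ^ m * (u ^ 8) ^ m = u ^ (15 * m) * v ^ (m * p) := by
    rw [mul_pow, ← pow_mul, ← pow_mul, ← pow_mul, mul_right_comm, ← pow_add]
    congr 2 <;> ring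
  rw [h1, h2]
  ring

lemma IsTriple.isWeightedHomogeneous_curve (h : IsTriple m (w 0) (w 1) (w 2) p q) :
    (X 1 ^ 3 - X 0 ^ m * X 2 ^ m : MvPolynomial (Fin 3) k).IsWeightedHomogeneous w (3 * w 1) := by
  refine (weightedHomogeneousSubmodule k w _).sub_mem
    ((isWeightedHomogeneous_X k w 1).pow 3) ?_
  have h1 := ((isWeightedHomogeneous_X k w 0).pow m).mul ((isWeightedHomogeneous_X k w 2).pow m)
  rwa [smul_eq_mul, smul_eq_mul, ← mul_add, ← h.three_mul_b] at h1

variable (π) in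
/-- The proper transform of the curve `y³ = xᵐzᵐ`. -/
noncomputable def curve (m : ℕ) : Closeds Y :=
  properTransform π (zeroLocus w {X 1 ^ 3 - X 0 ^ m * X 2 ^ m})

lemma mem_zeroLocus_singleton {g : MvPolynomial (Fin 3) k} {x : weightedPlane k w} :
    x ∈ zeroLocus w {g} ↔ g ∈ x.asHomogeneousIdeal := by
  rw [mem_zeroLocus]
  simp

lemma mem_of_mem_curve {x : Y} (hx : x ∈ curve π m) :
    X 1 ^ 3 - X 0 ^ m * X 2 ^ m ∈ (π x).asHomogeneousIdeal := by
  rw [← mem_zeroLocus_singleton]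
  have h1 : curve π m ≤ preimage π (zeroLocus w {X 1 ^ 3 - X 0 ^ m * X 2 ^ m}) :=
    Closeds.closure_le.mpr fun y hy => hy.1
  exact h1 hx

lemma exists_mem_of_mem_curve {x : Y} (hx : x ∈ curve π m) {U : Set Y} (hU : IsOpen U)
    (hxU : x ∈ U) : ∃ y ∈ U, X 1 ^ 3 - X 0 ^ m * X 2 ^ m ∈ (π y).asHomogeneousIdeal ∧
      π y ∉ torusIdentity k w := by
  obtain ⟨y, hy, hy'⟩ := mem_closure_iff.mp hx U hU hxU
  exact ⟨y, hy, mem_zeroLocus_singleton.mp hy'.1, hy'.2⟩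

open Classical in
lemma divisorOfClosed_apply {Z : Closeds Y} {x : PrimeDivisor Y}
    (hx : ∀ y : PrimeDivisor Y, y.1 ∈ Z ↔ y = x) (y : PrimeDivisor Y) :
    divisorOfClosed Z y = if y.1 ∈ Z then 1 else 0 := by
  have h1 : {y : PrimeDivisor Y | y.1 ∈ Z} = {x} := Set.ext hx
  rw [divisorOfClosed, h1, finsum_mem_singleton, Finsupp.single_apply]
  simp only [hx, eq_comm]

namespace IsBlowupCover

variable (c : IsBlowupCover h π s t o)
include c

lemma mem_chart_iff {g : MvPolynomial (Fin 3) k} {d : ℕ} (hg : g.IsWeightedHomogeneous w d) (z) :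
    g ∈ (π (s z)).asHomogeneousIdeal ↔ chartTheta k m p q g ∈ z.asIdeal := by
  rw [← Scheme.Hom.comp_apply, c.chart_comp, Scheme.Hom.comp_apply]
  exact h.mem_torusι_comap_iff (chartTheta k m p q) isUnit_chartTheta hg z

lemma mem_chart'_iff {g : MvPolynomial (Fin 3) k} {d : ℕ} (hg : g.IsWeightedHomogeneous w d) (z) :
    g ∈ (π (t z)).asHomogeneousIdeal ↔ chartTheta' k m p q g ∈ z.asIdeal := by
  rw [← Scheme.Hom.comp_apply, c.chart'_comp, Scheme.Hom.comp_apply]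
  exact h.mem_torusι_comap_iff (chartTheta' k m p q) isUnit_chartTheta' hg z

lemma curve_mem_chart_iff (z) :
    X 1 ^ 3 - X 0 ^ m * X 2 ^ m ∈ (π (s z)).asHomogeneousIdeal ↔
      (chartX k - 1) * chartU k ∈ z.asIdeal := by
  rw [c.mem_chart_iff h.isWeightedHomogeneous_curve, chartTheta, h.theta_curve,
    Ideal.unit_mul_mem_iff_mem _ ((isUnit_chartX.pow _).mul (isUnit_chartY.pow _)),
    add_sub_cancel_left]

lemma curve_mem_chart'_iff (z) :
    X 1 ^ 3 - X 0 ^ m * X 2 ^ m ∈ (π (t z)).asHomogeneousIdeal ↔ chartX k - 1 ∈ z.asIdeal := by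
  rw [c.mem_chart'_iff h.isWeightedHomogeneous_curve, chartTheta', h.theta_curve,
    Ideal.unit_mul_mem_iff_mem _ ((isUnit_chartY.pow _).mul (isUnit_chartX.pow _))]

/-- Near the exceptional divisor, the proper transform of `y³ = xᵐzᵐ` is the curve `U = 0` in the
first chart. -/
lemma exists_chart_of_mem_curve {x : Y} (hx : x ∈ curve π m) (hx' : π x ∈ torusIdentity k w) :
    ∃ z, x = s z ∧ chartU k ∈ z.asIdeal := by
  obtain ⟨z, rfl⟩ | ⟨z, rfl⟩ := c.mem_range_or x hx'
  · refine ⟨z, rfl, ?_⟩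
    by_contra hz
    have hz' : z ∈ PrimeSpectrum.basicOpen (chartU k) := hz
    obtain ⟨_, ⟨z', hz', rfl⟩, h1, h2⟩ := exists_mem_of_mem_curve hx
      (s.isOpenEmbedding.isOpenMap _ (PrimeSpectrum.basicOpen (chartU k)).isOpen) ⟨z, hz', rfl⟩
    rw [c.curve_mem_chart_iff] at h1
    rw [c.chart_mem_torusIdentity_iff] at h2
    exact (z'.isPrime.mem_or_mem h1).elim h2 hz'
  · obtain ⟨_, ⟨z', rfl⟩, h1, h2⟩ := exists_mem_of_mem_curve hx t.opensRange.isOpen ⟨z, rfl⟩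
    rw [c.curve_mem_chart'_iff] at h1
    rw [c.chart'_mem_torusIdentity_iff] at h2
    exact absurd h1 h2

lemma chart_mem_curve {z} (hz : chartU k ∈ z.asIdeal) (hz' : chartX k - 1 ∉ z.asIdeal) :
    s z ∈ curve π m :=
  subset_closure ⟨mem_zeroLocus_singleton.mpr ((c.curve_mem_chart_iff z).mpr
    (Ideal.mul_mem_left _ _ hz)), (c.chart_mem_torusIdentity_iff z).not.mpr hz'⟩

lemma specializes_of_le {x y : Y} (hx : π x ∉ torusIdentity k w) (hy : π y ∉ torusIdentity k w)
    (hxy : (π x).asHomogeneousIdeal ≤ (π y).asHomogeneousIdeal) : x ⤳ y := by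
  obtain ⟨x, rfl⟩ := (c.mem_range_compl_iff x).mpr hx
  obtain ⟨y, rfl⟩ := (c.mem_range_compl_iff y).mpr hy
  refine Specializes.map ?_ o.continuous
  rw [← (identityCompl k w).ι.isOpenEmbedding.isInducing.specializes_iff, ← c.compl_comp,
    Scheme.Hom.comp_apply, Scheme.Hom.comp_apply, specializes_iff_mem_closure]
  exact (ProjectiveSpectrum.le_iff_mem_closure _ _ _).mp hxy

variable [IsIntegral Y]

/-- The `i`-th coordinate vanishes along one prime divisor only. -/
lemma eq_of_X_mem {i : Fin 3} {x y : PrimeDivisor Y}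
    (hx : ∀ g, g ∈ (π x.1).asHomogeneousIdeal ↔ X i ∣ g)
    (hy : X i ∈ (π y.1).asHomogeneousIdeal) : y = x := by
  refine (Subtype.ext (eq_of_specializes x.2 y.2 (c.specializes_of_le
    (h.notMem_torusIdentity ((hx _).mpr dvd_rfl)) (h.notMem_torusIdentity hy) fun g hg => ?_))).symm
  exact Ideal.mem_of_dvd _ ((hx g).mp hg) hy

variable [IsLocallyNoetherian Y]

/-- The exceptional curve is a prime divisor, and the only one that lies over the identity of the
torus. -/
lemma exists_exceptional : ∃ x : PrimeDivisor Y, x.1 = s (primePoint prime_chartX_sub_one) ∧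
    ∀ y : PrimeDivisor Y, π y.1 ∈ torusIdentity k w ↔ y = x := by
  have hs := coheight_and_ord_of_span s prime_chartX_sub_one.ne_zero
    (primePoint_asIdeal prime_chartX_sub_one)
  have ht := coheight_and_ord_of_span t prime_chartX_sub_one.ne_zero
    (primePoint_asIdeal prime_chartX_sub_one)
  have key {z} (hy : Order.coheight (s z) = 1) (hy' : π (s z) ∈ torusIdentity k w) :
      s z = s (primePoint prime_chartX_sub_one) := by
    rw [c.chart_mem_torusIdentity_iff] at hy'
    exact (eq_of_specializes hs.1 hy
      ((primePoint_specializes _ hy').map s.continuous)).symm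
  refine ⟨⟨_, hs.1⟩, rfl, fun ⟨y, hy⟩ => ⟨fun hy' => Subtype.ext ?_, ?_⟩⟩
  · obtain ⟨z, rfl⟩ | ⟨z, rfl⟩ := c.mem_range_or y hy'
    · exact key hy hy'
    · have h1 := hy'
      rw [c.chart'_mem_torusIdentity_iff] at h1
      have h2 : t z = t (primePoint prime_chartX_sub_one) := (eq_of_specializes ht.1 hy
        ((primePoint_specializes _ h1).map t.continuous)).symm
      obtain ⟨z', hz'⟩ := c.chart'_mem_range (primePoint prime_chartX_sub_one)
        (fun h3 => not_chartX_sub_one_dvd_chartU ((mem_primePoint _).mp h3))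
      have h3 : s z' = t z := hz'.trans h2.symm
      exact h3.symm.trans (key (h3 ▸ hy) (h3 ▸ hy'))
  · intro h1
    rw [h1, c.chart_mem_torusIdentity_iff, mem_primePoint]

open Classical in
lemma divisorOfClosed_coord_apply (i : Fin 3) (y : PrimeDivisor Y) :
    divisorOfClosed (preimage π (zeroLocus w {X i})) y =
      if X i ∈ (π y.1).asHomogeneousIdeal then 1 else 0 := by
  obtain ⟨x, hx, -⟩ := c.exists_coordDivisor i
  have h1 (y : PrimeDivisor Y) : y.1 ∈ preimage π (zeroLocus w {X i}) ↔
      X i ∈ (π y.1).asHomogeneousIdeal := mem_zeroLocus_singleton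
  rw [divisorOfClosed_apply (x := x)]
  · simp only [h1]
  · refine fun y => (h1 y).trans ⟨fun hy => c.eq_of_X_mem hx hy, ?_⟩
    rintro rfl
    exact (hx _).mpr dvd_rfl

open Classical in
lemma exceptionalDivisor_apply (y : PrimeDivisor Y) :
    exceptionalDivisor π y = if π y.1 ∈ torusIdentity k w then 1 else 0 := by
  obtain ⟨x, -, hx⟩ := c.exists_exceptional
  exact divisorOfClosed_apply hx y

/-- The coefficients of `n A - l E` along the coordinate divisors. -/
lemma divisor_apply_of_X_mem (n l : ℤ) (r : Fin 3 → ℤ) {i : Fin 3} {y : PrimeDivisor Y}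
    (hy : X i ∈ (π y.1).asHomogeneousIdeal) :
    (n • divisorA π r - l • exceptionalDivisor π) y = n * r i := by
  obtain ⟨x, hx, -⟩ := c.exists_coordDivisor i
  obtain rfl := c.eq_of_X_mem hx hy
  have h1 (j : Fin 3) : X j ∈ (π y.1).asHomogeneousIdeal ↔ i = j := by
    rw [hx, X_dvd_X]
  simp [divisorA, c.divisorOfClosed_coord_apply, c.exceptionalDivisor_apply, h1,
    h.notMem_torusIdentity hy]

lemma divisor_apply_of_mem (n l : ℤ) (r : Fin 3 → ℤ) {y : PrimeDivisor Y}
    (hy : π y.1 ∈ torusIdentity k w) :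
    (n • divisorA π r - l • exceptionalDivisor π) y = -l := by
  have h1 (j : Fin 3) : X j ∉ (π y.1).asHomogeneousIdeal := fun hj => h.notMem_torusIdentity hj hy
  simp [divisorA, c.divisorOfClosed_coord_apply, c.exceptionalDivisor_apply, h1, hy]

lemma divisor_apply_of_notMem (n l : ℤ) (r : Fin 3 → ℤ) {y : PrimeDivisor Y}
    (hy : π y.1 ∉ torusIdentity k w) (hy' : ∀ i, X i ∉ (π y.1).asHomogeneousIdeal) :
    (n • divisorA π r - l • exceptionalDivisor π) y = 0 := by
  simp [divisorA, c.divisorOfClosed_coord_apply, c.exceptionalDivisor_apply, hy', hy]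

end IsBlowupCover

end PrimeDivisors

/-! ### Laurent polynomials on the charts -/

section LaurentPolynomials

open Polynomial

variable {k : Type u} [Field k]

/-- Over the fraction field of `k[X, Y]`, the substitution `Y = 1 + (X - 1)U` is inverted by
`U = (Y - 1) / (X - 1)`. -/
lemma blowupSubst_injective : Function.Injective (blowupSubst k) := by
  let F := FractionRing k[X][X]
  let φ := algebraMap k[X][X] F
  have hφ : Function.Injective φ := IsFractionRing.injective _ _
  let ψ : k[X][X] →+* F := eval₂RingHom (eval₂RingHom (φ.comp (C.comp C))
    ((φ (C X) - 1) / (φ X - 1))) (φ X)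
  have h0 : φ X - 1 ≠ 0 := by
    rw [← map_one φ, ← map_sub]
    exact (map_ne_zero_iff _ hφ).mpr prime_X_sub_one.ne_zero
  have h1 : ψ.comp (blowupSubst k) = φ := by
    refine Polynomial.ringHom_ext' (Polynomial.ringHom_ext' ?_ ?_) ?_
    · ext r : 1
      simp [ψ]
    · simp [ψ, mul_div_cancel₀ _ h0]
    · simp [ψ]
  have h2 : Function.Injective (ψ.comp (blowupSubst k)) := h1 ▸ hφ
  rw [RingHom.coe_comp] at h2
  exact h2.of_comp

/-- Since `(X - 1)U = Y - 1`, the functions on the chart are polynomials in `X` and `Y` up to powers of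
`X - 1`. -/
lemma exists_pow_mul_eq_blowupSubst (g : k[X][X]) :
    ∃ (N : ℕ) (G : k[X][X]), (X - 1) ^ N * g = blowupSubst k G := by
  have hadd {g g' : k[X][X]} (h : ∃ (N : ℕ) (G : k[X][X]), (X - 1) ^ N * g = blowupSubst k G)
      (h' : ∃ (N : ℕ) (G : k[X][X]), (X - 1) ^ N * g' = blowupSubst k G) :
      ∃ (N : ℕ) (G : k[X][X]), (X - 1) ^ N * (g + g') = blowupSubst k G := by
    obtain ⟨N, G, h⟩ := h
    obtain ⟨N', G', h'⟩ := h'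
    refine ⟨N + N', (X - 1) ^ N' * G + (X - 1) ^ N * G', ?_⟩
    simp only [map_add, map_mul, map_pow, map_sub, map_one, blowupSubst_X, ← h, ← h']
    ring
  induction g using Polynomial.induction_on' with
  | add g g' h h' => exact hadd h h'
  | monomial i a =>
    induction a using Polynomial.induction_on' with
    | add a a' h h' =>
      rw [map_add]
      exact hadd h h'
    | monomial j r =>
      refine ⟨j, C (C r) * (C X - 1) ^ j * X ^ i, ?_⟩
      simp only [map_mul, map_pow, map_sub, map_one, blowupSubst_X, blowupSubst_C_X,
        blowupSubst_C_C, add_sub_cancel_left, mul_pow, ← C_mul_X_pow_eq_monomial]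
      ring

lemma exists_mul_eq_algebraMap_blowupSubst (b : ChartRing k) :
    ∃ (n N : ℕ) (G : k[X][X]),
      b * (chartX k * (1 + (chartX k - 1) * chartU k)) ^ n * (chartX k - 1) ^ N =
        algebraMap k[X][X] (ChartRing k) (blowupSubst k G) := by
  obtain ⟨n, g, hg⟩ := exists_mul_pow_eq_algebraMap b
  obtain ⟨N, G, hG⟩ := exists_pow_mul_eq_blowupSubst g
  refine ⟨n, N, G, ?_⟩
  rw [← hG, hg, map_mul, map_pow, algebraMap_X_sub_one, mul_comm]

lemma not_X_sub_one_dvd_C_X_sub_one : ¬ (X - 1 : k[X][X]) ∣ C X - 1 := by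
  rintro ⟨g, hg⟩
  have := congr_arg (eval 1) hg
  rw [eval_mul, eval_sub, eval_sub, eval_X, eval_one, sub_self, zero_mul, eval_C] at this
  exact X_sub_C_ne_zero (1 : k) (by rw [C_1]; exact this)

end LaurentPolynomials

/-! ### Rational functions that are regular on both charts -/

section TorusFunctions

variable {k : Type u} [Field k] {m p q : ℕ} {w : Fin 3 → ℕ}
  {h : IsTriple m (w 0) (w 1) (w 2) p q} {Y : Scheme.{u}} {π : Y ⟶ weightedPlane k w}
  {s t : Spec (.of (ChartRing k)) ⟶ Y} {o : (identityCompl k w).toScheme ⟶ Y}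
  [IsOpenImmersion s] [IsOpenImmersion t] [IsOpenImmersion o] [IsIntegral Y]

namespace IsBlowupCover

open Polynomial

variable (c : IsBlowupCover h π s t o)
include c

/-- On the torus, the two charts of the blow-up give the same rational functions. -/
lemma torusLift_coord' : torusLift w (coord m p q s) isUnit_coord_X =
    (chartFun t).comp (chartHom' k w m p q) := by
  refine stalk_factor_unique (g := π) (j := h.torusι k) (q := genericPoint Y)
    c.isPullbackHom_torus ?_
  rw [CommRingCat.ofHom_comp, Spec.map_comp, Category.assoc,
    ← c.chart'_comp, ← Category.assoc, isPullbackHom_chartFun t, Category.comp_id]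

/-- A rational function that is regular on both charts of the blow-up is a Laurent polynomial in `X`
and `Y`: it can have only powers of `X - 1` in the denominator, by the first chart, and only powers of
`Y - 1`, by the second. -/
lemma exists_eq_torusLift {f : Y.functionField} {b b' : ChartRing k} (hs : f = chartFun s b)
    (ht : f = chartFun t b') : ∃ a, f = torusLift w (coord m p q s) isUnit_coord_X a := by
  set φ := torusLift w (coord m p q s) isUnit_coord_X
  have hφs : φ = (chartFun s).comp (chartHom k w m p q) := torusLift_coord
  have hφt : φ = (chartFun t).comp (chartHom' k w m p q) := c.torusLift_coord'
  let x : TorusRing k w := torusMonomial (exponentX w p q)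
  let y : TorusRing k w := torusMonomial h.exponentY
  let τ : k[X][X] →+* TorusRing k w := eval₂RingHom (eval₂RingHom (torusConst k w) y) x
  let swap : k[X][X] →+* k[X][X] := eval₂RingHom (eval₂RingHom (C.comp C) X) (C X)
  have hxs : φ x = chartFun s (chartX k) := by
    rw [hφs, RingHom.comp_apply, h.chartHom_exponentX]
  have hys : φ y = chartFun s (1 + (chartX k - 1) * chartU k) := by
    rw [hφs, RingHom.comp_apply, h.chartHom_exponentY]
  have hxt : φ x = chartFun t (1 + (chartX k - 1) * chartU k) := by
    rw [hφt, RingHom.comp_apply, h.chartHom'_exponentX]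
  have hyt : φ y = chartFun t (chartX k) := by
    rw [hφt, RingHom.comp_apply, h.chartHom'_exponentY]
  have hτX : τ X = x := by simp [τ]
  have hτC : τ (C X) = y := by simp [τ]
  have hτs (G : k[X][X]) : φ (τ G) =
      chartFun s (algebraMap k[X][X] (ChartRing k) (blowupSubst k G)) := by
    refine DFunLike.congr_fun (f := φ.comp τ) (g := ((chartFun s).comp
      (algebraMap k[X][X] (ChartRing k))).comp (blowupSubst k)) ?_ G
    refine Polynomial.ringHom_ext' (Polynomial.ringHom_ext' ?_ ?_) ?_
    · ext r
      have := DFunLike.congr_fun (chartHom_comp_torusConst (k := k) (w := w) (m := m) (p := p)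
        (q := q)) r
      rw [RingHom.comp_apply] at this
      simp [τ, hφs, this]
    · simp [τ, hys]
    · simp [τ, hxs]
  have hτt (G : k[X][X]) : φ (τ (swap G)) =
      chartFun t (algebraMap k[X][X] (ChartRing k) (blowupSubst k G)) := by
    refine DFunLike.congr_fun (f := (φ.comp τ).comp swap) (g := ((chartFun t).comp
      (algebraMap k[X][X] (ChartRing k))).comp (blowupSubst k)) ?_ G
    refine Polynomial.ringHom_ext' (Polynomial.ringHom_ext' ?_ ?_) ?_
    · ext r
      have := DFunLike.congr_fun (chartHom'_comp_torusConst (k := k) (w := w) (m := m) (p := p)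
        (q := q)) r
      rw [RingHom.comp_apply] at this
      simp [τ, swap, hφt, this]
    · simp [τ, swap, hxt]
    · simp [τ, swap, hyt]
  have hinj : Function.Injective (φ.comp τ) := by
    have : (φ.comp τ : k[X][X] → _) = chartFun s ∘ algebraMap k[X][X] (ChartRing k) ∘
      blowupSubst k := funext hτs
    rw [this]
    exact (chartFun_injective s).comp (algebraMap_chartRing_injective.comp blowupSubst_injective)
  obtain ⟨n, N, G, hG⟩ := exists_mul_eq_algebraMap_blowupSubst b
  obtain ⟨n', N', G', hG'⟩ := exists_mul_eq_algebraMap_blowupSubst b'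
  replace hG := congr_arg (chartFun s) hG
  replace hG' := congr_arg (chartFun t) hG'
  rw [← hτs, map_mul, map_mul, map_pow, map_mul, map_pow, map_sub, map_one, ← hxs, ← hys,
    ← hs] at hG
  rw [← hτt, map_mul, map_mul, map_pow, map_mul, map_pow, map_sub, map_one, ← hxt, ← hyt,
    ← ht] at hG'
  -- compare the two expressions for `f`, which have the denominators `(X - 1)ᴺ` and `(Y - 1)ᴺ'`
  have h1 : (X - 1) ^ N * ((X * C X) ^ n * swap G') =
      G * ((X * C X) ^ n' * (C X - 1) ^ N') := by
    apply hinj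
    simp only [RingHom.comp_apply, map_mul, map_pow, map_sub, map_one, hτX, hτC, ← hG, ← hG']
    ring
  have h2 : ¬ (X - 1 : k[X][X]) ∣ (X * C X) ^ n' * (C X - 1) ^ N' := by
    intro h3
    obtain h3 | h3 := prime_X_sub_one.dvd_or_dvd h3
    · obtain h3 | h3 := prime_X_sub_one.dvd_or_dvd (prime_X_sub_one.dvd_of_dvd_pow h3)
      · exact not_X_sub_one_dvd_X h3
      · exact not_X_sub_one_dvd_C_X h3
    · exact not_X_sub_one_dvd_C_X_sub_one (prime_X_sub_one.dvd_of_dvd_pow h3)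
  obtain ⟨G₁, rfl⟩ := prime_X_sub_one.pow_dvd_of_dvd_mul_right N h2 ⟨_, h1.symm⟩
  have h3 : φ x - 1 ≠ 0 := by
    rw [hxs, ← map_one (chartFun s), ← map_sub]
    exact (map_ne_zero_iff _ (chartFun_injective s)).mpr chartX_sub_one_ne_zero
  have h4 : f * (φ y * φ x) ^ n = φ (τ G₁) := by
    refine mul_right_cancel₀ (pow_ne_zero N h3) ?_
    rw [mul_comm (φ y), hG]
    simp only [map_mul, map_pow, map_sub, map_one, hτX]
    ring
  obtain ⟨v, hv⟩ := ((isUnit_torusMonomial h.exponentY (k := k)).mul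
    (isUnit_torusMonomial (exponentX w p q))).pow n
  refine ⟨τ G₁ * (v⁻¹ : (TorusRing k w)ˣ), ?_⟩
  have h5 : φ v ≠ 0 := (v.isUnit.map φ).ne_zero
  refine mul_right_cancel₀ h5 ?_
  rw [← map_mul, mul_assoc, Units.inv_mul, mul_one, ← h4, hv, map_pow, map_mul]

end IsBlowupCover

end TorusFunctions

/-! ### From divisors to sections -/

section Sections

open MvPolynomial

variable {k : Type u} [Field k] {m p q : ℕ} {w : Fin 3 → ℕ}
  {h : IsTriple m (w 0) (w 1) (w 2) p q} {Y : Scheme.{u}} {π : Y ⟶ weightedPlane k w}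
  {s t : Spec (.of (ChartRing k)) ⟶ Y} {o : (identityCompl k w).toScheme ⟶ Y}
  [IsOpenImmersion s] [IsOpenImmersion t] [IsOpenImmersion o] [IsIntegral Y]

lemma weights_eq : ![w 0, w 1, w 2] = w := by
  ext i
  fin_cases i <;> rfl

lemma exists_coordMonomial_eq_chartFun (e : Fin 3 → ℤ) :
    ∃ u : (ChartRing k)ˣ, coordMonomial m p q s e = chartFun s u := by
  refine ⟨laurent (fun i => (isUnit_chartTheta (m := m) (p := p) (q := q) i).unit) e, ?_⟩
  rw [laurent, Units.coe_prod, map_prod, coordMonomial]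
  refine Finset.prod_congr rfl fun i _ => ?_
  have h1 := congr_arg Units.val (map_zpow (Units.map (chartFun s : ChartRing k →* Y.functionField))
    (isUnit_chartTheta (k := k) (m := m) (p := p) (q := q) i).unit (e i))
  rw [Units.val_zpow_eq_zpow_val] at h1
  exact h1.symm

lemma chartTheta_eq_algebraMap (g : MvPolynomial (Fin 3) k) : chartTheta k m p q g =
    algebraMap _ (ChartRing k) (theta m p q (Polynomial.C.comp Polynomial.C) Polynomial.X
      (1 + (Polynomial.X - 1) * Polynomial.C Polynomial.X) g) := by
  rw [map_theta]
  simp only [map_add, map_mul, map_sub, map_one]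
  rfl

lemma C_X_dvd {f : Polynomial (Polynomial k)} (hf : f.map (Polynomial.evalRingHom 0) = 0) :
    Polynomial.C Polynomial.X ∣ f := by
  refine (Polynomial.C_dvd_iff_dvd_coeff _ _).mpr fun i => ?_
  rw [Polynomial.X_dvd_iff, Polynomial.coeff_zero_eq_eval_zero, ← Polynomial.coe_evalRingHom,
    ← Polynomial.coeff_map, hf, Polynomial.coeff_zero]

lemma map_eval_theta_blowup (g : MvPolynomial (Fin 3) k) :
    (theta m p q (Polynomial.C.comp Polynomial.C) Polynomial.X
      (1 + (Polynomial.X - 1) * Polynomial.C Polynomial.X) g :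
        Polynomial (Polynomial k)).map (Polynomial.evalRingHom 0) =
      theta m p q Polynomial.C Polynomial.X 1 g := by
  rw [← blowupSubst_theta, map_eval_blowupSubst, map_eval_theta]

/-- If the section vanishes along `Y = 1`, then its image in the chart vanishes along the proper
transform `U = 0`. -/
lemma chartU_dvd_chartTheta {g : MvPolynomial (Fin 3) k}
    (hg : (theta m p q Polynomial.C Polynomial.X 1 g : Polynomial k) = 0) :
    chartU k ∣ chartTheta k m p q g := by
  rw [chartTheta_eq_algebraMap]
  exact map_dvd _ (C_X_dvd ((map_eval_theta_blowup g).trans hg))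

/-- The divisors of the coordinates can be split off from the numerator of a rational function. -/
lemma exists_coord_mul_coordMonomial_eq {G : MvPolynomial (Fin 3) k} {d : ℕ} (hw : ∀ i, 0 < w i)
    (hG : G.IsWeightedHomogeneous w d) (hG0 : G ≠ 0) {e : Fin 3 → ℤ}
    (hdeg : d + ∑ i, e i * (w i : ℤ) = 0) :
    ∃ (G' : MvPolynomial (Fin 3) k) (d' : ℕ) (e' : Fin 3 → ℤ), G'.IsWeightedHomogeneous w d' ∧
      G' ≠ 0 ∧ d' + ∑ i, e' i * (w i : ℤ) = 0 ∧ (∀ i, ¬ X i ∣ G') ∧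
      coord m p q s G * coordMonomial m p q s e =
        coord m p q s G' * coordMonomial m p q s e' := by
  induction d using Nat.strong_induction_on generalizing G e with
  | _ d ih =>
    by_cases h1 : ∃ i, X i ∣ G
    · obtain ⟨i, G₁, rfl⟩ := h1
      have h2 := right_ne_zero_of_mul hG0
      obtain ⟨d', rfl, h4⟩ := isWeightedHomogeneous_of_X_mul hG h2
      obtain ⟨G', d'', e', h5, h6, h7, h8, h9⟩ := ih d' (by have := hw i; omega) h4 h2
        (e := e + Pi.single i 1) (by
          simp only [Pi.add_apply, add_mul, Finset.sum_add_distrib]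
          simp only [Pi.single_apply, ite_mul, one_mul, zero_mul, Finset.sum_ite_eq',
            Finset.mem_univ, if_true]
          push_cast at hdeg
          linarith)
      refine ⟨G', d'', e', h5, h6, h7, h8, ?_⟩
      rw [← h9, coordMonomial_add, coordMonomial_single, map_mul]
      ring
    · exact ⟨G, d, e, hG, hG0, hdeg, not_exists.mp h1, rfl⟩

/-- A regular function on the torus is a quotient of a homogeneous polynomial, not divisible by any
coordinate, and a Laurent monomial. -/
lemma exists_torusLift_eq_coord (hw : ∀ i, 0 < w i) {a : TorusRing k w}
    (ha : torusLift w (coord m p q s) isUnit_coord_X a ≠ 0) :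
    ∃ (G : MvPolynomial (Fin 3) k) (d : ℕ) (e : Fin 3 → ℤ), G.IsWeightedHomogeneous w d ∧
      G ≠ 0 ∧ d + ∑ i, e i * (w i : ℤ) = 0 ∧ (∀ i, ¬ X i ∣ G) ∧
      torusLift w (coord m p q s) isUnit_coord_X a =
        coord m p q s G * coordMonomial m p q s e := by
  obtain ⟨n, g, hg, rfl⟩ := HomogeneousLocalization.Away.mk_surjective _ coordProd_mem a
  have h1 := awayLift_mk_mul (coord m p q s) (isUnit_coordProd (coord m p q s) isUnit_coord_X)
      coordProd_mem n g hg
  have h2 : coordMonomial m p q s (fun _ => (n : ℤ)) = coord m p q s (coordProd k) ^ n := by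
    rw [coordMonomial_natCast (fun _ => n), Finset.prod_pow, map_pow]
  have h3 : coordMonomial m p q s (fun _ => (n : ℤ)) * coordMonomial m p q s (fun _ => -(n : ℤ)) =
      1 := by
    rw [← coordMonomial_add]
    simp [coordMonomial]
  have hg0 : g ≠ 0 := by
    rintro rfl
    rw [map_zero, mul_eq_zero] at h1
    exact h1.elim ha (pow_ne_zero _ (isUnit_coordProd (coord m p q s) isUnit_coord_X).ne_zero)
  obtain ⟨G, d, e, h4, h5, h6, h7, h8⟩ := exists_coord_mul_coordMonomial_eq (m := m) (p := p)
    (q := q) (s := s) hw hg hg0 (e := fun _ => -(n : ℤ)) (by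
      simp [Finset.mul_sum])
  refine ⟨G, d, e, h4, h5, h6, h7, ?_⟩
  rw [← h8, ← h1, ← h2, mul_assoc, h3, mul_one]

namespace IsBlowupCover

variable (c : IsBlowupCover h π s t o)
include c

variable [IsLocallyNoetherian Y]

/-- The order of a homogeneous rational function along a coordinate divisor. -/
lemma ord_coord_of_X_mem {i : Fin 3} {y : PrimeDivisor Y}
    (hy : X i ∈ (π y.1).asHomogeneousIdeal) {G : MvPolynomial (Fin 3) k} {d : ℕ}
    (hG : G.IsWeightedHomogeneous w d) (hG0 : G ≠ 0) {e : Fin 3 → ℤ}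
    (hdeg : d + ∑ i, e i * (w i : ℤ) = 0) :
    e i ≤ Scheme.ord (coord m p q s G * coordMonomial m p q s e) y.1 ∧
      (¬ X i ∣ G → Scheme.ord (coord m p q s G * coordMonomial m p q s e) y.1 = e i) := by
  obtain ⟨x, hx, hx'⟩ := c.exists_coordDivisor i
  obtain rfl := c.eq_of_X_mem hx hy
  obtain ⟨v, hv⟩ := h.exists_exponent i
  have hv0 := mem_zeroWeight.mp v.2
  have hX {j : Fin 3} : (X j : MvPolynomial (Fin 3) k) ∈ (π y.1).asHomogeneousIdeal ↔ j = i := by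
    rw [hx, X_dvd_X, eq_comm]
  set e' := e - e i • v.1 with he'
  have hdeg' : d + ∑ i, e' i * (w i : ℤ) = 0 := by
    simp only [he', Pi.sub_apply, Pi.smul_apply, smul_eq_mul, sub_mul, Finset.sum_sub_distrib,
      mul_assoc, ← Finset.mul_sum, hv0]
    simpa using hdeg
  have he0 : e' i = 0 := by simp [he', hv]
  have h1 : coord m p q s G * coordMonomial m p q s e =
      coordMonomial m p q s v.1 ^ e i * (coord m p q s G * coordMonomial m p q s e') := by
    rw [he', coordMonomial_sub, coordMonomial_zsmul]
    have := zpow_ne_zero (e i) (coordMonomial_ne_zero (m := m) (p := p) (q := q) (s := s) v.1)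
    field_simp
  have h2 : Scheme.ord (coord m p q s G * coordMonomial m p q s e) y.1 =
      e i + Scheme.ord (coord m p q s G * coordMonomial m p q s e') y.1 := by
    rw [h1, Scheme.ord_mul (zpow_ne_zero _ (coordMonomial_ne_zero _))
      (mul_ne_zero (c.coord_ne_zero hG hG0) (coordMonomial_ne_zero _)),
      ord_zpow _ (coordMonomial_ne_zero _), hx', hv, mul_one]
  rw [h2]
  constructor
  · have := c.ord_coord_nonneg (x := y.1) hG hG0 hdeg' fun j hj => by rw [hX.mp hj, he0]
    omega
  · intro hGi
    rw [c.ord_coord_eq_zero hG ((hx G).not.mpr hGi) hdeg' fun j hj => by rw [hX.mp hj, he0],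
      add_zero]

omit [IsIntegral Y] [IsLocallyNoetherian Y] in
lemma X_notMem_chart (z) (i : Fin 3) : X i ∉ (π (s z)).asHomogeneousIdeal := fun hi =>
  z.isPrime.ne_top (Ideal.eq_top_of_isUnit_mem _
    ((c.mem_chart_iff (isWeightedHomogeneous_X k w i) z).mp hi) (isUnit_chartTheta i))

omit [IsIntegral Y] [IsLocallyNoetherian Y] in
lemma X_notMem_chart' (z) (i : Fin 3) : X i ∉ (π (t z)).asHomogeneousIdeal := fun hi =>
  z.isPrime.ne_top (Ideal.eq_top_of_isUnit_mem _
    ((c.mem_chart'_iff (isWeightedHomogeneous_X k w i) z).mp hi) (isUnit_chartTheta' i))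

/-- A rational function that vanishes to order `n` along the exceptional curve, and whose poles are
coordinate divisors, is divisible by `(X - 1)ⁿ` on the first chart. -/
lemma exists_eq_chartFun_pow_mul {f : Y.functionField} (hf : f ≠ 0) {n : ℕ}
    (h1 : ∀ y : PrimeDivisor Y, π y.1 ∈ torusIdentity k w → n ≤ Scheme.ord f y.1)
    (h2 : ∀ y : PrimeDivisor Y, π y.1 ∉ torusIdentity k w →
      (∀ i, X i ∉ (π y.1).asHomogeneousIdeal) → 0 ≤ Scheme.ord f y.1) :
    ∃ b, f = chartFun s ((chartX k - 1) ^ n * b) := by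
  have h0 : chartFun s (chartX k - 1) ≠ 0 :=
    (map_ne_zero_iff _ (chartFun_injective s)).mpr chartX_sub_one_ne_zero
  suffices h3 : ∃ b, chartFun s (chartX k - 1) ^ (-n : ℤ) * f = chartFun s b by
    obtain ⟨b, hb⟩ := h3
    refine ⟨b, ?_⟩
    rw [map_mul, map_pow, ← hb, zpow_neg, zpow_natCast, mul_inv_cancel_left₀ (pow_ne_zero n h0)]
  refine exists_chartFun_eq s fun z ϖ hϖ hz => ?_
  obtain ⟨h3, -⟩ := coheight_and_ord_of_span s hϖ.ne_zero hz
  rw [Scheme.ord_mul (zpow_ne_zero _ h0) hf, ord_zpow _ h0]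
  by_cases h4 : π (s z) ∈ torusIdentity k w
  · obtain ⟨x, hx, hx'⟩ := c.exists_exceptional
    have h5 : s z = s (primePoint prime_chartX_sub_one) :=
      (congr_arg Subtype.val ((hx' ⟨s z, h3⟩).mp h4)).trans hx
    have h6 := h1 ⟨s z, h3⟩ h4
    have h7 := (coheight_and_ord_of_span s prime_chartX_sub_one.ne_zero
      (primePoint_asIdeal prime_chartX_sub_one)).2
    rw [← h5] at h7
    rw [h7]
    dsimp only at h6
    omega
  · have h5 := h4
    rw [c.chart_mem_torusIdentity_iff] at h5
    rw [ord_chartFun_eq_zero s h5, mul_zero, zero_add]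
    exact h2 ⟨s z, h3⟩ h4 (c.X_notMem_chart z)

lemma exists_eq_chartFun' {f : Y.functionField}
    (h1 : ∀ y : PrimeDivisor Y, (∀ i, X i ∉ (π y.1).asHomogeneousIdeal) → 0 ≤ Scheme.ord f y.1) :
    ∃ b, f = chartFun t b :=
  exists_chartFun_eq t fun z _ hϖ hz =>
    h1 ⟨t z, (coheight_and_ord_of_span t hϖ.ne_zero hz).1⟩ (c.X_notMem_chart' z)

/-- The generic point of the curve `U = 0` is a prime divisor on the proper transform of
`y³ = xᵐzᵐ`. -/
lemma exists_curvePoint : ∃ x : PrimeDivisor Y, x.1 = s (primePoint prime_chartU) ∧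
    x.1 ∈ curve π m ∧ π x.1 ∉ torusIdentity k w ∧ Scheme.ord (chartFun s (chartU k)) x.1 = 1 := by
  have h1 := coheight_and_ord_of_span s prime_chartU.ne_zero (primePoint_asIdeal prime_chartU)
  have h2 : chartX k - 1 ∉ (primePoint (prime_chartU (k := k))).asIdeal :=
    (mem_primePoint _).not.mpr not_chartU_dvd_chartX_sub_one
  exact ⟨⟨_, h1.1⟩, rfl, c.chart_mem_curve ((mem_primePoint _).mpr dvd_rfl) h2,
    (c.chart_mem_torusIdentity_iff _).not.mpr h2, h1.2⟩

/-- An effective divisor that is linearly equivalent to `acd A - 3d E` comes from a homogeneous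
polynomial of degree `acd` that vanishes to order `3d` at the identity.  If it does not contain the
curve, then the polynomial does not vanish there. -/
theorem hasSection_of_linearlyEquivalent {r : Fin 3 → ℤ} (hr : ∑ i, r i * (w i : ℤ) = 1) {d : ℕ}
    {D : WeilDivisor Y} (hD : 0 ≤ D) (hDC : HasNoComponentIn D (curve π m))
    (hlin : LinearlyEquivalent D
      ((w 0 * w 2 * d : ℤ) • divisorA π r - (3 * d : ℤ) • exceptionalDivisor π)) :
    HasSection k m (w 0) (w 1) (w 2) p q d := by
  obtain ⟨f, hf0, hf⟩ := hlin
  set N : ℤ := w 0 * w 2 * d with hN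
  obtain ⟨b, hb⟩ := c.exists_eq_chartFun_pow_mul hf0 (n := 3 * d)
    (fun y hy => by
      rw [← hf, c.divisor_apply_of_mem _ _ _ hy]
      have : 0 ≤ D y := hD y
      push_cast
      omega)
    (fun y hy hy' => by
      rw [← hf, c.divisor_apply_of_notMem _ _ _ hy hy', sub_zero]
      exact hD y)
  obtain ⟨b', hb'⟩ := c.exists_eq_chartFun' (f := f) fun y hy => by
    rw [← hf]
    have : 0 ≤ D y := hD y
    by_cases hy' : π y.1 ∈ torusIdentity k w
    · rw [c.divisor_apply_of_mem _ _ _ hy']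
      omega
    · rwa [c.divisor_apply_of_notMem _ _ _ hy' hy, sub_zero]
  obtain ⟨a, ha⟩ := c.exists_eq_torusLift hb hb'
  obtain ⟨G, d', e, hG, hG0, hdeg, hGX, hGe⟩ := exists_torusLift_eq_coord h.pos (ha ▸ hf0)
  rw [← ha] at hGe
  -- `f` has poles of order at most `acd rᵢ` along the coordinate divisors
  have he (i) : 0 ≤ e i + N * r i := by
    obtain ⟨y, hy, -⟩ := c.exists_coordDivisor i
    have hy' := (hy (X i)).mpr dvd_rfl
    have h1 := (c.ord_coord_of_X_mem hy' hG hG0 hdeg).2 (hGX i)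
    rw [← hGe, ← hf, c.divisor_apply_of_X_mem _ _ _ hy'] at h1
    have : 0 ≤ D y := hD y
    omega
  let n : Fin 3 → ℕ := fun i => (e i + N * r i).toNat
  have hn (i) : (n i : ℤ) = e i + N * r i := Int.toNat_of_nonneg (he i)
  let ξ := G * ∏ i, X i ^ n i
  have hξ : ξ.IsWeightedHomogeneous w (w 0 * w 2 * d) := by
    have h1 := hG.mul (isWeightedHomogeneous_prod_X_pow (k := k) (w := w) n)
    have h2 : d' + ∑ i, n i * w i = w 0 * w 2 * d := by
      zify
      simp only [hn, add_mul, Finset.sum_add_distrib, mul_assoc N, ← Finset.mul_sum, hr]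
      rw [hN] at *
      linarith
    rwa [h2] at h1
  have hξf : coord m p q s ξ = f * coordMonomial m p q s (N • r) := by
    have h1 : (fun i => (n i : ℤ)) = e + N • r := funext hn
    rw [map_mul, ← coordMonomial_natCast, h1, coordMonomial_add, hGe]
    ring
  obtain ⟨v, hv⟩ := exists_coordMonomial_eq_chartFun (m := m) (p := p) (q := q) (s := s) (N • r)
  have hξ' : chartTheta k m p q ξ = (chartX k - 1) ^ (3 * d) * b * v := by
    apply chartFun_injective s
    rw [map_mul _ _ (v : ChartRing k), ← hv, ← hb, ← hξf]
    rfl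
  refine ⟨ξ, weights_eq.symm ▸ hξ, ?_, fun h1 => ?_⟩
  · refine pow_dvd_of_algebraMap_chartRing_pow_dvd prime_X_sub_one not_X_sub_one_dvd ?_
    rw [← chartTheta_eq_algebraMap, hξ', algebraMap_X_sub_one, mul_assoc]
    exact dvd_mul_right _ _
  · obtain ⟨g, hg⟩ := chartU_dvd_chartTheta h1
    obtain ⟨x, hx, hxC, hxe, hxU⟩ := c.exists_curvePoint
    have h2 : f = chartFun s (chartU k * (g * (v⁻¹ : (ChartRing k)ˣ))) := by
      rw [hb]
      congr 1
      rw [← mul_assoc, ← hg, hξ', mul_assoc _ (v : ChartRing k), Units.mul_inv, mul_one]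
    have h3 : chartU k * (g * (v⁻¹ : (ChartRing k)ˣ)) ≠ 0 := by
      intro h4
      rw [h4, map_zero] at h2
      exact hf0 h2
    have h4 := right_ne_zero_of_mul h3
    have h5 := hf x
    rw [hDC x hxC, c.divisor_apply_of_notMem _ _ _ hxe (by rw [hx]; exact c.X_notMem_chart _), h2,
      map_mul, Scheme.ord_mul
        ((map_ne_zero_iff _ (chartFun_injective s)).mpr prime_chartU.ne_zero)
        ((map_ne_zero_iff _ (chartFun_injective s)).mpr h4), hxU, hx] at h5
    have := ord_chartFun_nonneg s (primePoint prime_chartU) h4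
    omega

end IsBlowupCover

end Sections

/-! ### Restriction of sections to the curve -/

section Restriction

open Polynomial

variable {k : Type*} [Field k] {m a b c p q d : ℕ}

lemma theta_one_eq_sum (ξ : MvPolynomial (Fin 3) k) :
    (theta m p q C X 1 ξ : k[X]) =
      ∑ μ ∈ ξ.support, C (ξ.coeff μ) * X ^ (μ 0 * 7 + μ 1 * (5 * m) + μ 2 * 8) := by
  rw [theta_eq_sum]
  simp only [one_pow, mul_one]

/-- The restriction of a section to the curve `Y = 1` is determined up to a scalar: only the powers
of `X` between `X^{8ad}` and `X^{8ad + 3d}` occur in it, and it vanishes to order `3d` at `1`. -/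
lemma exists_theta_one_eq (h : IsTriple m a b c p q) {ξ : MvPolynomial (Fin 3) k}
    (hξ : ξ.IsWeightedHomogeneous ![a, b, c] (a * c * d))
    (hdvd : (X - 1 : k[X]) ^ (3 * d) ∣ theta m p q C X 1 ξ)
    (h0 : (theta m p q C X 1 ξ : k[X]) ≠ 0) :
    ∃ r : k, r ≠ 0 ∧
      (theta m p q C X 1 ξ : k[X]) = X ^ (8 * a * d) * (C r * (X - 1) ^ (3 * d)) := by
  have hcol (μ) (hμ : μ ∈ ξ.support) := h.exists_column (d := d)
    (by rw [← weight_fin_three]; exact hξ (MvPolynomial.mem_support_iff.mp hμ))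
  have hX : (X : k[X]) ^ (8 * a * d) ∣ theta m p q C X 1 ξ := by
    rw [theta_one_eq_sum]
    refine Finset.dvd_sum fun μ hμ => ?_
    obtain ⟨κ, hκ, -⟩ := hcol μ hμ
    rw [hκ, pow_add]
    exact Dvd.dvd.mul_left (dvd_mul_right _ _) _
  have hdeg : (theta m p q C X 1 ξ : k[X]).natDegree ≤ 8 * a * d + 3 * d := by
    rw [theta_one_eq_sum]
    refine natDegree_sum_le_of_forall_le _ _ fun μ hμ => ?_
    obtain ⟨κ, hκ, -, hκ'⟩ := hcol μ hμ
    have h1 : κ ≤ 3 * d := Nat.le_of_mul_le_mul_left (by omega : a * κ ≤ a * (3 * d)) h.a_pos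
    refine (natDegree_C_mul_X_pow_le _ _).trans ?_
    omega
  have hm : (X - 1 : k[X]).Monic := by
    rw [← C_1]
    exact monic_X_sub_C 1
  have hm' : (X - 1 : k[X]).natDegree = 1 := by
    rw [← C_1]
    exact natDegree_X_sub_C 1
  have hco : IsCoprime (X : k[X]) (X - 1) := ⟨1, -1, by ring⟩
  obtain ⟨g, hg⟩ := hco.pow.mul_dvd hX hdvd
  have hg0 : g ≠ 0 := by
    rintro rfl
    exact h0 (by rw [hg, mul_zero])
  rw [hg, ((monic_X_pow _).mul (hm.pow _)).natDegree_mul' hg0,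
    (monic_X_pow _).natDegree_mul (hm.pow _), natDegree_X_pow, hm.natDegree_pow, hm', mul_one] at hdeg
  have hg1 : g = C (g.coeff 0) := eq_C_of_natDegree_eq_zero (by omega)
  refine ⟨g.coeff 0, fun h1 => hg0 (by rw [hg1, h1, C_0]), ?_⟩
  rw [hg, ← hg1]
  ring

variable {ξ : MvPolynomial (Fin 3) k} {r : k}

/-- The power of `z` occurs in a section: it is the only monomial that restricts to `X^{8ad}`. -/
lemma coeff_single_two_ne_zero (h : IsTriple m a b c p q)
    (hξ : ξ.IsWeightedHomogeneous ![a, b, c] (a * c * d)) (hr : r ≠ 0)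
    (h1 : (theta m p q C X 1 ξ : k[X]) = X ^ (8 * a * d) * (C r * (X - 1) ^ (3 * d))) :
    ξ.coeff (Finsupp.single 2 (a * d)) ≠ 0 := by
  have h2 := congr_arg (fun f : k[X] => f.coeff (8 * a * d)) h1
  have h3 := coeff_X_pow_mul (C r * (X - 1) ^ (3 * d)) (8 * a * d) 0
  rw [zero_add] at h3
  rw [h3, coeff_zero_eq_eval_zero, theta_one_eq_sum, finsetSum_coeff] at h2
  intro h4
  rw [Finset.sum_eq_zero, eq_comm] at h2
  · simp [hr] at h2
  intro μ hμ
  obtain ⟨κ, hκ, hκ', hκ''⟩ := h.exists_column (d := d)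
    (by rw [← weight_fin_three]; exact hξ (MvPolynomial.mem_support_iff.mp hμ))
  rw [coeff_C_mul_X_pow, if_neg]
  intro h5
  have h6 : κ = 0 := by omega
  subst h6
  have h7 : m * μ 1 = 0 := by omega
  have h8 : μ 0 = 0 := by omega
  have h9 : μ 1 = 0 := (Nat.mul_eq_zero.mp h7).resolve_left h.m_pos.ne'
  have h10 : μ 2 = a * d := by
    rw [h7] at hκ''
    have : 3 * μ 2 = 3 * (a * d) := by rw [mul_zero] at hκ''; linarith
    omega
  have h11 : μ = Finsupp.single 2 (a * d) := by
    ext i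
    fin_cases i <;> simp [h8, h9, h10]
  exact MvPolynomial.mem_support_iff.mp hμ (h11 ▸ h4)

/-- The power of `x` occurs in a section: it is the only monomial that restricts to `X^{8ad + 3d}`. -/
lemma coeff_single_zero_ne_zero (h : IsTriple m a b c p q)
    (hξ : ξ.IsWeightedHomogeneous ![a, b, c] (a * c * d)) (hr : r ≠ 0)
    (h1 : (theta m p q C X 1 ξ : k[X]) = X ^ (8 * a * d) * (C r * (X - 1) ^ (3 * d))) :
    ξ.coeff (Finsupp.single 0 (c * d)) ≠ 0 := by
  have h2 := congr_arg (fun f : k[X] => f.coeff (3 * d + 8 * a * d)) h1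
  have hm : ((X - 1 : k[X]) ^ (3 * d)).coeff (3 * d) = 1 := by
    have h3 : (X - 1 : k[X]).natDegree = 1 := by
      rw [← C_1]
      exact natDegree_X_sub_C 1
    have h4 : (X - 1 : k[X]).Monic := by
      rw [← C_1]
      exact monic_X_sub_C 1
    have h5 := (h4.pow (3 * d)).coeff_natDegree
    rwa [h4.natDegree_pow, h3, mul_one] at h5
  rw [coeff_X_pow_mul, coeff_C_mul, hm, theta_one_eq_sum, finsetSum_coeff] at h2
  intro h4
  rw [Finset.sum_eq_zero, eq_comm] at h2
  · simp [hr] at h2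
  intro μ hμ
  obtain ⟨κ, hκ, hκ', hκ''⟩ := h.exists_column (d := d)
    (by rw [← weight_fin_three]; exact hξ (MvPolynomial.mem_support_iff.mp hμ))
  rw [coeff_C_mul_X_pow, if_neg]
  intro h5
  have h6 : κ = 3 * d := by omega
  subst h6
  have h7 : m * μ 1 = 0 := by omega
  have h8 : μ 2 = 0 := by omega
  have h9 : μ 1 = 0 := (Nat.mul_eq_zero.mp h7).resolve_left h.m_pos.ne'
  have h10 : μ 0 = c * d := by
    rw [h7] at hκ'
    have : 3 * μ 0 = 3 * (c * d) := by linarith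
    omega
  have h11 : μ = Finsupp.single 0 (c * d) := by
    ext i
    fin_cases i <;> simp [h8, h9, h10]
  exact MvPolynomial.mem_support_iff.mp hμ (h11 ▸ h4)

end Restriction

/-! ### Zeros of sections on the curve -/

section Avoidance

open MvPolynomial

variable {k : Type u} [Field k] {m p q d : ℕ} {w : Fin 3 → ℕ}

/-- If all variables but one lie in an ideal that contains a homogeneous polynomial, then so does the
term of the polynomial in the remaining variable. -/
lemma monomial_single_mem {I : Ideal (MvPolynomial (Fin 3) k)} {g : MvPolynomial (Fin 3) k}
    {i : Fin 3} {n : ℕ} (hw : 0 < w i) (hg : g.IsWeightedHomogeneous w (n * w i)) (hgI : g ∈ I)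
    (hI : ∀ j ≠ i, X j ∈ I) : monomial (Finsupp.single i n) (g.coeff (Finsupp.single i n)) ∈ I := by
  classical
  have key : ∀ μ ∈ g.support, μ ≠ Finsupp.single i n → monomial μ (g.coeff μ) ∈ I := by
    intro μ hμ hμi
    obtain ⟨j, hj, hμj⟩ : ∃ j, j ≠ i ∧ μ j ≠ 0 := by
      by_contra! h1
      have h2 : μ = Finsupp.single i (μ i) := by
        ext j
        by_cases hj : j = i
        · rw [hj, Finsupp.single_eq_same]
        · rw [h1 j hj, Finsupp.single_eq_of_ne hj]
      have h3 := hg (mem_support_iff.mp hμ)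
      rw [h2, Finsupp.weight_single, smul_eq_mul] at h3
      rw [Nat.eq_of_mul_eq_mul_right hw h3] at h2
      exact hμi h2
    refine Ideal.mem_of_dvd _ ?_ (hI j hj)
    rw [X_dvd_monomial]
    exact Or.inr hμj
  by_cases h1 : Finsupp.single i n ∈ g.support
  · have h2 : g = monomial (Finsupp.single i n) (g.coeff (Finsupp.single i n)) +
        ∑ μ ∈ g.support.erase (Finsupp.single i n), monomial μ (g.coeff μ) := by
      conv_lhs => rw [g.as_sum, ← Finset.add_sum_erase _ _ h1]
    refine (Ideal.add_mem_iff_left I (I.sum_mem fun μ hμ =>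
      key μ (Finset.mem_of_mem_erase hμ) (Finset.ne_of_mem_erase hμ))).mp ?_
    rwa [← h2]
  · rw [notMem_support_iff.mp h1, monomial_zero]
    exact I.zero_mem

namespace IsTriple

variable (h : IsTriple m (w 0) (w 1) (w 2) p q)
include h

/-- A homogeneous polynomial vanishes at a point of the torus if and only if its expression in the
coordinates `X` and `Y` does. -/
lemma mem_torusι_iff {g : MvPolynomial (Fin 3) k} {n : ℕ} (hg : g.IsWeightedHomogeneous w n)
    (z : Spec (.of (TorusRing k w))) :
    g ∈ (h.torusι k z).asHomogeneousIdeal ↔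
      theta m p q (torusConst k w) (torusMonomial (exponentX w p q))
        (torusMonomial h.exponentY) g ∈ z.asIdeal := by
  have hx := isUnit_torusMonomial (k := k) (exponentX w p q)
  have hy := isUnit_torusMonomial (k := k) h.exponentY
  have h1 : torusLift w (theta m p q (torusConst k w) (torusMonomial (exponentX w p q))
      (torusMonomial h.exponentY)) (isUnit_theta_X _ hx hy) = RingHom.id _ := by
    refine h.isTorus.hom_ext _ _ ?_ ?_ ?_
    · rw [torusLift_comp_torusConst]
      exact RingHom.ext fun c => theta_C ..
    · exact h.theta_exponentX _ hx hy
    · exact h.theta_exponentY _ hx hy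
  have h2 := h.mem_torusι_comap_iff _ (isUnit_theta_X (m := m) (p := p) (q := q) (torusConst k w) hx hy) hg z
  rw [h1, CommRingCat.ofHom_id, Spec.map_id] at h2
  exact h2

/-- A section does not vanish on the curve `y³ = xᵐzᵐ` away from the identity of the torus.  On the
torus the curve is `Y = 1`, where the section is a scalar times `X^{8ad}(X - 1)^{3d}`; the other points
of the curve are those with `y = 0` and `x = 0` or `z = 0`, where a power of `z` or of `x` remains. -/
lemma notMem_of_curve_mem {ξ : MvPolynomial (Fin 3) k}
    (hξ : ξ.IsWeightedHomogeneous w (w 0 * w 2 * d))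
    (hdvd : (Polynomial.X - 1 : Polynomial k) ^ (3 * d) ∣ theta m p q Polynomial.C Polynomial.X 1 ξ)
    (h0 : (theta m p q Polynomial.C Polynomial.X 1 ξ : Polynomial k) ≠ 0) {x : weightedPlane k w}
    (hx : X 1 ^ 3 - X 0 ^ m * X 2 ^ m ∈ x.asHomogeneousIdeal) (hxe : x ∉ torusIdentity k w) :
    ξ ∉ x.asHomogeneousIdeal := by
  intro hξx
  have hξ' : ξ.IsWeightedHomogeneous ![w 0, w 1, w 2] (w 0 * w 2 * d) := weights_eq.symm ▸ hξ
  obtain ⟨r, hr, h1⟩ := exists_theta_one_eq h hξ' hdvd h0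
  have hprime := x.isPrime
  have hx1 : X 1 ∈ x.asHomogeneousIdeal ↔
      X 0 ∈ x.asHomogeneousIdeal ∨ X 2 ∈ x.asHomogeneousIdeal := by
    have hiff : (X 1 ^ 3 : MvPolynomial (Fin 3) k) ∈ x.asHomogeneousIdeal.toIdeal ↔
        X 0 ^ m * X 2 ^ m ∈ x.asHomogeneousIdeal.toIdeal := by
      refine ⟨fun h2 => ?_, fun h2 => ?_⟩
      · exact (Submodule.sub_mem_iff_right _ h2).mp hx
      · exact (Submodule.sub_mem_iff_left _ h2).mp hx
    have h3 := h.m_pos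
    constructor
    · intro h2
      exact (hprime.mem_or_mem (hiff.mp (Ideal.pow_mem_of_mem _ h2 3 (by norm_num)))).imp
        (hprime.mem_of_pow_mem _) (hprime.mem_of_pow_mem _)
    · rintro (h2 | h2)
      · exact hprime.mem_of_pow_mem 3
          (hiff.mpr (Ideal.mul_mem_right _ _ (Ideal.pow_mem_of_mem _ h2 m h3)))
      · exact hprime.mem_of_pow_mem 3
          (hiff.mpr (Ideal.mul_mem_left _ _ (Ideal.pow_mem_of_mem _ h2 m h3)))
  have key {i : Fin 3} {n : ℕ} (hn : w 0 * w 2 * d = n * w i)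
      (hn0 : ξ.coeff (Finsupp.single i n) ≠ 0) (hI : ∀ j ≠ i, X j ∈ x.asHomogeneousIdeal) : False := by
    rw [hn] at hξ
    have h2 := monomial_single_mem (I := x.asHomogeneousIdeal.toIdeal) (h.pos i) hξ hξx hI
    obtain ⟨j, hj⟩ := IsTriple.exists_X_notMem x
    have hji : j = i := by
      by_contra hji
      exact hj (hI j hji)
    subst hji
    rw [← C_mul_X_pow_eq_monomial, Ideal.unit_mul_mem_iff_mem _ (hn0.isUnit.map C)] at h2
    exact hj (hprime.mem_of_pow_mem _ h2)
  by_cases hx0 : X 0 ∈ x.asHomogeneousIdeal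
  · refine key (i := 2) (by ring) (coeff_single_two_ne_zero h hξ' hr h1) fun j hj => ?_
    fin_cases j
    · exact hx0
    · exact hx1.mpr (Or.inl hx0)
    · exact absurd rfl hj
  by_cases hx2 : X 2 ∈ x.asHomogeneousIdeal
  · refine key (i := 0) (by ring) (coeff_single_zero_ne_zero h hξ' hr h1) fun j hj => ?_
    fin_cases j
    · exact absurd rfl hj
    · exact hx1.mpr (Or.inr hx2)
    · exact hx2
  have hcoord : x ∈ (h.torusι k).opensRange := by
    rw [Proj.opensRange_awayι, Proj.mem_basicOpen]
    intro h2
    obtain ⟨i, -, hi⟩ := hprime.prod_mem_iff.mp h2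
    fin_cases i
    · exact hx0 hi
    · exact (not_or.mpr ⟨hx0, hx2⟩) (hx1.mp hi)
    · exact hx2 hi
  obtain ⟨z, rfl⟩ := hcoord
  rw [h.torusι_mem_torusIdentity_iff, h.ker_evalOne, Ideal.span_le, Set.insert_subset_iff,
    Set.singleton_subset_iff] at hxe
  have hxu := isUnit_torusMonomial (k := k) (exponentX w p q)
  have hyu := isUnit_torusMonomial (k := k) h.exponentY
  rw [h.mem_torusι_iff h.isWeightedHomogeneous_curve, h.theta_curve,
    Ideal.unit_mul_mem_iff_mem _ ((hxu.pow _).mul (hyu.pow _))] at hx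
  rw [h.mem_torusι_iff hξ] at hξx
  refine hxe ⟨?_, hx⟩
  -- modulo `Y - 1`, the section becomes a scalar times `X^{8ad}(X - 1)^{3d}`
  let φ := Ideal.Quotient.mk z.asIdeal
  have h2 : φ (torusMonomial h.exponentY) = 1 := by
    rw [← map_one φ]
    exact Ideal.Quotient.eq.mpr hx
  have h3 := Ideal.Quotient.eq_zero_iff_mem.mpr hξx
  have h4 := map_theta (m := m) (p := p) (q := q) (Polynomial.eval₂RingHom (φ.comp (torusConst k w))
    (φ (torusMonomial (exponentX w p q)))) Polynomial.C Polynomial.X 1 ξ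
  have h5 : (Polynomial.eval₂RingHom (φ.comp (torusConst k w))
    (φ (torusMonomial (exponentX w p q)))).comp Polynomial.C = φ.comp (torusConst k w) := by
    ext
    simp
  change φ _ = 0 at h3
  rw [map_theta, h2] at h3
  rw [h5, map_one, Polynomial.coe_eval₂RingHom, Polynomial.eval₂_X, h3, h1, Polynomial.eval₂_mul,
    Polynomial.eval₂_mul, Polynomial.eval₂_pow, Polynomial.eval₂_pow, Polynomial.eval₂_X,
    Polynomial.eval₂_C, Polynomial.eval₂_sub, Polynomial.eval₂_X, Polynomial.eval₂_one,
    RingHom.comp_apply, ← map_one φ, ← map_sub, ← map_pow, ← map_pow, ← map_mul, ← map_mul] at h4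
  have h6 := Ideal.Quotient.eq_zero_iff_mem.mp h4
  rw [Ideal.unit_mul_mem_iff_mem _ (hxu.pow _),
    Ideal.unit_mul_mem_iff_mem _ (hr.isUnit.map (torusConst k w))] at h6
  exact z.isPrime.mem_of_pow_mem _ h6

end IsTriple

end Avoidance

/-! ### Intersection numbers -/

section Intersection

variable {Y : Scheme.{u}}

/-- A divisor whose support does not meet the curve has intersection number zero with it. -/
lemma intersectionNumber_eq_zero {D : WeilDivisor Y} {Z : Closeds Y}
    (hD : ∀ p ∈ Z, ∀ y : PrimeDivisor Y, y.1 ⤳ p → D y = 0) : intersectionNumber D Z = 0 := by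
  rw [intersectionNumber, ENNReal.tsum_eq_zero]
  rintro ⟨p, -, hp⟩
  have h1 : IsLocalEquation D 1 p 1 := fun y hy => by
    rw [map_one, Ring.ord_one, hD p hp y hy]
    simp
  refine le_antisymm (iInf₂_le_of_le 1 one_pos (iInf₂_le_of_le 1 h1 ?_)) zero_le
  have : Subsingleton (Y.presheaf.stalk p ⧸
      (Ideal.span {(1 : Y.presheaf.stalk p)} ⊔
        stalkIdeal (Scheme.IdealSheafData.vanishingIdeal Z) p)) := by
    rw [Ideal.Quotient.subsingleton_iff, Ideal.span_singleton_one, top_sup_eq]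
  rw [Module.length_eq_zero]
  simp

end Intersection

/-! ### From sections to divisors -/

section DivisorsOfSections

open MvPolynomial

variable {k : Type u} [Field k] {m p q : ℕ} {w : Fin 3 → ℕ}
  {h : IsTriple m (w 0) (w 1) (w 2) p q} {Y : Scheme.{u}} {π : Y ⟶ weightedPlane k w}
  {s t : Spec (.of (ChartRing k)) ⟶ Y} {o : (identityCompl k w).toScheme ⟶ Y}
  [IsOpenImmersion s] [IsOpenImmersion t] [IsOpenImmersion o] [IsIntegral Y]

namespace IsBlowupCover

variable (c : IsBlowupCover h π s t o)
include c

lemma notMem_apply_genericPoint {g : MvPolynomial (Fin 3) k} {n : ℕ}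
    (hg : g.IsWeightedHomogeneous w n) (hg0 : g ≠ 0) :
    g ∉ (π (genericPoint Y)).asHomogeneousIdeal := by
  rw [← genericPoint_eq_of_isOpenImmersion s, c.mem_chart_iff hg, genericPoint_eq_bot_of_affine]
  intro h1
  have h2 : chartTheta k m p q g = 0 := h1
  refine c.coord_ne_zero hg hg0 ?_
  rw [coord, RingHom.comp_apply, h2, map_zero]

lemma apply_genericPoint_notMem_torusIdentity : π (genericPoint Y) ∉ torusIdentity k w := by
  rw [← genericPoint_eq_of_isOpenImmersion s, c.chart_mem_torusIdentity_iff,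
    genericPoint_eq_bot_of_affine]
  exact chartX_sub_one_ne_zero

variable [IsLocallyNoetherian Y]

/-- The divisor of a section is effective and does not meet the curve: on the exceptional curve this
holds because the restriction of the section to the curve vanishes at the identity to order `3d` and
not higher. -/
theorem exists_divisor_of_hasSection [NoetherianSpace Y] {r : Fin 3 → ℤ}
    (hr : ∑ i, r i * (w i : ℤ) = 1) {d : ℕ} (hd : HasSection k m (w 0) (w 1) (w 2) p q d) :
    ∃ D : WeilDivisor Y, 0 ≤ D ∧ (∀ x ∈ curve π m, ∀ y : PrimeDivisor Y, y.1 ⤳ x → D y = 0) ∧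
      LinearlyEquivalent D
        ((w 0 * w 2 * d : ℤ) • divisorA π r - (3 * d : ℤ) • exceptionalDivisor π) := by
  obtain ⟨ξ, hξ', ⟨g, hg⟩, hξ1⟩ := hd
  have hξ : ξ.IsWeightedHomogeneous w (w 0 * w 2 * d) := weights_eq (w := w) ▸ hξ'
  have hξ0 : ξ ≠ 0 := by
    rintro rfl
    exact hξ1 (map_zero _)
  have hg' : (theta m p q Polynomial.C Polynomial.X 1 ξ : Polynomial k) =
      (Polynomial.X - 1) ^ (3 * d) * g.map (Polynomial.evalRingHom 0) := by
    rw [← map_eval_theta_blowup, hg]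
    simp
  have hdvd := Dvd.intro _ hg'.symm
  obtain ⟨ρ, hρ, hρ'⟩ := exists_theta_one_eq h hξ' hdvd hξ1
  set N : ℤ := w 0 * w 2 * d with hN
  set e : Fin 3 → ℤ := -(N • r) with he
  have hdeg : ((w 0 * w 2 * d : ℕ) : ℤ) + ∑ i, e i * (w i : ℤ) = 0 := by
    simp only [he, Pi.neg_apply, Pi.smul_apply, smul_eq_mul, neg_mul, Finset.sum_neg_distrib,
      mul_assoc N, ← Finset.mul_sum, hr]
    rw [hN]
    push_cast
    ring
  obtain ⟨v, hv⟩ := exists_coordMonomial_eq_chartFun (m := m) (p := p) (q := q) (s := s) e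
  set f := coord m p q s ξ * coordMonomial m p q s e with hf
  have hf0 : f ≠ 0 := mul_ne_zero (c.coord_ne_zero hξ hξ0) (coordMonomial_ne_zero e)
  set b := algebraMap _ (ChartRing k) g * (v : ChartRing k) with hb
  have hfb : f = chartFun s (chartX k - 1) ^ (3 * d : ℤ) * chartFun s b := by
    have h1 : (3 * d : ℤ) = (3 * d : ℕ) := by push_cast; rfl
    rw [h1, zpow_natCast, hf, hv, coord, RingHom.comp_apply, chartTheta_eq_algebraMap, hg, map_mul,
      map_pow, algebraMap_X_sub_one, map_mul, map_pow, hb, map_mul (chartFun s) _ (v : ChartRing k),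
      mul_assoc]
  have hX0 : chartFun s (chartX k - 1) ≠ 0 :=
    (map_ne_zero_iff _ (chartFun_injective s)).mpr chartX_sub_one_ne_zero
  have hb0 : b ≠ 0 := by
    intro h1
    rw [h1, map_zero, mul_zero] at hfb
    exact hf0 hfb
  have hb0' := (map_ne_zero_iff _ (chartFun_injective s)).mpr hb0
  have hford (x) : Scheme.ord f x = 3 * d * Scheme.ord (chartFun s (chartX k - 1)) x +
      Scheme.ord (chartFun s b) x := by
    rw [hfb, Scheme.ord_mul (zpow_ne_zero _ hX0) hb0', ord_zpow _ hX0]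
  -- on the curve `U = 0`, the function `b` is a scalar times a power of the unit `X`
  have hbz (z : Spec (.of (ChartRing k))) (hz : chartU k ∈ z.asIdeal) : b ∉ z.asIdeal := by
    have h1 : g.map (Polynomial.evalRingHom 0) =
        Polynomial.X ^ (8 * w 0 * d) * Polynomial.C ρ := by
      rw [hρ', ← mul_assoc, mul_comm] at hg'
      refine (mul_left_cancel₀ (pow_ne_zero _ ?_) hg').symm
      rw [← Polynomial.C_1]
      exact Polynomial.X_sub_C_ne_zero 1
    have h2 := C_X_dvd (f := g - Polynomial.X ^ (8 * w 0 * d) * Polynomial.C (Polynomial.C ρ)) (by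
      rw [Polynomial.map_sub, h1]
      simp)
    have h3 := Ideal.mem_of_dvd _ (map_dvd (algebraMap _ (ChartRing k)) h2) hz
    rw [hb, Ideal.mul_unit_mem_iff_mem _ v.isUnit]
    intro h4
    rw [map_sub, Submodule.sub_mem_iff_right _ h4, map_mul, map_pow] at h3
    exact z.isPrime.ne_top (Ideal.eq_top_of_isUnit_mem _ h3
      ((isUnit_chartX.pow _).mul (hρ.isUnit.map (chartConst k))))
  let E := N • divisorA π r - (3 * d : ℤ) • exceptionalDivisor π
  have hE : (Function.support fun y : PrimeDivisor Y => E y + Scheme.ord f y.1).Finite := by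
    have h1 : (ξ * coordProd k).IsWeightedHomogeneous w _ := hξ.mul coordProd_mem
    have h2 : ξ * coordProd k ≠ 0 :=
      mul_ne_zero hξ0 (Finset.prod_ne_zero_iff.mpr fun i _ => X_ne_zero i)
    refine (finite_primeDivisor_mem (Z := preimage π (zeroLocus w {ξ * coordProd k} ⊔
      torusIdentity k w)) (Closeds.isClosed _) ?_).subset fun y hy => ?_
    · rintro (h3 | h3)
      · exact c.notMem_apply_genericPoint h1 h2 (mem_zeroLocus_singleton.mp h3)
      · exact c.apply_genericPoint_notMem_torusIdentity h3
    · by_contra h3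
      have h4 := not_or.mp h3
      have h5 : ξ * coordProd k ∉ (π y.1).asHomogeneousIdeal := fun h5 =>
        h4.1 (mem_zeroLocus_singleton.mpr h5)
      have h6 (i) : X i ∉ (π y.1).asHomogeneousIdeal := fun h6 => h5 (Ideal.mul_mem_left _ _
        (Ideal.mem_of_dvd _ (Finset.dvd_prod_of_mem X (Finset.mem_univ i)) h6))
      refine hy ?_
      dsimp only
      rw [c.divisor_apply_of_notMem _ _ _ h4.2 h6, zero_add]
      exact c.ord_coord_eq_zero hξ (fun h7 => h5 (Ideal.mul_mem_right _ _ h7)) hdeg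
        fun i hi => absurd hi (h6 i)
  let D : WeilDivisor Y := Finsupp.ofSupportFinite _ hE
  have hD (y : PrimeDivisor Y) : D y = E y + Scheme.ord f y.1 := rfl
  refine ⟨D, fun y => ?_, fun x hx y hyx => ?_, f, hf0, fun y => ?_⟩
  · rw [hD, Finsupp.zero_apply]
    by_cases hye : π y.1 ∈ torusIdentity k w
    · rw [c.divisor_apply_of_mem _ _ _ hye, hford]
      obtain ⟨y', hy', hy''⟩ := c.exists_exceptional
      rw [(hy'' y).mp hye, hy', (coheight_and_ord_of_span s prime_chartX_sub_one.ne_zero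
        (primePoint_asIdeal prime_chartX_sub_one)).2]
      have := ord_chartFun_nonneg s (primePoint prime_chartX_sub_one) hb0
      omega
    · by_cases hyX : ∃ i, X i ∈ (π y.1).asHomogeneousIdeal
      · obtain ⟨i, hi⟩ := hyX
        have h1 : e i ≤ Scheme.ord f y.1 := (c.ord_coord_of_X_mem hi hξ hξ0 hdeg).1
        rw [c.divisor_apply_of_X_mem _ _ _ hi]
        have h2 : e i = -(N * r i) := rfl
        omega
      · rw [c.divisor_apply_of_notMem _ _ _ hye (not_exists.mp hyX), zero_add]
        exact c.ord_coord_nonneg hξ hξ0 hdeg fun i hi => absurd ⟨i, hi⟩ hyX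
  · rw [hD]
    by_cases hxe : π x ∈ torusIdentity k w
    · obtain ⟨z, rfl, hz⟩ := c.exists_chart_of_mem_curve hx hxe
      obtain ⟨z', hz'⟩ := hyx.mem_open s.opensRange.isOpen ⟨z, rfl⟩
      have h1 : b ∉ z'.asIdeal := by
        rw [← hz', s.isOpenEmbedding.isInducing.specializes_iff, specializes_iff_mem_closure] at hyx
        exact fun h2 => hbz z hz ((PrimeSpectrum.le_iff_mem_closure z' z).mpr hyx h2)
      rw [hford, ← hz', ord_chartFun_eq_zero s h1, add_zero]
      by_cases hye : π y.1 ∈ torusIdentity k w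
      · obtain ⟨y', hy', hy''⟩ := c.exists_exceptional
        have h2 : s z' = s (primePoint prime_chartX_sub_one) :=
          hz'.trans ((congr_arg Subtype.val ((hy'' y).mp hye)).trans hy')
        rw [c.divisor_apply_of_mem _ _ _ hye, h2,
          (coheight_and_ord_of_span s prime_chartX_sub_one.ne_zero
            (primePoint_asIdeal prime_chartX_sub_one)).2]
        omega
      · rw [c.divisor_apply_of_notMem _ _ _ hye (by rw [← hz']; exact c.X_notMem_chart z'),
          ord_chartFun_eq_zero s, mul_zero, zero_add]
        rwa [← c.chart_mem_torusIdentity_iff, hz']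
    · have h1 := hyx.map π.continuous
      have h2 : (π y.1).asHomogeneousIdeal ≤ (π x).asHomogeneousIdeal := by
        rw [specializes_iff_mem_closure] at h1
        exact (ProjectiveSpectrum.le_iff_mem_closure _ _ _).mpr h1
      have h3 : ξ ∉ (π y.1).asHomogeneousIdeal := fun h4 =>
        h.notMem_of_curve_mem hξ hdvd hξ1 (mem_of_mem_curve hx) hxe (h2 h4)
      have hye : π y.1 ∉ torusIdentity k w := fun h4 =>
        hxe (h1.mem_closed (torusIdentity k w).isClosed h4)
      by_cases hyX : ∃ i, X i ∈ (π y.1).asHomogeneousIdeal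
      · obtain ⟨i, hi⟩ := hyX
        have h4 := (c.ord_coord_of_X_mem hi hξ hξ0 hdeg).2
          fun h5 => h3 (Ideal.mem_of_dvd _ h5 hi)
        rw [c.divisor_apply_of_X_mem _ _ _ hi, h4]
        exact add_neg_cancel _
      · rw [c.divisor_apply_of_notMem _ _ _ hye (not_exists.mp hyX), zero_add]
        exact c.ord_coord_eq_zero hξ h3 hdeg fun i hi => absurd ⟨i, hi⟩ hyX
  · rw [hD]
    exact add_sub_cancel_left _ _

end IsBlowupCover

end DivisorsOfSections

/-! ### The triples of the weights -/

lemma exists_isTriple {m : ℕ} (hm : 0 < m) (hm3 : ¬ 3 ∣ m) :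
    ∃ p q, IsTriple m (weights m 0) (weights m 1) (weights m 2) p q := by
  have h1 : 2 * m ≤ 5 * m ^ 2 := by nlinarith
  have h2 : weights m 0 + 3 = 7 * m := by
    change 7 * m - 3 + 3 = 7 * m
    omega
  have h3 : weights m 1 + 2 * m = 5 * m ^ 2 := Nat.sub_add_cancel h1
  have h4 : weights m 2 + 3 = 8 * m := by
    change 8 * m - 3 + 3 = 8 * m
    omega
  obtain h5 | h5 : m % 3 = 1 ∨ m % 3 = 2 := by omega
  · exact ⟨2, (2 * m + 1) / 3, h2, h3, h4, by omega⟩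
  · exact ⟨1, (m + 1) / 3, h2, h3, h4, by omega⟩

end BlowUpPlane

theorem proposition4p3 {k : Type u} [Field k] [IsAlgClosed k] (m : ℕ) (hm : 4 ≤ m)
    (hm3 : ¬ 3 ∣ m) {X : Scheme.{u}}
    (π : X ⟶ BlowUpPlane.weightedPlane k (BlowUpPlane.weights m))
    (hπ : BlowUpPlane.IsBlowUpAtIdentity π)
    (r : Fin 3 → ℤ) (hr : ∑ i, r i * (BlowUpPlane.weights m i : ℤ) = 1) :
    ∃ (_ : AlgebraicGeometry.IsIntegral X) (_ : IsLocallyNoetherian X),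
      ∃ d₀ : ℕ, BlowUpPlane.degreeSet π r = {d : ℕ | ∃ n : ℕ, d = n * d₀} := by
  obtain ⟨p, q, h⟩ := BlowUpPlane.exists_isTriple (by omega) hm3
  obtain ⟨s, t, o, _, _, _, c⟩ := BlowUpPlane.exists_isBlowupCover h hπ
  have := c.isIntegral
  have := c.isLocallyNoetherian
  have := c.noetherianSpace
  refine ⟨inferInstance, inferInstance, ?_⟩
  obtain ⟨d₀, hd₀⟩ := BlowUpPlane.exists_forall_hasSection_iff (k := k) h
  refine ⟨d₀, Set.ext fun d => Iff.trans ?_ (hd₀ d)⟩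
  have hw : (d : ℤ) * (7 * m - 3) * (8 * m - 3) =
      (BlowUpPlane.weights m 0 : ℤ) * BlowUpPlane.weights m 2 * d := by
    have h1 : (BlowUpPlane.weights m 0 : ℤ) + 3 = 7 * m := by exact_mod_cast h.ha
    have h2 : (BlowUpPlane.weights m 2 : ℤ) + 3 = 8 * m := by exact_mod_cast h.hc
    rw [← h1, ← h2]
    ring
  have hdiv : BlowUpPlane.divisorD π r d =
      (BlowUpPlane.weights m 0 * BlowUpPlane.weights m 2 * d : ℤ) • BlowUpPlane.divisorA π r -
        (3 * d : ℤ) • BlowUpPlane.exceptionalDivisor π := by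
    rw [BlowUpPlane.divisorD, hw]
  constructor
  · rintro ⟨D, ⟨hD, hDC, -⟩, hlin⟩
    exact c.hasSection_of_linearlyEquivalent hr hD hDC (hdiv ▸ hlin)
  · intro hd
    obtain ⟨D, hD, hDC, hlin⟩ := c.exists_divisor_of_hasSection hr hd
    exact ⟨D, ⟨hD, fun x hx => hDC x.1 hx x specializes_rfl,
      BlowUpPlane.intersectionNumber_eq_zero hDC⟩, hdiv.symm ▸ hlin⟩
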